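/- Let $M$ be either a smooth variety over an algebraically closed field $\Bbbk$ of characteristic zero, or (with $\Bbbk=\mathbb{C}$) a complex analytic manifold. Let $X\subset M$ be a reduced closed subspace and let $Z$ be a connected component of $\mathrm{Sing}(X)$ with its reduced structure. Assume that $X$ and $Z$ are locally complete intersections in $M$, of codimensions $r$ and $k$. *Good generators.* Let $U\subset M$ be open. Functions $f_1,\dots,f_r$ on $U$ are called good generators of $I_X$ (along $Z$) with multiplicities $p_1,\dots,p_r$ if they generate $I_{X}$ at the points of $Z\cap U$, if on a dense open subset of $Z\cap U$ the function $f_i$ lies in $I_{Z}^{p_i}$ but not in $I_{Z}^{p_i+1}$, and if at every point of $Z\cap U$ the ideal of leading forms of $I_X$ in $\bigoplus_n I_Z^n/I_Z^{n+1}$ is generated by the leading forms of $f_1,\dots,f_r$ in degrees $p_1,\dots,p_r$. Assume that $X$ is a strictly complete intersection along $Z$: near each point of $Z$ good generators exist, with the same multiplicities $(p_1,\dots,p_r)$ everywhere along $Z$. *Expansions.* An expansion over $U$ consists of generators $g_1,\dots,g_k$ of $I_Z$ at the points of $Z\cap U$, good generators $f_1,\dots,f_r$ of $I_X$ (with multiplicities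 $p_i$) and functions $a^{(i)}_m$ on $U$ with $$f_i=\sum_{m_1+\dots+m_k=p_i} g_1^{m_1}\cdots g_k^{m_k}\,a^{(i)}_{m},\qquad i=1,\dots,r.$$ The transversal type of $X$ along $Z$ is ordinary at $x\in Z$ if for some expansion near $x$ the scheme $\bigcap_i\{\sum_m a^{(i)}_m(x)\,y^m=0\}\subset\mathbb{P}^{k-1}$ is (geometrically) a smooth complete intersection of dimension $k-1-r\ge 0$. Assume that this holds at all points of a dense open subset of $Z$. *The local equation.* Let $\Delta$ be the classical discriminant of multidegree $(p_1,\dots,p_r)$, i.e. the set of coefficient vectors over $\Bbbk$ of tuples of forms $(F_1,\dots,F_r)$ of degrees $p_i$ in $k$ variables such that $F_1=\dots=F_r=0$ in $\mathbb{P}^{k-1}$ is singular or not of codimension $r$ (at some common zero the Jacobian matrix of $(F_1,\dots,F_r)$ has rank less than $r$), and let $\mathfrak{D}$ be a generator of the ideal of all polynomials vanishing on $\Delta$. For an expansion over $U$, the local equation is the function $\mathfrak{D}^\perp=\mathfrak{D}(\{a^{(i)}_m\})$ on $U$, restricted to $Z\cap U$. Then: 1. Expansions exist near every point of $Z$; for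 the multidegree of each expansion over an open set meeting $Z$ the ideal of $\Delta$ is principal, so that $\mathfrak{D}$ exists. 2. The ideal of $\mathcal{O}_Z$ generated by $\mathfrak{D}^\perp$ is independent of the generators $g_j$ of $I_Z$, of the good generators $f_i$ of $I_X$ and of the coefficients $a^{(i)}_m$: for any two expansions, over $U$ and $U'$, the ideals generated in $\mathcal{O}_{Z,x}$ by the two local equations coincide for every $x\in Z\cap U\cap U'$. 3. The local equations are nonzerodivisors in the local rings of $Z$, and they glue: there is a unique effective Cartier divisor $\Delta^\perp\subset Z$ which over every $Z\cap U$ as above is defined by $\mathfrak{D}^\perp=0$. -/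

import Mathlib

open CategoryTheory TopologicalSpace Opposite AlgebraicGeometry

universe u v

noncomputable section

namespace TransversalDiscriminant

/-! ## The classical discriminant of complete intersections in projective space -/

section Classical

/-- Index set of the coefficients of `r` homogeneous forms in `k` variables of degrees
`p 0, …, p (r-1)`: pairs `(i, m)` with `m` a multi-index of total degree `p i`. -/
abbrev CoeffIdx {r : ℕ} (k : ℕ) (p : Fin r → ℕ) : Type :=
  Σ i : Fin r, {m : Fin k → ℕ // m ∈ Finset.piAntidiag Finset.univ (p i)}

variable {r k : ℕ} {p : Fin r → ℕ} {A : Type v} [CommRing A]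

/-- The `i`-th form `∑_{|m| = p i} a⁽ⁱ⁾_m y^m` with prescribed coefficients `a`. -/
def form (a : CoeffIdx k p → A) (i : Fin r) : MvPolynomial (Fin k) A :=
  ∑ m : {m : Fin k → ℕ // m ∈ Finset.piAntidiag Finset.univ (p i)},
    MvPolynomial.C (a ⟨i, m⟩) * ∏ j, MvPolynomial.X j ^ m.1 j

/-- The Jacobian matrix `(∂F_i / ∂y_j)` of the forms with coefficients `a`, evaluated at `y`. -/
def jacobian (a : CoeffIdx k p → A) (y : Fin k → A) : Matrix (Fin r) (Fin k) A :=
  Matrix.of fun i j => MvPolynomial.eval y (MvPolynomial.pderiv j (form a i))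

/-- The discriminant locus over an (algebraically closed) field `K`: tuples of forms of degrees `p`
in `k` variables whose common zero scheme in `ℙ^{k-1}` is singular or not of codimension `r`, i.e.
such that at some common zero in `ℙ^{k-1}(K)` the Jacobian matrix has rank less than `r`. -/
def discrLocus (K : Type v) [Field K] (k : ℕ) {r : ℕ} (p : Fin r → ℕ) :
    Set (CoeffIdx k p → K) :=
  {a | ∃ y : Fin k → K, y ≠ 0 ∧ (∀ i, MvPolynomial.eval y (form a i) = 0) ∧
    (jacobian a y).rank < r}

/-- `D` is the classical discriminant (well defined up to a nonzero constant): the discriminant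
locus is the (reduced) hypersurface `D = 0`, i.e. `D` generates its vanishing ideal. -/
def IsClassicalDiscriminant (K : Type v) [Field K] (k : ℕ) {r : ℕ} (p : Fin r → ℕ)
    (D : MvPolynomial (CoeffIdx k p) K) : Prop :=
  Ideal.span {D} = MvPolynomial.vanishingIdeal K (discrLocus K k p)

end Classical

/-! ## Ideal sheaves, closed subspaces, smooth points, complete intersections -/

/-- The ring of sections of the structure sheaf over an open set. -/
abbrev Sec (M : LocallyRingedSpace.{u}) (U : Opens M) : Type u := M.presheaf.obj (op U)

/-- Restriction of sections. -/
abbrev res (M : LocallyRingedSpace.{u}) {U V : Opens M} (h : U ≤ V) : Sec M V →+* Sec M U :=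
  (M.presheaf.map (homOfLE h).op).hom

/-- The local ring `𝒪_{M,x}`. -/
abbrev Stalk (M : LocallyRingedSpace.{u}) (x : M) : Type u := M.presheaf.stalk x

/-- The germ of a section at a point. -/
abbrev germ (M : LocallyRingedSpace.{u}) (U : Opens M) (x : M) (hx : x ∈ U) :
    Sec M U →+* Stalk M x :=
  (M.presheaf.germ U x hx).hom

/-- A sheaf of ideals of the structure sheaf of a locally ringed space. -/
@[ext]
structure IdealSheaf (M : LocallyRingedSpace.{u}) where
  /-- the ideal of sections over an open set -/
  ideal : ∀ U : Opens M, Ideal (Sec M U)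
  /-- stability under restriction -/
  res_mem : ∀ {U V : Opens M} (h : U ≤ V) (s : Sec M V), s ∈ ideal V → res M h s ∈ ideal U
  /-- membership is a local property -/
  of_local : ∀ (U : Opens M) (s : Sec M U),
    (∀ x ∈ U, ∃ (V : Opens M) (h : V ≤ U), x ∈ V ∧ res M h s ∈ ideal V) → s ∈ ideal U

/-- The stalk at `x` of an ideal sheaf, as an ideal of `𝒪_{M,x}`. -/
def IdealSheaf.stalk {M : LocallyRingedSpace.{u}} (J : IdealSheaf M) (x : M) :
    Ideal (Stalk M x) :=
  ⨆ (U : Opens M) (hx : x ∈ U), (J.ideal U).map (germ M U x hx)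

/-- The ideal sheaf of all functions vanishing on `Z`, i.e. the ideal sheaf of the closed set `Z`
with its reduced structure. -/
def vanishing (M : LocallyRingedSpace.{u}) (Z : Set M) : IdealSheaf M where
  ideal U :=
    ⨅ (x : M) (hx : x ∈ U) (_ : x ∈ Z),
      (IsLocalRing.maximalIdeal (Stalk M x)).comap (germ M U x hx)
  res_mem := by
    intro U V h s hs
    simp only [Ideal.mem_iInf, Ideal.mem_comap] at hs ⊢
    intro x hx hZ
    have := hs x (h hx) hZ
    rwa [← TopCat.Presheaf.germ_res_apply M.presheaf (homOfLE h) x hx s] at this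
  of_local := by
    intro U s hs
    simp only [Ideal.mem_iInf, Ideal.mem_comap] at hs ⊢
    intro x hx hZ
    obtain ⟨V, h, hV, H⟩ := hs x hx
    have := H x hV hZ
    rwa [TopCat.Presheaf.germ_res_apply M.presheaf (homOfLE h) x hV s] at this

/-- The ideal `I_{(Z/M,x)} ⊆ 𝒪_{M,x}` of the reduced germ of `Z` at `x`. -/
abbrev idealAt (M : LocallyRingedSpace.{u}) (Z : Set M) (x : M) : Ideal (Stalk M x) :=
  (vanishing M Z).stalk x

/-- The local ring `𝒪_{Z,x} = 𝒪_{M,x} / I_{(Z/M,x)}` of the reduced closed subspace `Z`. -/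
abbrev SubStalk (M : LocallyRingedSpace.{u}) (Z : Set M) (x : M) : Type u :=
  Stalk M x ⧸ idealAt M Z x

/-- The image in `𝒪_{Z,x}` of a function on an open set of `M`. -/
abbrev germOn (M : LocallyRingedSpace.{u}) (Z : Set M) (U : Opens M) (x : M) (hx : x ∈ U) :
    Sec M U →+* SubStalk M Z x :=
  (Ideal.Quotient.mk (idealAt M Z x)).comp (germ M U x hx)

/-- The reduced closed subspace `X` of the smooth space `M` is smooth at `x`: its ideal at `x` is
generated by a part of a system of local coordinates, i.e. by elements of the maximal ideal `𝔪`
which are linearly independent in `𝔪 / 𝔪²`. -/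
def IsSmoothPt (M : LocallyRingedSpace.{u}) (X : Set M) (x : M) : Prop :=
  ∃ (s : ℕ) (h : Fin s → IsLocalRing.maximalIdeal (Stalk M x)),
    Ideal.span (Set.range fun i => (h i : Stalk M x)) = idealAt M X x ∧
    LinearIndependent (IsLocalRing.ResidueField (Stalk M x))
      (fun i => (IsLocalRing.maximalIdeal (Stalk M x)).toCotangent (h i))

/-- The singular locus of the reduced closed subspace `X`. -/
def singularLocus (M : LocallyRingedSpace.{u}) (X : Set M) : Set M :=
  {x ∈ X | ¬ IsSmoothPt M X x}

/-- The reduced closed subspace `Y` is a locally complete intersection of codimension `c`: locally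
its ideal sheaf is generated by `c` functions, forming a regular sequence at the points of `Y`. -/
def IsLCI (M : LocallyRingedSpace.{u}) (Y : Set M) (c : ℕ) : Prop :=
  ∀ y ∈ Y, ∃ (U : Opens M) (f : Fin c → Sec M U), y ∈ U ∧ ∀ (x : M) (hx : x ∈ U),
    Ideal.span (Set.range fun i => germ M U x hx (f i)) = idealAt M Y x ∧
    (x ∈ Y → RingTheory.Sequence.IsRegular (Stalk M x)
      (List.ofFn fun i => germ M U x hx (f i)))

/-! ## Good bases, expansions and ordinary transversal type -/

/-- The functions `f i` on `U` are good generators of the ideal of `X` along `Z`, with multiplicity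
sequence `p`. -/
structure IsGoodBasis (M : LocallyRingedSpace.{u}) (X Z : Set M) {r : ℕ} (U : Opens M)
    (p : Fin r → ℕ) (f : Fin r → Sec M U) : Prop where
  /-- the `f i` generate the ideal of `X` at the points of `Z ∩ U` -/
  span_eq : ∀ (x : M) (hx : x ∈ U), x ∈ Z →
    Ideal.span (Set.range fun i => germ M U x hx (f i)) = idealAt M X x
  /-- the generic multiplicity of `f i` along `Z` (along every irreducible component) is `p i`:
  on a dense open subset of `Z ∩ U`, the function `f i` lies in the `p i`-th power of the ideal of
  `Z`, but not in the next one -/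
  mult : ∃ W : Opens M, (U : Set M) ∩ Z ⊆ closure ((W : Set M) ∩ Z) ∧
    ∀ (x : M) (hx : x ∈ U), x ∈ W → x ∈ Z → ∀ i,
      germ M U x hx (f i) ∈ idealAt M Z x ^ p i ∧
      germ M U x hx (f i) ∉ idealAt M Z x ^ (p i + 1)
  /-- the ideal, in the associated graded ring `⨁ I_Z^n / I_Z^{n+1}`, of the cone of `X` along `Z`
  is generated by the leading terms of the `f i` (of degrees `p i`): the leading term of order `n`
  of any element of `I_X ∩ I_Z^n` is a combination of these leading terms -/
  leading : ∀ (x : M) (hx : x ∈ U), x ∈ Z → ∀ n : ℕ,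
    idealAt M X x ⊓ idealAt M Z x ^ n ≤
      (⨆ (i : Fin r) (_ : p i ≤ n),
        Ideal.span {germ M U x hx (f i)} * idealAt M Z x ^ (n - p i)) ⊔ idealAt M Z x ^ (n + 1)

/-- All the choices entering the local equation of the discriminant over an open set `U`:
generators `g` of the ideal of `Z`, good generators `f` of the ideal of `X` and coefficients `a`
with `f i = ∑_{|m| = p i} a⁽ⁱ⁾_m g^m`. -/
structure Expansion (M : LocallyRingedSpace.{u}) (X Z : Set M) (k r : ℕ) (U : Opens M) where
  /-- the multiplicity sequence -/
  p : Fin r → ℕ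
  /-- generators of the ideal of `Z` -/
  g : Fin k → Sec M U
  /-- good generators of the ideal of `X` -/
  f : Fin r → Sec M U
  /-- coefficients of the `f i` in the expansion in powers of the `g j` -/
  a : CoeffIdx k p → Sec M U
  span_g : ∀ (x : M) (hx : x ∈ U), x ∈ Z →
    Ideal.span (Set.range fun j => germ M U x hx (g j)) = idealAt M Z x
  good : IsGoodBasis M X Z U p f
  expand : ∀ i, f i = MvPolynomial.eval g (form a i)

/-- The values at `x` of the coefficients of an expansion, in an algebraic closure of the residue
field of `x`. -/
def Expansion.valueAt {M : LocallyRingedSpace.{u}} {X Z : Set M} {k r : ℕ} {U : Opens M}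
    (E : Expansion M X Z k r U) (x : M) (hx : x ∈ U) :
    CoeffIdx k E.p → AlgebraicClosure (IsLocalRing.ResidueField (Stalk M x)) :=
  fun c => algebraMap (IsLocalRing.ResidueField (Stalk M x)) _
    (IsLocalRing.residue (Stalk M x) (germ M U x hx (E.a c)))

/-- `X` has ordinary transversal type along `Z` at `x`: the projectivised virtual normal cone
`⋂ᵢ {∑ a⁽ⁱ⁾_m(x) y^m = 0} ⊆ ℙ^{k-1}` is a smooth complete intersection of dimension
`dim X - dim Z - 1 = k - r - 1 ≥ 0`. -/
def IsOrdinaryAt (M : LocallyRingedSpace.{u}) (X Z : Set M) (k r : ℕ) (x : M) : Prop :=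
  r < k ∧ ∃ (U : Opens M) (hx : x ∈ U) (E : Expansion M X Z k r U),
    E.valueAt x hx ∉
      discrLocus (AlgebraicClosure (IsLocalRing.ResidueField (Stalk M x))) k E.p

/-- The standing assumptions on `Z ⊆ X ⊆ M`. -/
structure IsSetup (M : LocallyRingedSpace.{u}) (X Z : Set M) (k r : ℕ) : Prop where
  closed_X : IsClosed X
  closed_Z : IsClosed Z
  /-- `Z` is a connected component of the singular locus of `X` -/
  component : ∃ x ∈ singularLocus M X, Z = connectedComponentIn (singularLocus M X) x
  /-- `X` is a locally complete intersection of codimension `r` -/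
  lci_X : IsLCI M X r
  /-- `Z` (with the reduced structure) is a locally complete intersection of codimension `k` -/
  lci_Z : IsLCI M Z k
  /-- `X` is a strictly complete intersection along `Z` (good generators exist locally), with the
  same generic multiplicity sequence along all components of `Z` -/
  strict : ∃ p : Fin r → ℕ, ∀ z ∈ Z, ∃ (U : Opens M) (f : Fin r → Sec M U),
    z ∈ U ∧ IsGoodBasis M X Z U p f
  /-- the transversal type is ordinary at the points of a dense open subset of `Z` -/
  ordinary : ∃ W : Opens M, Z ⊆ closure ((W : Set M) ∩ Z) ∧
    ∀ x ∈ W, x ∈ Z → IsOrdinaryAt M X Z k r x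

/-! ## The discriminant of the transversal type -/

/-- The structure map of a `K`-space, `c : K → 𝒪(M)`, followed by restriction to `U`. -/
def const {M : LocallyRingedSpace.{u}} {K : Type v} [Field K] (c : K →+* Sec M ⊤)
    (U : Opens M) : K →+* Sec M U :=
  (res M le_top).comp c

/-- The local equation `𝔇^⊥`: the classical discriminant evaluated at the coefficients `a`. -/
def Expansion.localEquation {M : LocallyRingedSpace.{u}} {X Z : Set M} {k r : ℕ} {U : Opens M}
    (E : Expansion M X Z k r U) {K : Type v} [Field K] (c : K →+* Sec M ⊤)
    (D : MvPolynomial (CoeffIdx k E.p) K) : Sec M U :=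
  MvPolynomial.eval₂ (const c U) E.a D

/-- The ideal generated by the local equation in `𝒪_{Z,x}`. -/
def Expansion.localIdeal {M : LocallyRingedSpace.{u}} {X Z : Set M} {k r : ℕ} {U : Opens M}
    (E : Expansion M X Z k r U) {K : Type v} [Field K] (c : K →+* Sec M ⊤)
    (D : MvPolynomial (CoeffIdx k E.p) K) (x : M) (hx : x ∈ U) : Ideal (SubStalk M Z x) :=
  Ideal.span {germOn M Z U x hx (E.localEquation c D)}

/-- The closed subspace with ideal sheaf `J` is an effective Cartier divisor on the reduced closed
subspace `Z`: it is contained in `Z`, and locally on `Z` it is defined in `Z` by one equation which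
is a nonzerodivisor in the local rings of `Z`. -/
def IsEffectiveCartierOn (M : LocallyRingedSpace.{u}) (Z : Set M) (J : IdealSheaf M) : Prop :=
  (∀ U, (vanishing M Z).ideal U ≤ J.ideal U) ∧
  ∀ z ∈ Z, ∃ (U : Opens M) (d : Sec M U), z ∈ U ∧ ∀ (x : M) (hx : x ∈ U), x ∈ Z →
    (J.stalk x).map (Ideal.Quotient.mk (idealAt M Z x)) = Ideal.span {germOn M Z U x hx d} ∧
    germOn M Z U x hx d ∈ nonZeroDivisors (SubStalk M Z x)

/-- The discriminant of the transversal type of `X` along `Z` is a well defined effective Cartier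
divisor on `Z`. -/
structure HasTransversalDiscriminant {M : LocallyRingedSpace.{u}} {K : Type v} [Field K]
    (c : K →+* Sec M ⊤) (X Z : Set M) (k r : ℕ) : Prop where
  /-- local data (hence local equations) exist around every point of `Z` -/
  exists_expansion : ∀ z ∈ Z, ∃ U : Opens M, z ∈ U ∧ Nonempty (Expansion M X Z k r U)
  /-- the classical discriminant is a hypersurface, defined by one equation, for the multidegree of
  every expansion -/
  exists_discriminant : ∀ (U : Opens M) (E : Expansion M X Z k r U), ((U : Set M) ∩ Z).Nonempty →
    ∃ D, IsClassicalDiscriminant K k E.p D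
  /-- the ideal generated by the local equation is independent of all the choices: the generators
  of the ideal of `Z`, the good generators of the ideal of `X`, the coefficients (and of the
  scaling of the classical discriminant) -/
  independent : ∀ (U U' : Opens M) (E : Expansion M X Z k r U) (E' : Expansion M X Z k r U') (D D'),
    IsClassicalDiscriminant K k E.p D → IsClassicalDiscriminant K k E'.p D' →
    ∀ (x : M) (hx : x ∈ U) (hx' : x ∈ U'), x ∈ Z →
      E.localIdeal c D x hx = E'.localIdeal c D' x hx'
  /-- the local equations glue to a unique effective Cartier divisor on `Z` -/
  glue : ∃! J : IdealSheaf M, IsEffectiveCartierOn M Z J ∧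
    ∀ (U : Opens M) (E : Expansion M X Z k r U) (D), IsClassicalDiscriminant K k E.p D →
      ∀ (x : M) (hx : x ∈ U), x ∈ Z →
        (J.stalk x).map (Ideal.Quotient.mk (idealAt M Z x)) = E.localIdeal c D x hx ∧
        germOn M Z U x hx (E.localEquation c D) ∈ nonZeroDivisors (SubStalk M Z x)

/-! ## The two kinds of ambient spaces -/

/-- The structure map `K → 𝒪(M)` of a scheme over a field `K`. -/
def schemeConst {K : Type u} [Field K] {M : Scheme.{u}} (π : M ⟶ Spec (CommRingCat.of K)) :
    K →+* Sec M.toLocallyRingedSpace ⊤ :=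
  ((Scheme.ΓSpecIso (CommRingCat.of K)).inv ≫ π.appTop).hom

section Manifold

open scoped Manifold ContDiff

variable (E : Type v) [NormedAddCommGroup E] [NormedSpace ℂ E]
  (M : Type) [TopologicalSpace M] [ChartedSpace E M]

/-- A complex manifold as a locally ringed space, with its sheaf of holomorphic functions (complex
`C^∞` functions). -/
abbrev complexSpace : LocallyRingedSpace.{0} :=
  ChartedSpace.locallyRingedSpace (𝓘(ℂ, E)) M

/-- The constant functions on a complex manifold. -/
def manifoldConst : ℂ →+* Sec (complexSpace E M) ⊤ :=
  (algebraMap ℂ C^∞⟮𝓘(ℂ, E), (⊤ : Opens M); 𝓘(ℂ), ℂ⟯ :)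

end Manifold

end TransversalDiscriminant

end

/-! Incidence. A tuple of forms lies in Δ exactly when some `y ≠ 0` is a common zero and some
covector `l ≠ 0` kills the Jacobian matrix at `y` (`mem_discrLocus_iff`). All such triples are
specialisations of one polynomial family, `univTuple`, so the ideal of Δ is the kernel of a
homomorphism into a domain. Hence it is prime, it vanishes at incident tuples over every `K`-algebra
as soon as `y` and `l` are unimodular (`aeval_eq_zero_of_isIncident`), and, projective spaces being
proper, its zeros over an algebraically closed extension are again discriminant tuples
(`mem_discrLocus_of_forall_aeval_eq_zero`).

Principality. If `r < k` and some `p i₀ ≥ 2`, a tuple with a node can be deformed in every direction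
and to every order so that it stays incident, at the price of correcting one coefficient `c₀`. So no
nonzero polynomial free of `c₀` vanishes on Δ, and a prime ideal with this property is principal
(`exists_isClassicalDiscriminant`). That some multiplicity is at least 2 comes from geometry
(`IsSetup.exists_two_le`): otherwise `X` would be smooth at an ordinary point of `Z` where
generators of the ideal of `Z` are independent modulo `𝔪²`. Such points exist by
`HasGenericSmoothness`, obtained at a generic point of a component in the scheme case and from a
constant rank argument in the complex analytic case.

Independence. Generators of the ideal of `Z` are quasi-regular: a form of degree `n` in them with
value in `I_Z^(n+1)` has coefficients in `I_Z`. Together with the condition on leading forms, this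
relates the coefficient tuples of two expansions over `𝒪_{Z,x}` by a linear substitution and a
matrix of forms (`exists_transform_of_expansions`). Such a change preserves the vanishing of the
ideal of Δ over any ring (`aeval_eq_zero_of_transform`). Applied over the quotient of `𝒪_{Z,x}` by
one local equation, this shows that the other lies in the ideal of the first, and conversely; no
explicit transformation formula for the discriminant is needed.

Divisor. At ordinary points the local equation is a unit; these points are dense in `Z` and `Z` is
reduced, so the local equation is a nonzerodivisor everywhere. The divisor is the sheaf of all
functions whose germs lie in the local ideals, and an ideal sheaf containing that of `Z` is
determined by its images in the rings `𝒪_{Z,x}`. -/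

noncomputable section

namespace TransversalDiscriminant

/-! ## Tuples of forms and their coefficients -/

section Forms

open MvPolynomial

variable {r k : ℕ} {p : Fin r → ℕ} {A : Type*} [CommRing A] {B : Type*} [CommRing B]

/-- The coefficients, in the degrees `p i`, of a tuple of polynomials. -/
def coeffTuple (p : Fin r → ℕ) (F : Fin r → MvPolynomial (Fin k) A) : CoeffIdx k p → A :=
  fun c => coeff (Finsupp.equivFunOnFinite.symm c.2.1) (F c.1)

theorem coeffIdx_degree (i : Fin r)
    (m : {m : Fin k → ℕ // m ∈ Finset.piAntidiag Finset.univ (p i)}) :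
    (Finsupp.equivFunOnFinite.symm m.1).degree = p i := by
  have := (Finset.mem_piAntidiag.1 m.2).1
  rw [Finsupp.degree_eq_sum]
  simpa using this

theorem form_eq_sum_monomial (a : CoeffIdx k p → A) (i : Fin r) :
    form a i = ∑ m : {m : Fin k → ℕ // m ∈ Finset.piAntidiag Finset.univ (p i)},
      monomial (Finsupp.equivFunOnFinite.symm m.1) (a ⟨i, m⟩) := by
  refine Finset.sum_congr rfl fun m _ => ?_
  rw [monomial_eq, Finsupp.prod_fintype _ _ (by simp)]
  simp

theorem form_isHomogeneous (a : CoeffIdx k p → A) (i : Fin r) :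
    (form a i).IsHomogeneous (p i) := by
  rw [form_eq_sum_monomial]
  exact IsHomogeneous.sum _ _ _ fun m _ => isHomogeneous_monomial _ (coeffIdx_degree i m)

theorem coeffTuple_form (a : CoeffIdx k p → A) : coeffTuple p (form a) = a := by
  funext ⟨i, m⟩
  simp only [coeffTuple, form_eq_sum_monomial, coeff_sum, coeff_monomial]
  rw [Finset.sum_eq_single m]
  · simp
  · intro b _ hb
    rw [if_neg]
    intro h
    exact hb (Subtype.ext (Finsupp.equivFunOnFinite.symm.injective h))
  · simp

theorem form_coeffTuple {F : Fin r → MvPolynomial (Fin k) A} {i : Fin r}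
    (hF : (F i).IsHomogeneous (p i)) : form (coeffTuple p F) i = F i := by
  ext m
  by_cases hm : m.degree = p i
  · have hm' : (m : Fin k → ℕ) ∈ Finset.piAntidiag Finset.univ (p i) := by
      simpa [Finset.mem_piAntidiag, Finsupp.degree_eq_sum] using hm
    have h1 := congrFun (coeffTuple_form (coeffTuple p F)) ⟨i, ⟨m, hm'⟩⟩
    simpa [coeffTuple] using h1
  · rw [(form_isHomogeneous _ i).coeff_eq_zero hm, hF.coeff_eq_zero hm]

theorem map_form (f : A →+* B) (a : CoeffIdx k p → A) (i : Fin r) :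
    map f (form a i) = form (f ∘ a) i := by
  simp [form]

theorem eval_form_map (f : A →+* B) (a : CoeffIdx k p → A) (y : Fin k → A) (i : Fin r) :
    eval (f ∘ y) (form (f ∘ a) i) = f (eval y (form a i)) := by
  rw [← map_form, map_eval]

theorem eval_pderiv_form_map (f : A →+* B) (a : CoeffIdx k p → A) (y : Fin k → A) (i : Fin r)
    (j : Fin k) :
    eval (f ∘ y) (pderiv j (form (f ∘ a) i)) = f (eval y (pderiv j (form a i))) := by
  rw [← map_form, pderiv_map, map_eval]

theorem sum_mul_eval_pderiv {F : MvPolynomial (Fin k) A} {n : ℕ} (hF : F.IsHomogeneous n)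
    (y : Fin k → A) : ∑ j, y j * eval y (pderiv j F) = n * eval y F := by
  have := congrArg (eval y) hF.sum_X_mul_pderiv
  simpa using this

/-- `(y, l)` exhibits a point of the projective zero locus of the forms with coefficients `a` at
which the Jacobian matrix drops rank. -/
structure IsIncident (a : CoeffIdx k p → A) (y : Fin k → A) (l : Fin r → A) : Prop where
  eval_eq : ∀ i, eval y (form a i) = 0
  grad_eq : ∀ j, ∑ i, l i * eval y (pderiv j (form a i)) = 0

theorem IsIncident.map (f : A →+* B) {a : CoeffIdx k p → A} {y : Fin k → A} {l : Fin r → A}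
    (h : IsIncident a y l) : IsIncident (f ∘ a) (f ∘ y) (f ∘ l) where
  eval_eq i := by rw [eval_form_map, h.eval_eq, map_zero]
  grad_eq j := by
    simp only [eval_pderiv_form_map, Function.comp_apply, ← map_mul, ← map_sum]
    rw [h.grad_eq, map_zero]

theorem IsIncident.of_map {f : A →+* B} (hf : Function.Injective f) {a : CoeffIdx k p → A}
    {y : Fin k → A} {l : Fin r → A} (h : IsIncident (f ∘ a) (f ∘ y) (f ∘ l)) :
    IsIncident a y l where
  eval_eq i := hf <| by rw [← eval_form_map, h.eval_eq, map_zero]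
  grad_eq j := hf <| by
    rw [map_zero, ← h.grad_eq j]
    simp only [eval_pderiv_form_map, Function.comp_apply, ← map_mul, ← map_sum]

theorem eval_smul_of_isHomogeneous {F : MvPolynomial (Fin k) A} {n : ℕ} (hF : F.IsHomogeneous n)
    (c : A) (y : Fin k → A) : eval (c • y) F = c ^ n * eval y F := by
  rw [eval_eq, eval_eq, Finset.mul_sum]
  refine Finset.sum_congr rfl fun d hd => ?_
  have hd' : ∑ i, d i = n := by
    rw [← Finsupp.degree_eq_sum]
    by_contra h
    exact (mem_support_iff.1 hd) (hF.coeff_eq_zero h)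
  have h2 : ∀ z : Fin k → A, ∏ i ∈ d.support, z i ^ d i = ∏ i, z i ^ d i := fun z =>
    Finset.prod_subset (Finset.subset_univ _) fun i _ hi => by
      simp [Finsupp.notMem_support_iff.1 hi]
  rw [h2, h2]
  simp only [Pi.smul_apply, smul_eq_mul, mul_pow, Finset.prod_mul_distrib,
    Finset.prod_pow_eq_pow_sum, hd']
  ring

/-- Scaling the point by `c` multiplies the `i`-th gradient by `c ^ (p i - 1)`, which varies with
`i`. The covector compensates by filling each exponent up to the common value `∑ i, p i`, so `c`
need not be invertible. -/
theorem IsIncident.smul {a : CoeffIdx k p → A} {y : Fin k → A} {l : Fin r → A}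
    (h : IsIncident a y l) (c : A) :
    IsIncident a (c • y) (fun i => c ^ (∑ i, p i - (p i - 1)) * l i) := by
  refine ⟨fun i => ?_, fun j => ?_⟩
  · rw [eval_smul_of_isHomogeneous (form_isHomogeneous a i), h.eval_eq, mul_zero]
  · have h1 := congrArg (c ^ (∑ i, p i) * ·) (h.grad_eq j)
    simp only [Finset.mul_sum, mul_zero] at h1
    rw [← h1]
    refine Finset.sum_congr rfl fun i _ => ?_
    rw [eval_smul_of_isHomogeneous (form_isHomogeneous a i).pderiv]
    have h2 : p i ≤ ∑ i, p i := Finset.single_le_sum (fun _ _ => Nat.zero_le _) (Finset.mem_univ i)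
    have h3 : c ^ (∑ i, p i) = c ^ (∑ i, p i - (p i - 1)) * c ^ (p i - 1) := by
      rw [← pow_add]; congr 1; omega
    rw [h3]; ring

theorem IsIncident.smul_right {a : CoeffIdx k p → A} {y : Fin k → A} {l : Fin r → A}
    (h : IsIncident a y l) (c : A) : IsIncident a y (c • l) := by
  refine ⟨h.eval_eq, fun j => ?_⟩
  have h1 := congrArg (c * ·) (h.grad_eq j)
  simpa only [Finset.mul_sum, mul_zero, Pi.smul_apply, smul_eq_mul, mul_assoc] using h1

/-- A matrix with `r` rows has rank below `r` exactly when a nonzero covector kills it from the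
left. This replaces a rank condition by equations, which survive ring homomorphisms. -/
theorem mem_discrLocus_iff {K : Type*} [Field K] {a : CoeffIdx k p → K} :
    a ∈ discrLocus K k p ↔ ∃ y ≠ 0, ∃ l ≠ 0, IsIncident a y l := by
  have key : ∀ J : Matrix (Fin r) (Fin k) K, J.rank < r ↔
      ∃ l : Fin r → K, l ≠ 0 ∧ ∀ j, ∑ i, l i * J i j = 0 := by
    intro J
    have h1 : J.rank < r ↔ ¬ LinearIndependent K J.row := by
      rw [linearIndependent_iff_card_eq_finrank_span, Set.finrank,
        ← Matrix.rank_eq_finrank_span_row, Fintype.card_fin]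
      have := J.rank_le_height
      omega
    rw [h1, Fintype.not_linearIndependent_iff]
    refine exists_congr fun l => ?_
    rw [and_comm]
    refine and_congr ?_ ?_
    · simp [funext_iff]
    · simp [funext_iff, Matrix.row]
  constructor
  · rintro ⟨y, hy, h0, hJ⟩
    obtain ⟨l, hl, h⟩ := (key _).1 hJ
    exact ⟨y, hy, l, hl, h0, h⟩
  · rintro ⟨y, hy, l, hl, h⟩
    exact ⟨y, hy, h.eval_eq, (key _).2 ⟨l, hl, h.grad_eq⟩⟩

end Forms

/-! ## The universal incident tuple of forms -/

section Universal

open MvPolynomial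

variable {r k : ℕ} {p : Fin r → ℕ} {A : Type*} [CommRing A] {B : Type*} [CommRing B]

/-- The linear form with coefficients `w`. -/
def linForm (w : Fin k → A) : MvPolynomial (Fin k) A := ∑ j, C (w j) * X j

theorem linForm_isHomogeneous (w : Fin k → A) : (linForm w).IsHomogeneous 1 :=
  IsHomogeneous.sum _ _ _ fun j _ => isHomogeneous_C_mul_X _ j

theorem map_linForm (f : A →+* B) (w : Fin k → A) : map f (linForm w) = linForm (f ∘ w) := by
  simp [linForm]

theorem eval_linForm (w y : Fin k → A) : eval y (linForm w) = ∑ j, w j * y j := by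
  simp [linForm]

theorem pderiv_linForm (w : Fin k → A) (j : Fin k) : pderiv j (linForm w) = C (w j) := by
  simp [linForm, pderiv_X, Pi.single_apply]

/-- Correct the forms with coefficients `b` so that they vanish at `y`. -/
def vanishingForm (y s : Fin k → A) (b : CoeffIdx k p → A) (i : Fin r) : MvPolynomial (Fin k) A :=
  C (eval y (linForm s) ^ p i) * form b i - C (eval y (form b i)) * linForm s ^ p i

/-- The combination of the gradients of the corrected forms at `y`. -/
def gradForm (y : Fin k → A) (l : Fin r → A) (s : Fin k → A) (b : CoeffIdx k p → A) (j : Fin k) :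
    A :=
  ∑ i, l i * eval y (pderiv j (vanishingForm y s b i))

/-- Correct the forms with coefficients `b` so that `(y, l)` becomes incident to them. -/
def incidentForm (y : Fin k → A) (l : Fin r → A) (s : Fin k → A) (t : Fin r → A)
    (b : CoeffIdx k p → A) (i : Fin r) : MvPolynomial (Fin k) A :=
  C ((∑ i, t i * l i) * eval y (linForm s) ^ (∑ i, p i)) * vanishingForm y s b i -
    C (t i * eval y (linForm s) ^ (∑ i, p i + 1 - p i)) *
      (linForm s ^ (p i - 1) * linForm (gradForm y l s b))

theorem vanishingForm_isHomogeneous (y s : Fin k → A) (b : CoeffIdx k p → A) (i : Fin r) :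
    (vanishingForm y s b i).IsHomogeneous (p i) := by
  refine ((form_isHomogeneous b i).C_mul _).sub (IsHomogeneous.C_mul ?_ _)
  simpa using (linForm_isHomogeneous s).pow (p i)

theorem eval_vanishingForm (y s : Fin k → A) (b : CoeffIdx k p → A) (i : Fin r) :
    eval y (vanishingForm y s b i) = 0 := by
  simp [vanishingForm]; ring

theorem incidentForm_isHomogeneous (y : Fin k → A) (l : Fin r → A) (s : Fin k → A) (t : Fin r → A)
    (b : CoeffIdx k p → A) {i : Fin r} (hp : 1 ≤ p i) :
    (incidentForm y l s t b i).IsHomogeneous (p i) := by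
  refine ((vanishingForm_isHomogeneous y s b i).C_mul _).sub (IsHomogeneous.C_mul ?_ _)
  have := ((linForm_isHomogeneous s).pow (p i - 1)).mul (linForm_isHomogeneous (gradForm y l s b))
  rwa [one_mul, Nat.sub_add_cancel hp] at this

/-- Euler's identity: the corrected forms vanish at `y`, so their radial derivatives there vanish
too. Hence the gradient correction in `incidentForm` does not spoil vanishing at `y`. -/
theorem eval_linForm_gradForm (y : Fin k → A) (l : Fin r → A) (s : Fin k → A)
    (b : CoeffIdx k p → A) : eval y (linForm (gradForm y l s b)) = 0 := by
  simp only [eval_linForm, gradForm, Finset.sum_mul]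
  rw [Finset.sum_comm]
  refine Finset.sum_eq_zero fun i _ => ?_
  have := sum_mul_eval_pderiv (vanishingForm_isHomogeneous y s b i) y
  rw [eval_vanishingForm, mul_zero] at this
  rw [← mul_zero (l i), ← this, Finset.mul_sum]
  exact Finset.sum_congr rfl fun j _ => by ring

theorem eval_incidentForm (y : Fin k → A) (l : Fin r → A) (s : Fin k → A) (t : Fin r → A)
    (b : CoeffIdx k p → A) (i : Fin r) : eval y (incidentForm y l s t b i) = 0 := by
  simp [incidentForm, eval_vanishingForm, eval_linForm_gradForm]

/-- The last linear factor of the subtracted term vanishes at `y`, so only its own derivative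
survives there. The exponent `∑ i, p i + 1 - p i` makes the resulting power of `s(y)` the same for
all `i`; weighting by `l i` then produces `∑ i, t i * l i`, and the two contributions cancel. -/
theorem sum_eval_pderiv_incidentForm (y : Fin k → A) (l : Fin r → A) (s : Fin k → A)
    (t : Fin r → A) (b : CoeffIdx k p → A) (hp : ∀ i, 1 ≤ p i) (j : Fin k) :
    ∑ i, l i * eval y (pderiv j (incidentForm y l s t b i)) = 0 := by
  have h1 : ∀ i, eval y (pderiv j (incidentForm y l s t b i)) =
      (∑ i, t i * l i) * eval y (linForm s) ^ (∑ i, p i) *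
        eval y (pderiv j (vanishingForm y s b i)) -
      t i * eval y (linForm s) ^ (∑ i, p i) * gradForm y l s b j := by
    intro i
    have h2 : p i ≤ ∑ i, p i := Finset.single_le_sum (fun _ _ => Nat.zero_le _) (Finset.mem_univ i)
    have h3 : eval y (linForm s) ^ (∑ i, p i) =
        eval y (linForm s) ^ (∑ i, p i + 1 - p i) * eval y (linForm s) ^ (p i - 1) := by
      rw [← pow_add]; congr 1; have := hp i; omega
    rw [incidentForm]
    simp only [map_sub, pderiv_C, mul_zero, Derivation.leibniz, smul_eq_mul, map_mul, map_add,
      eval_C, eval_linForm_gradForm, pderiv_linForm, zero_mul, add_zero]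
    rw [h3]; simp only [map_pow]; ring
  simp only [h1, mul_sub, Finset.sum_sub_distrib]
  have h4 : ∀ i, l i * ((∑ i, t i * l i) * eval y (linForm s) ^ (∑ i, p i) *
        eval y (pderiv j (vanishingForm y s b i))) =
      (∑ i, t i * l i) * eval y (linForm s) ^ (∑ i, p i) *
        (l i * eval y (pderiv j (vanishingForm y s b i))) := fun i => by ring
  have h5 : ∀ i, l i * (t i * eval y (linForm s) ^ (∑ i, p i) * gradForm y l s b j) =
      (t i * l i) * (eval y (linForm s) ^ (∑ i, p i) * gradForm y l s b j) := fun i => by ring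
  simp only [h4, h5, ← Finset.mul_sum, ← Finset.sum_mul]
  rw [gradForm]; ring

/-- The coefficients of the corrected forms. -/
def incidentTuple (y : Fin k → A) (l : Fin r → A) (s : Fin k → A) (t : Fin r → A)
    (b : CoeffIdx k p → A) : CoeffIdx k p → A :=
  coeffTuple p (incidentForm y l s t b)

theorem isIncident_incidentTuple (y : Fin k → A) (l : Fin r → A) (s : Fin k → A) (t : Fin r → A)
    (b : CoeffIdx k p → A) (hp : ∀ i, 1 ≤ p i) : IsIncident (incidentTuple y l s t b) y l := by
  have h : ∀ i, form (incidentTuple y l s t b) i = incidentForm y l s t b i := fun i =>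
    form_coeffTuple (incidentForm_isHomogeneous y l s t b (hp i))
  refine ⟨fun i => ?_, fun j => ?_⟩
  · rw [h, eval_incidentForm]
  · simp only [h]
    exact sum_eval_pderiv_incidentForm y l s t b hp j

/-- Under these normalisations every correction term is zero. So the universal tuple specialises to
each incident tuple whose `y` and `l` are unimodular, which is what makes it universal. -/
theorem incidentTuple_eq_self {y : Fin k → A} {l : Fin r → A} {s : Fin k → A} {t : Fin r → A}
    {b : CoeffIdx k p → A} (hb : IsIncident b y l) (hs : ∑ j, s j * y j = 1)
    (ht : ∑ i, t i * l i = 1) : incidentTuple y l s t b = b := by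
  have h1 : ∀ i, vanishingForm y s b i = form b i := fun i => by
    simp [vanishingForm, hb.eval_eq, eval_linForm, hs]
  have h2 : gradForm y l s b = 0 := by
    funext j
    simp only [gradForm, h1, hb.grad_eq, Pi.zero_apply]
  have h3 : incidentForm y l s t b = form b := by
    funext i
    simp [incidentForm, h1, h2, ht, hs, linForm]
  rw [incidentTuple, h3, coeffTuple_form]

theorem comp_incidentTuple (f : A →+* B) (y : Fin k → A) (l : Fin r → A) (s : Fin k → A)
    (t : Fin r → A) (b : CoeffIdx k p → A) :
    f ∘ incidentTuple y l s t b = incidentTuple (f ∘ y) (f ∘ l) (f ∘ s) (f ∘ t) (f ∘ b) := by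
  have h0 : f (eval y (linForm s)) = eval (f ∘ y) (linForm (f ∘ s)) := by
    rw [map_eval, map_linForm]
  have h1 : ∀ i, map f (vanishingForm y s b i) = vanishingForm (f ∘ y) (f ∘ s) (f ∘ b) i := by
    intro i
    have h0' : f (eval y (form b i)) = eval (f ∘ y) (form (f ∘ b) i) := by rw [eval_form_map]
    simp only [vanishingForm, map_sub, map_mul, map_pow, map_C, map_form, map_linForm, h0, h0']
  have h2 : f ∘ gradForm y l s b = gradForm (f ∘ y) (f ∘ l) (f ∘ s) (f ∘ b) := by
    funext j
    simp only [gradForm, Function.comp_apply, map_sum, map_mul, ← h1, pderiv_map, ← map_eval]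
  have h3 : ∀ i, map f (incidentForm y l s t b i) =
      incidentForm (f ∘ y) (f ∘ l) (f ∘ s) (f ∘ t) (f ∘ b) i := by
    intro i
    simp only [incidentForm, map_sub, map_mul, map_pow, map_C, map_sum, map_linForm, h1, h2, h0,
      Function.comp_apply]
  funext c
  simp only [incidentTuple, coeffTuple, Function.comp_apply, ← h3, coeff_map]

/-- The parameters of the universal incident tuple. -/
abbrev IncidentVar (k : ℕ) (p : Fin r → ℕ) : Type :=
  ((Fin k ⊕ Fin r) ⊕ (Fin k ⊕ Fin r)) ⊕ CoeffIdx k p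

variable (K : Type v) [Field K]

/-- The universal point `y`. -/
def univPoint (k : ℕ) (p : Fin r → ℕ) (j : Fin k) : MvPolynomial (IncidentVar k p) K :=
  X (.inl (.inl (.inl j)))

/-- The universal covector `l`. -/
def univCovector (k : ℕ) (p : Fin r → ℕ) (i : Fin r) : MvPolynomial (IncidentVar k p) K :=
  X (.inl (.inl (.inr i)))

/-- The universal incident tuple. -/
def univTuple (k : ℕ) (p : Fin r → ℕ) : CoeffIdx k p → MvPolynomial (IncidentVar k p) K :=
  incidentTuple (univPoint K k p) (univCovector K k p) (fun j => X (.inl (.inr (.inl j))))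
    (fun i => X (.inl (.inr (.inr i)))) (fun c => X (.inr c))

/-- The specialisation of the universal parameters. -/
def incidentVal {A : Type*} (y : Fin k → A) (l : Fin r → A) (s : Fin k → A) (t : Fin r → A)
    (b : CoeffIdx k p → A) : IncidentVar k p → A :=
  Sum.elim (Sum.elim (Sum.elim y l) (Sum.elim s t)) b

variable {K}

theorem comp_univTuple [Algebra K A] (y : Fin k → A) (l : Fin r → A) (s : Fin k → A)
    (t : Fin r → A) (b : CoeffIdx k p → A) :
    aeval (R := K) (incidentVal y l s t b) ∘ univTuple K k p = incidentTuple y l s t b := by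
  have := comp_incidentTuple (aeval (R := K) (incidentVal y l s t b)).toRingHom
    (univPoint K k p) (univCovector K k p) (fun j => X (.inl (.inr (.inl j))))
    (fun i => X (.inl (.inr (.inr i)))) (fun c => X (.inr c))
  refine this.trans ?_
  congr 1 <;> funext x <;> simp [incidentVal, univPoint, univCovector]

/-- A polynomial over an infinite field is zero once all its values are. Multiplying by one
coordinate of `y` and one of `l` disposes of the parameters with `y = 0` or `l = 0`; at the others
the specialised tuple lies in Δ. -/
theorem aeval_univTuple_eq_zero [Infinite K] (hp : ∀ i, 1 ≤ p i) (i₀ : Fin r) (j₀ : Fin k)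
    {h : MvPolynomial (CoeffIdx k p) K} (hh : h ∈ vanishingIdeal K (discrLocus K k p)) :
    aeval (univTuple K k p) h = 0 := by
  have h1 : univPoint K k p j₀ * univCovector K k p i₀ * aeval (univTuple K k p) h = 0 := by
    refine MvPolynomial.funext fun x => ?_
    rw [map_mul, map_mul, map_zero]
    by_cases hy : eval x (univPoint K k p j₀) = 0
    · rw [hy, zero_mul, zero_mul]
    by_cases hl : eval x (univCovector K k p i₀) = 0
    · rw [hl, mul_zero, zero_mul]
    have h2 : eval x ∘ univTuple K k p ∈ discrLocus K k p := by
      refine mem_discrLocus_iff.2 ⟨eval x ∘ univPoint K k p, fun h0 => hy (congrFun h0 j₀),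
        eval x ∘ univCovector K k p, fun h0 => hl (congrFun h0 i₀), ?_⟩
      exact (isIncident_incidentTuple _ _ _ _ _ hp).map (eval x)
    have h3 := mem_vanishingIdeal_iff.1 hh _ h2
    have h4 : eval x (aeval (univTuple K k p) h) = aeval (eval x ∘ univTuple K k p) h := by
      simp only [← coe_aeval_eq_eval, RingHom.coe_coe]
      rw [← AlgHom.comp_apply, comp_aeval]
      rfl
    rw [h4, h3, mul_zero]
  refine (mul_eq_zero.1 h1).resolve_left (mul_ne_zero ?_ ?_) <;> exact X_ne_zero _

/-- The incident tuple is a specialisation of `univTuple`. No reducedness of `A` is involved, and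
the statement is later applied over truncated polynomial rings. -/
theorem aeval_eq_zero_of_isIncident [Infinite K] [Algebra K A] (hp : ∀ i, 1 ≤ p i) (i₀ : Fin r)
    (j₀ : Fin k) {h : MvPolynomial (CoeffIdx k p) K}
    (hh : h ∈ vanishingIdeal K (discrLocus K k p)) {a : CoeffIdx k p → A} {y : Fin k → A}
    {l : Fin r → A} (ha : IsIncident a y l) {s : Fin k → A} (hs : ∑ j, s j * y j = 1)
    {t : Fin r → A} (ht : ∑ i, t i * l i = 1) : aeval a h = 0 := by
  have h1 := congrArg (aeval (R := K) (incidentVal y l s t a))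
    (aeval_univTuple_eq_zero hp i₀ j₀ hh)
  rw [map_zero, ← AlgHom.comp_apply, comp_aeval] at h1
  have h2 := comp_univTuple (K := K) y l s t a
  rw [incidentTuple_eq_self ha hs ht] at h2
  rwa [← h2]

theorem exists_dual {ι : Type*} [Fintype ι] {F : Type*} [Field F] {y : ι → F} (hy : y ≠ 0) :
    ∃ s : ι → F, ∑ j, s j * y j = 1 := by
  classical
  obtain ⟨j, hj⟩ := Function.ne_iff.1 hy
  refine ⟨Pi.single j (y j)⁻¹, ?_⟩
  simp [Pi.single_apply, inv_mul_cancel₀ hj]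

/-- The incidence variety is parametrised by an affine space, so Δ behaves like the image of an
irreducible variety: its ideal is a kernel into a domain, hence prime. -/
theorem vanishingIdeal_discrLocus_eq_ker [Infinite K] (hp : ∀ i, 1 ≤ p i) (i₀ : Fin r)
    (j₀ : Fin k) :
    vanishingIdeal K (discrLocus K k p) = RingHom.ker (aeval (R := K) (univTuple K k p)) := by
  ext h
  refine ⟨aeval_univTuple_eq_zero hp i₀ j₀, fun hh => mem_vanishingIdeal_iff.2 fun a ha => ?_⟩
  obtain ⟨y, hy, l, hl, hi⟩ := mem_discrLocus_iff.1 ha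
  obtain ⟨s, hs⟩ := exists_dual hy
  obtain ⟨t, ht⟩ := exists_dual hl
  have h1 := congrArg (aeval (R := K) (incidentVal y l s t a)) ((RingHom.mem_ker).1 hh)
  rw [map_zero, ← AlgHom.comp_apply, comp_aeval] at h1
  have h2 := comp_univTuple (K := K) y l s t a
  rw [incidentTuple_eq_self hi hs ht] at h2
  rwa [← h2]

theorem vanishingIdeal_discrLocus_isPrime [Infinite K] (hp : ∀ i, 1 ≤ p i) (i₀ : Fin r)
    (j₀ : Fin k) : (vanishingIdeal K (discrLocus K k p)).IsPrime := by
  rw [vanishingIdeal_discrLocus_eq_ker hp i₀ j₀]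
  exact RingHom.ker_isPrime _

end Universal

/-! ## The vanishing ideal of the discriminant cuts out the discriminant over every extension -/

section Elimination

open MvPolynomial

variable {r k : ℕ} {p : Fin r → ℕ}

theorem nonempty_algHom_of_finite (F T L : Type*) [Field F] [Field T] [Algebra F T]
    [Module.Finite F T] [Field L] [Algebra F L] [IsAlgClosed L] : Nonempty (T →ₐ[F] L) :=
  ⟨IsAlgClosed.lift⟩

/-- Zariski's lemma: modulo a maximal ideal, the algebra generated over `F` by the entries of `y`
and `l` is a finite extension of `F`, so it embeds into `L`. The entries equal to 1 keep the images
of `y` and `l` nonzero. -/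
theorem exists_incident_of_extension {F F' L : Type*} [Field F] [Field F'] [Algebra F F'] [Field L]
    [Algebra F L] [IsAlgClosed L] {a : CoeffIdx k p → F} {y : Fin k → F'} {l : Fin r → F'}
    (h : IsIncident (algebraMap F F' ∘ a) y l) {j₀ : Fin k} (hy : y j₀ = 1) {i₀ : Fin r}
    (hl : l i₀ = 1) : algebraMap F L ∘ a ∈ discrLocus L k p := by
  let S : Subalgebra F F' := Algebra.adjoin F (Set.range y ∪ Set.range l)
  have hyS : ∀ j, y j ∈ S := fun j => Algebra.subset_adjoin (Or.inl ⟨j, rfl⟩)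
  have hlS : ∀ i, l i ∈ S := fun i => Algebra.subset_adjoin (Or.inr ⟨i, rfl⟩)
  have hfin : Algebra.FiniteType F S :=
    (Subalgebra.fg_iff_finiteType S).1
      (Subalgebra.fg_def.2 ⟨_, (Set.finite_range y).union (Set.finite_range l), rfl⟩)
  obtain ⟨m, hm⟩ := Ideal.exists_maximal S
  let _ : Field (S ⧸ m) := Ideal.Quotient.field m
  have : Module.Finite F (S ⧸ m) := finite_of_finite_type_of_isJacobsonRing F (S ⧸ m)
  obtain ⟨χ⟩ := nonempty_algHom_of_finite F (S ⧸ m) L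
  let ψ : S →ₐ[F] L := χ.comp (Ideal.Quotient.mkₐ F m)
  have hS : IsIncident (algebraMap F S ∘ a) (fun j => (⟨y j, hyS j⟩ : S))
      (fun i => (⟨l i, hlS i⟩ : S)) :=
    IsIncident.of_map (f := S.val.toRingHom) Subtype.val_injective h
  have hL := hS.map ψ.toRingHom
  have hψ : ψ.toRingHom ∘ algebraMap F S ∘ a = algebraMap F L ∘ a := by
    funext c
    exact ψ.commutes (a c)
  rw [hψ] at hL
  refine mem_discrLocus_iff.2 ⟨_, fun h0 => ?_, _, fun h0 => ?_, hL⟩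
  · have h1 := congrFun h0 j₀
    have h2 : (⟨y j₀, hyS j₀⟩ : S) = 1 := Subtype.ext hy
    simp [h2] at h1
  · have h1 := congrFun h0 i₀
    have h2 : (⟨l i₀, hlS i₀⟩ : S) = 1 := Subtype.ext hl
    simp [h2] at h1

/-- Divide by an entry of maximal valuation. This is the valuative form of the properness of
projective space. -/
theorem exists_scaling {Q : Type*} [Field Q] (V : ValuationSubring Q) {ι : Type*} [Finite ι]
    {y : ι → Q} (hy : y ≠ 0) : ∃ c : Q, c ≠ 0 ∧ (∀ j, c * y j ∈ V) ∧ ∃ j, c * y j = 1 := by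
  obtain ⟨j₁, hj₁⟩ := Function.ne_iff.1 hy
  have : Nonempty ι := ⟨j₁⟩
  obtain ⟨j₀, hj₀⟩ := Finite.exists_max fun j => V.valuation (y j)
  have hne : y j₀ ≠ 0 := by
    intro h0
    have h1 := hj₀ j₁
    rw [h0, map_zero, le_zero_iff, map_eq_zero] at h1
    exact hj₁ h1
  refine ⟨(y j₀)⁻¹, inv_ne_zero hne, fun j => ?_, j₀, inv_mul_cancel₀ hne⟩
  rw [← V.valuation_le_one_iff, map_mul, map_inv₀]
  exact (inv_mul_le_one₀ (zero_lt_iff.2 ((V.valuation).ne_zero_iff.2 hne))).2 (hj₀ j)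

/-- Elimination theory by valuations. The universal incident pair lives over the fraction field `Q`
of the parameter ring; a valuation ring of `Q` centred at the point `a` allows it to be normalised
and reduced, and the reduced pair is incident over an extension of the residue field of `a`, from
which it descends to `L`. -/
theorem mem_discrLocus_of_forall_aeval_eq_zero {K : Type v} [Field K] [Infinite K] {L : Type*}
    [Field L] [IsAlgClosed L] [Algebra K L] (hp : ∀ i, 1 ≤ p i) (i₀ : Fin r) (j₀ : Fin k)
    {a : CoeffIdx k p → L}
    (ha : ∀ h ∈ vanishingIdeal K (discrLocus K k p), aeval a h = 0) : a ∈ discrLocus L k p := by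
  let Q := FractionRing (MvPolynomial (IncidentVar k p) K)
  let ι : MvPolynomial (IncidentVar k p) K →+* Q := algebraMap _ _
  have hι : Function.Injective ι := IsFractionRing.injective _ _
  let φ : MvPolynomial (CoeffIdx k p) K →+* Q := ι.comp (aeval (univTuple K k p)).toRingHom
  let q : Ideal (MvPolynomial (CoeffIdx k p) K) := RingHom.ker (aeval (R := K) a)
  have : q.IsPrime := RingHom.ker_isPrime _
  have hφ : ∀ h, φ h = 0 → h ∈ q := by
    intro h hh
    refine ha h ?_
    rw [vanishingIdeal_discrLocus_eq_ker hp i₀ j₀]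
    exact hι (by rw [map_zero]; exact hh)
  let R := Localization.AtPrime q
  let f : R →+* Q := IsLocalization.lift (M := q.primeCompl) (g := φ) fun h =>
    isUnit_iff_ne_zero.2 fun h0 => h.2 (hφ _ h0)
  -- The ideal of Δ is `ker φ` and is contained in `q`, so `φ` extends to the localisation at `q`.
  -- Choose a valuation ring of `Q` dominating the image of this local ring.
  obtain ⟨V, hV, hloc⟩ := IsLocalRing.exists_factor_valuationRing f
  let g : R →+* V := f.codRestrict V.toSubring hV
  have : IsLocalHom g := hloc
  let F := IsLocalRing.ResidueField R
  let F' := IsLocalRing.ResidueField V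
  let _ : Algebra F F' := (IsLocalRing.ResidueField.map g).toAlgebra
  let e : R →+* L := IsLocalization.lift (M := q.primeCompl) (g := (aeval (R := K) a).toRingHom)
    fun h => isUnit_iff_ne_zero.2 fun h0 => h.2 h0
  -- Locality lets the residue field of `R` embed into `L`, so that `a` is the image of the residue
  -- classes of the variables.
  have : IsLocalHom e := by
    refine ⟨fun x hx => ?_⟩
    obtain ⟨⟨n, d⟩, hnd⟩ := IsLocalization.surj q.primeCompl x
    have h1 : e x * aeval a d.1 = aeval a n := by
      have := congrArg e hnd
      rw [map_mul] at this
      simpa [e, IsLocalization.lift_eq] using this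
    have h2 : n ∉ q := by
      intro h0
      rw [RingHom.mem_ker.1 h0, mul_eq_zero] at h1
      rcases h1 with h1 | h1
      · exact hx.ne_zero h1
      · exact d.2 h1
    have h3 := IsLocalization.map_units R (⟨n, h2⟩ : q.primeCompl)
    rw [← hnd] at h3
    exact isUnit_of_mul_isUnit_left h3
  let _ : Algebra F L := (IsLocalRing.ResidueField.lift e).toAlgebra
  let x : CoeffIdx k p → R := fun c => algebraMap (MvPolynomial (CoeffIdx k p) K) R (X c)
  obtain ⟨c, hc, hcV, j₁, hj₁⟩ := exists_scaling V (y := ι ∘ univPoint K k p) fun h0 =>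
    X_ne_zero (R := K) _ (hι ((congrFun h0 j₀).trans (map_zero ι).symm))
  have hinc : IsIncident (ι ∘ univTuple K k p) (ι ∘ univPoint K k p) (ι ∘ univCovector K k p) :=
    (isIncident_incidentTuple _ _ _ _ _ hp).map ι
  have hinc1 := hinc.smul c
  -- The covector is normalised only now, since rescaling the point has already changed it.
  obtain ⟨d, hd, hdV, i₁, hi₁⟩ := exists_scaling V
    (y := fun i => c ^ (∑ i, p i - (p i - 1)) * (ι ∘ univCovector K k p) i) fun h0 => by
      have h1 := congrFun h0 i₀
      simp only [Pi.zero_apply, mul_eq_zero, pow_eq_zero_iff', hc, false_and, false_or] at h1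
      exact X_ne_zero (R := K) _ (hι (h1.trans (map_zero ι).symm))
  have hinc2 := hinc1.smul_right d
  have hinc3 : IsIncident (g ∘ x) (fun j => (⟨_, hcV j⟩ : V)) (fun i => (⟨_, hdV i⟩ : V)) := by
    refine IsIncident.of_map (f := V.subtype) Subtype.val_injective ?_
    convert hinc2 using 1
    · funext b
      change f (algebraMap _ R (X b)) = _
      simp [f, φ, IsLocalization.lift_eq]
    · rfl
    · rfl
  have hinc4 := hinc3.map (IsLocalRing.residue V)
  have key := exists_incident_of_extension (F := F) (F' := F') (L := L)
    (a := IsLocalRing.residue R ∘ x) (j₀ := j₁) (i₀ := i₁) hinc4 ?_ ?_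
  · convert key using 1
    funext b
    change _ = IsLocalRing.ResidueField.lift e (IsLocalRing.residue R (algebraMap _ R (X b)))
    simp [IsLocalRing.ResidueField.lift_residue_apply, e, IsLocalization.lift_eq]
  · have : (⟨_, hcV j₁⟩ : V) = 1 := Subtype.ext hj₁
    change IsLocalRing.residue V ⟨_, hcV j₁⟩ = 1
    rw [this, map_one]
  · have : (⟨_, hdV i₁⟩ : V) = 1 := Subtype.ext hi₁
    change IsLocalRing.residue V ⟨_, hdV i₁⟩ = 1
    rw [this, map_one]

end Elimination

/-! ## The discriminant is a hypersurface -/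

section Hypersurface

open MvPolynomial

/-- A nonzero `P` contains a prime element `f`, of positive degree because `P` has no nonzero
constants. If `f` failed to divide some `g ∈ P`, they would be coprime over the fraction field, and
clearing denominators in a Bézout relation would put a nonzero constant into `P`. -/
theorem exists_span_singleton_of_prime {R : Type*} [CommRing R] [IsDomain R]
    [UniqueFactorizationMonoid R] (P : Ideal (Polynomial R)) [hP : P.IsPrime]
    (h : ∀ c : R, Polynomial.C c ∈ P → c = 0) : ∃ f, Ideal.span {f} = P := by
  have : IsGCDMonoid R := ⟨UniqueFactorizationMonoid.toGCDMonoid R⟩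
  by_cases hbot : P = ⊥
  · exact ⟨0, by rw [hbot]; simp⟩
  obtain ⟨f, hfP, hf⟩ := hP.exists_mem_prime_of_ne_bot hbot
  have hdeg : f.natDegree ≠ 0 := by
    intro h0
    rw [Polynomial.eq_C_of_natDegree_eq_zero h0] at hfP
    refine hf.ne_zero ?_
    rw [Polynomial.eq_C_of_natDegree_eq_zero h0, h _ hfP, map_zero]
  have hprim : f.IsPrimitive := hf.irreducible.isPrimitive hdeg
  let F := FractionRing R
  have hirr : Irreducible (f.map (algebraMap R F)) :=
    hprim.irreducible_iff_irreducible_map_fraction_map.1 hf.irreducible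
  refine ⟨f, le_antisymm ((Ideal.span_singleton_le_iff_mem _).2 hfP) fun g hg => ?_⟩
  rw [Ideal.mem_span_singleton]
  refine hprim.dvd_of_fraction_map_dvd_fraction_map (K := F) ?_
  by_contra hndvd
  obtain ⟨u, v, huv⟩ := (hirr.coprime_iff_not_dvd).2 hndvd
  obtain ⟨b, hb₀, hb⟩ := IsLocalization.integerNormalization_spec (nonZeroDivisors R) u
  obtain ⟨c, hc₀, hc⟩ := IsLocalization.integerNormalization_spec (nonZeroDivisors R) v
  set u' := IsLocalization.integerNormalization (nonZeroDivisors R) u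
  set v' := IsLocalization.integerNormalization (nonZeroDivisors R) v
  have key : Polynomial.C (c * b) = Polynomial.C c * u' * f + Polynomial.C b * v' * g := by
    apply Polynomial.map_injective (algebraMap R F) (IsFractionRing.injective R F)
    simp only [Polynomial.map_add, Polynomial.map_mul, hb, hc, Polynomial.map_C, map_mul]
    rw [Algebra.smul_def, Algebra.smul_def, Polynomial.algebraMap_apply,
      Polynomial.algebraMap_apply]
    have := congrArg (Polynomial.C (algebraMap R F c) * Polynomial.C (algebraMap R F b) * ·) huv
    simp only [mul_one] at this
    rw [← this]; ring
  have h0 := h _ (key ▸ P.add_mem (P.mul_mem_left _ hfP) (P.mul_mem_left _ hg))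
  exact nonZeroDivisors.ne_zero (mul_mem hc₀ hb₀) h0

theorem exists_span_singleton_of_rename {σ : Type*} {K : Type*} [Field K]
    (c₀ : σ) (P : Ideal (MvPolynomial σ K)) [P.IsPrime]
    (h : ∀ g : MvPolynomial {c // c ≠ c₀} K, rename Subtype.val g ∈ P → g = 0) :
    ∃ D, Ideal.span {D} = P := by
  classical
  let e : MvPolynomial σ K ≃ₐ[K] Polynomial (MvPolynomial {c // c ≠ c₀} K) :=
    (renameEquiv K (Equiv.optionSubtypeNe c₀).symm).trans (optionEquivLeft K _)
  have he : ∀ g : MvPolynomial {c // c ≠ c₀} K, e (rename Subtype.val g) = Polynomial.C g := by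
    intro g
    induction g using MvPolynomial.induction_on with
    | C a => simp [e]
    | add p q hp hq => rw [map_add, map_add, hp, hq, map_add]
    | mul_X p i hp =>
      rw [map_mul, map_mul, hp, map_mul]
      congr 1
      simp [e, i.2]
  obtain ⟨f, hf⟩ := exists_span_singleton_of_prime (P.comap e.symm.toRingEquiv.toRingHom)
    fun c hc => h c (by
      have : e.symm (Polynomial.C c) ∈ P := hc
      rwa [← he, AlgEquiv.symm_apply_apply] at this)
  refine ⟨e.symm f, ?_⟩
  have h1 : P = (P.comap e.symm.toRingEquiv.toRingHom).map e.symm.toRingEquiv.toRingHom :=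
    (Ideal.map_comap_of_surjective _ e.symm.surjective P).symm
  rw [h1, ← hf, Ideal.map_span, Set.image_singleton]
  rfl

/-- Fixed point iteration for a `t`-adic contraction: `hQ` says that `Q` respects congruences, as
polynomial maps do, so each step gains a factor `t`, and the iteration is stationary after `n`
steps. -/
theorem exists_eq_mul_of_nilpotent {A : Type*} [CommRing A] {ι : Type*} {t : A} {n : ℕ}
    (ht : t ^ n = 0) (Q : (ι → A) → ι → A)
    (hQ : ∀ (J : Ideal A) (u u' : ι → A), (∀ i, u i - u' i ∈ J) → ∀ i, Q u i - Q u' i ∈ J) :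
    ∃ u : ι → A, ∀ i, u i = t * Q u i := by
  let G : (ι → A) → ι → A := fun u i => t * Q u i
  have h : ∀ m i, G^[m + 1] 0 i - G^[m] 0 i ∈ Ideal.span {t ^ m} := by
    intro m
    induction m with
    | zero => intro i; simp
    | succ m ih =>
      intro i
      have h1 := hQ _ _ _ ih i
      rw [Function.iterate_succ_apply' G (m + 1), Function.iterate_succ_apply' G m]
      change t * _ - t * _ ∈ _
      rw [Function.iterate_succ_apply' G m] at h1
      rw [← mul_sub, pow_succ', ← Ideal.span_singleton_mul_span_singleton]
      exact Ideal.mul_mem_mul (Ideal.mem_span_singleton_self t) h1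
  refine ⟨G^[n] 0, fun i => ?_⟩
  have h1 := h n i
  rw [ht, Ideal.mem_span_singleton, zero_dvd_iff, sub_eq_zero, Function.iterate_succ_apply'] at h1
  exact h1.symm

variable {r k : ℕ} {p : Fin r → ℕ}

/-- Forms with a nondegenerate quadratic singular point at the `j₀`-th coordinate point. -/
def baseForm {A : Type*} [CommRing A] (p : Fin r → ℕ) (e : A) (σ : Fin r → Fin k) (i₀ : Fin r)
    (j₀ : Fin k) (i : Fin r) : MvPolynomial (Fin k) A :=
  if i = i₀ then C e * (∑ j ∈ Finset.univ.erase j₀, X j ^ 2) * X j₀ ^ (p i - 2)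
  else X (σ i) * X j₀ ^ (p i - 1)

theorem baseForm_isHomogeneous {A : Type*} [CommRing A] (hp : ∀ i, 1 ≤ p i) (e : A)
    (σ : Fin r → Fin k) (i₀ : Fin r) (j₀ : Fin k) (h2 : 2 ≤ p i₀) (i : Fin r) :
    (baseForm p e σ i₀ j₀ i).IsHomogeneous (p i) := by
  rw [baseForm]
  split_ifs with h
  · subst h
    have h3 : (∑ j ∈ Finset.univ.erase j₀, (X j : MvPolynomial (Fin k) A) ^ 2).IsHomogeneous 2 :=
      IsHomogeneous.sum _ _ _ fun j _ => isHomogeneous_X_pow j 2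
    have := (h3.C_mul e).mul (isHomogeneous_X_pow (R := A) j₀ (p i - 2))
    rwa [Nat.add_sub_cancel' h2] at this
  · have := (isHomogeneous_X A (σ i)).mul (isHomogeneous_X_pow (R := A) j₀ (p i - 1))
    rwa [Nat.add_sub_cancel' (hp i)] at this

theorem map_baseForm {A B : Type*} [CommRing A] [CommRing B] (f : A →+* B) (e : A)
    (σ : Fin r → Fin k) (i₀ : Fin r) (j₀ : Fin k) (i : Fin r) :
    map f (baseForm p e σ i₀ j₀ i) = baseForm p (f e) σ i₀ j₀ i := by
  rw [baseForm, baseForm]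
  split_ifs <;> simp

/-- The base tuple is incident to the `j₀`-th coordinate point and the `i₀`-th covector. In the
chart `y j₀ = 1`, `l i₀ = 1` the linear parts of all incidence equations but one can be solved for
the remaining unknowns, the quadratic part of the `i₀`-th form having gradient `y j` because `2 * e
= 1`. The equation left over is the vanishing of the `i₀`-th form, met by altering its coefficient
at the pure power of `X j₀`. -/
theorem exists_incident_deformation {A : Type*} [CommRing A] {t e : A} {n : ℕ} (ht : t ^ n = 0)
    (he : 2 * e = 1) (hp : ∀ i, 1 ≤ p i) {σ : Fin r → Fin k} (hσ : Function.Injective σ)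
    {i₀ : Fin r} {j₀ : Fin k} (hσ₀ : ∀ i, σ i ≠ j₀) (h2 : 2 ≤ p i₀) (b : CoeffIdx k p → A) :
    ∃ (a : CoeffIdx k p → A) (y : Fin k → A) (l : Fin r → A), y j₀ = 1 ∧ l i₀ = 1 ∧
      IsIncident a y l ∧ ∀ c : CoeffIdx k p, (c.1 ≠ i₀ ∨ c.2.1 ≠ Pi.single j₀ (p i₀)) →
        a c = coeffTuple p (baseForm p e σ i₀ j₀) c + t * b c := by
  classical
  let Y : (Fin k ⊕ Fin r → A) → Fin k → A := fun u => Function.update (u ∘ Sum.inl) j₀ 1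
  let Λ : (Fin k ⊕ Fin r → A) → Fin r → A := fun u => Function.update (u ∘ Sum.inr) i₀ 1
  let W : (Fin k ⊕ Fin r → A) → Fin k → A := fun u j =>
    ∑ i, Λ u i * eval (Y u) (pderiv j (form b i))
  -- The incidence equations in the form `u = t * Q u`. Vanishing of the `i`-th form, `i ≠ i₀`,
  -- determines coordinate `σ i`; the gradient equation in direction `σ i` determines `l i`; the
  -- gradient equations in the other directions determine the other coordinates. The entries for
  -- `j₀` and `i₀` are dummies, overwritten by 1 in `Y` and `Λ`.
  let Q : (Fin k ⊕ Fin r → A) → Fin k ⊕ Fin r → A := fun u => Sum.elim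
    (Function.extend σ (fun i => if i = i₀ then -W u (σ i) else -eval (Y u) (form b i))
      (fun j => -W u j))
    (fun i => eval (Y u) (form b i) - W u (σ i))
  have hQ : ∀ (J : Ideal A) (u u' : Fin k ⊕ Fin r → A), (∀ i, u i - u' i ∈ J) →
      ∀ i, Q u i - Q u' i ∈ J := by
    intro J u u' h
    let m := Ideal.Quotient.mk J
    have hu : ∀ i, m (u i) = m (u' i) := fun i => Ideal.Quotient.eq.2 (h i)
    have hY : m ∘ Y u = m ∘ Y u' := by
      funext j
      by_cases hj : j = j₀
      · subst hj; simp [Y]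
      · simp [Y, hj, hu]
    have hΛ : ∀ i, m (Λ u i) = m (Λ u' i) := by
      intro i
      by_cases hi : i = i₀
      · subst hi; simp [Λ]
      · simp [Λ, hi, hu]
    have hev : ∀ F, m (eval (Y u) F) = m (eval (Y u') F) := fun F => by
      rw [map_eval, map_eval, hY]
    have hW : ∀ j, m (W u j) = m (W u' j) := fun j => by
      simp only [W, map_sum, map_mul, hΛ, hev]
    intro i
    refine Ideal.Quotient.eq.1 ?_
    change m _ = m _
    rcases i with j | i
    · simp only [Q, Sum.elim_inl]
      by_cases hj : ∃ i, σ i = j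
      · obtain ⟨i, rfl⟩ := hj
        rw [hσ.extend_apply, hσ.extend_apply]
        split_ifs
        · rw [map_neg, map_neg, hW]
        · rw [map_neg, map_neg, hev]
      · rw [Function.extend_apply' _ _ _ hj, Function.extend_apply' _ _ _ hj, map_neg, map_neg, hW]
    · simp only [Q, Sum.elim_inr, map_sub, hW, hev]
  obtain ⟨u, hu⟩ := exists_eq_mul_of_nilpotent ht Q hQ
  set y := Y u with hy
  set l := Λ u with hl
  have hy0 : y j₀ = 1 := by simp [hy, Y]
  have hl0 : l i₀ = 1 := by simp [hl, Λ]
  have hyj : ∀ j ≠ j₀, y j = u (Sum.inl j) := fun j hj => by simp [hy, Y, hj]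
  have hli : ∀ i ≠ i₀, l i = u (Sum.inr i) := fun i hi => by simp [hl, Λ, hi]
  have hv1 : ∀ i ≠ i₀, y (σ i) = -(t * eval y (form b i)) := by
    intro i hi
    rw [hyj _ (hσ₀ i), hu]
    simp only [Q, Sum.elim_inl]
    rw [hσ.extend_apply, if_neg hi]; ring
  have hv2 : ∀ j ≠ j₀, (∀ i ≠ i₀, σ i ≠ j) → y j = -(t * W u j) := by
    intro j hj h
    rw [hyj j hj, hu]
    simp only [Q, Sum.elim_inl]
    by_cases hj' : ∃ i, σ i = j
    · obtain ⟨i, rfl⟩ := hj'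
      have hi : i = i₀ := by
        by_contra hi
        exact h i hi rfl
      rw [hσ.extend_apply, if_pos hi]; ring
    · rw [Function.extend_apply' _ _ _ hj']; ring
  have hv3 : ∀ i ≠ i₀, l i = t * (eval y (form b i) - W u (σ i)) := by
    intro i hi
    rw [hli i hi, hu]
    simp only [Q, Sum.elim_inr]
    rfl
  -- The one coefficient correction; it equals the defect of the `i₀`-th equation because `y j₀ =
  -- 1`.
  let γ : A := -eval y (baseForm p e σ i₀ j₀ i₀ + C t * form b i₀)
  let F : Fin r → MvPolynomial (Fin k) A := fun i =>
    baseForm p e σ i₀ j₀ i + C t * form b i + (if i = i₀ then C γ * X j₀ ^ p i else 0)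
  have hF : ∀ i, (F i).IsHomogeneous (p i) := by
    intro i
    refine ((baseForm_isHomogeneous hp e σ i₀ j₀ h2 i).add
      ((form_isHomogeneous b i).C_mul t)).add ?_
    split_ifs
    · exact isHomogeneous_C_mul_X_pow γ j₀ (p i)
    · exact isHomogeneous_zero _ _ _
  have hFa : ∀ i, form (coeffTuple p F) i = F i := fun i => form_coeffTuple (hF i)
  have hF0 : ∀ i, eval y (F i) = 0 := by
    intro i
    by_cases hi : i = i₀
    · subst hi
      simp [F, γ, hy0]
    · simp [F, baseForm, hi, hy0, hv1 i hi]
  have hgrad : ∀ j ≠ j₀, ∑ i, l i * eval y (pderiv j (F i)) = 0 := by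
    intro j hj
    have h1 : ∀ i, l i * eval y (pderiv j (F i)) =
        l i * eval y (pderiv j (baseForm p e σ i₀ j₀ i)) +
          t * (l i * eval y (pderiv j (form b i))) := by
      intro i
      have : pderiv j (if i = i₀ then C γ * X j₀ ^ p i else 0 : MvPolynomial (Fin k) A) = 0 := by
        split_ifs
        · simp [pderiv_X_of_ne hj.symm, Derivation.leibniz_pow]
        · simp
      simp only [F, map_add, this, add_zero, pderiv_C_mul, map_mul, eval_C]
      ring
    simp only [h1, Finset.sum_add_distrib, ← Finset.mul_sum]
    have h3 : eval y (pderiv j (baseForm p e σ i₀ j₀ i₀)) = y j := by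
      have h5 : pderiv j (∑ j ∈ Finset.univ.erase j₀, (X j : MvPolynomial (Fin k) A) ^ 2) =
          2 * X j := by
        rw [map_sum, Finset.sum_eq_single j]
        · simp [Derivation.leibniz_pow]
        · intro b _ hb
          simp [pderiv_X_of_ne hb, Derivation.leibniz_pow]
        · intro h; exact absurd (Finset.mem_erase.2 ⟨hj, Finset.mem_univ _⟩) h
      have h6 : pderiv j ((X j₀ : MvPolynomial (Fin k) A) ^ (p i₀ - 2)) = 0 := by
        simp [Derivation.leibniz_pow, pderiv_X_of_ne hj.symm]
      rw [baseForm, if_pos rfl, Derivation.leibniz, h6, pderiv_C_mul, h5]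
      simp [hy0]
      rw [← mul_assoc, mul_comm e 2, he, one_mul]
    have h4 : ∀ i ≠ i₀, eval y (pderiv j (baseForm p e σ i₀ j₀ i)) = if σ i = j then 1 else 0 := by
      intro i hi
      have h6 : pderiv j ((X j₀ : MvPolynomial (Fin k) A) ^ (p i - 1)) = 0 := by
        simp [Derivation.leibniz_pow, pderiv_X_of_ne hj.symm]
      rw [baseForm, if_neg hi, Derivation.leibniz, h6]
      by_cases hij : σ i = j
      · simp [hij, hy0]
      · simp [hij, pderiv_X_of_ne hij]
    rw [← Finset.add_sum_erase _ _ (Finset.mem_univ i₀), hl0, h3, one_mul]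
    have h7 : ∑ i ∈ Finset.univ.erase i₀, l i * eval y (pderiv j (baseForm p e σ i₀ j₀ i)) =
        ∑ i ∈ Finset.univ.erase i₀, if σ i = j then l i else 0 := by
      refine Finset.sum_congr rfl fun i hi => ?_
      rw [h4 i (Finset.ne_of_mem_erase hi)]
      split_ifs <;> simp
    rw [h7]
    change _ + t * W u j = 0
    by_cases hex : ∃ i ≠ i₀, σ i = j
    · obtain ⟨i, hi, rfl⟩ := hex
      rw [Finset.sum_eq_single i, if_pos rfl, hv1 i hi, hv3 i hi]
      · ring
      · intro i' _ hi'
        rw [if_neg (fun h => hi' (hσ h))]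
      · intro h; exact absurd (Finset.mem_erase.2 ⟨hi, Finset.mem_univ _⟩) h
    · push Not at hex
      rw [Finset.sum_eq_zero, hv2 j hj hex]
      · ring
      · intro i hi
        rw [if_neg (hex i (Finset.ne_of_mem_erase hi))]
  refine ⟨coeffTuple p F, y, l, hy0, hl0, ⟨fun i => by rw [hFa, hF0], fun j => ?_⟩, ?_⟩
  · simp only [hFa]
    by_cases hj : j = j₀
    · subst hj
      -- By Euler's identity the gradient equation in direction `j₀` follows from the others, again
      -- because `y j₀ = 1`.
      have h1 : ∑ j', y j' * ∑ i, l i * eval y (pderiv j' (F i)) = 0 := by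
        simp only [Finset.mul_sum]
        rw [Finset.sum_comm]
        refine Finset.sum_eq_zero fun i _ => ?_
        have h5 := sum_mul_eval_pderiv (hF i) y
        rw [hF0, mul_zero] at h5
        rw [← mul_zero (l i), ← h5, Finset.mul_sum]
        exact Finset.sum_congr rfl fun j _ => by ring
      rw [Finset.sum_eq_single j, hy0, one_mul] at h1
      · exact h1
      · intro j' _ hj'
        rw [hgrad j' hj', mul_zero]
      · simp
    · exact hgrad j hj
  · intro c hc
    have h1 : coeff (Finsupp.equivFunOnFinite.symm c.2.1)
        (if c.1 = i₀ then C γ * X j₀ ^ p c.1 else 0 : MvPolynomial (Fin k) A) = 0 := by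
      split_ifs with h
      · rw [coeff_C_mul, coeff_X_pow, if_neg, mul_zero]
        intro h3
        rcases hc with hc | hc
        · exact hc h
        · refine hc ?_
          have h4 := congrArg Finsupp.equivFunOnFinite h3
          rw [Equiv.apply_symm_apply] at h4
          rw [← h4, h]
          funext x
          simp [Finsupp.single_apply, Pi.single_apply, eq_comm]
      · simp
    have h2 : coeff (Finsupp.equivFunOnFinite.symm c.2.1) (form b c.1) = b c :=
      congrFun (coeffTuple_form b) c
    simp only [coeffTuple, F, coeff_add, h1, add_zero, coeff_C_mul, h2]

/-- Restrict `g` to the line from the base tuple to an arbitrary point `x`. Modulo every power of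
the parameter this line agrees, away from the coordinate `c₀` which `g` ignores, with an incident
tuple. So the restriction `P` is divisible by all powers of the parameter and vanishes, in
particular at `x`. -/
theorem eq_zero_of_rename_mem_vanishingIdeal {K : Type v} [Field K] [CharZero K]
    (hp : ∀ i, 1 ≤ p i) (hrk : r < k) {i₀ : Fin r} (h2 : 2 ≤ p i₀) (c₀ : CoeffIdx k p)
    (hc₀ : c₀.1 = i₀ ∧ c₀.2.1 = Pi.single ⟨0, by omega⟩ (p i₀))
    (g : MvPolynomial {c // c ≠ c₀} K)
    (hg : rename Subtype.val g ∈ vanishingIdeal K (discrLocus K k p)) : g = 0 := by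
  let j₀ : Fin k := ⟨0, by omega⟩
  -- The shift by one is possible because `r < k`, and it leaves coordinate 0 free for the singular
  -- point.
  let σ : Fin r → Fin k := fun i => ⟨i + 1, by omega⟩
  have hσ : Function.Injective σ := fun i i' h => Fin.ext (by simpa [σ] using h)
  have hσ₀ : ∀ i, σ i ≠ j₀ := fun i h => by simp [σ, j₀] at h
  have he : (2 : K) * 2⁻¹ = 1 := mul_inv_cancel₀ two_ne_zero
  refine MvPolynomial.funext fun x => ?_
  let x₀ : CoeffIdx k p → K := coeffTuple p (baseForm p (2⁻¹ : K) σ i₀ j₀)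
  let b : CoeffIdx k p → K := fun c => if h : c ≠ c₀ then x ⟨c, h⟩ - x₀ c else 0
  let P : Polynomial K := aeval (fun c : {c // c ≠ c₀} =>
    Polynomial.C (x₀ c) + Polynomial.X * Polynomial.C (b c)) g
  have hP : P = 0 := by
    ext n
    have h1 : Polynomial.X ^ (n + 1) ∣ P := by
      rw [← Ideal.mem_span_singleton, ← Ideal.Quotient.eq_zero_iff_mem]
      let J : Ideal (Polynomial K) := Ideal.span {Polynomial.X ^ (n + 1)}
      let m := Ideal.Quotient.mkₐ K J
      have ht : m Polynomial.X ^ (n + 1) = 0 := by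
        rw [← map_pow]
        exact Ideal.Quotient.eq_zero_iff_mem.2 (Ideal.mem_span_singleton_self _)
      have he' : (2 : Polynomial K ⧸ J) * algebraMap K _ 2⁻¹ = 1 := by
        rw [← map_ofNat (algebraMap K (Polynomial K ⧸ J)), ← map_mul, he, map_one]
      obtain ⟨a, y, l, hy, hl, hinc, hab⟩ := exists_incident_deformation ht he' hp hσ
        (i₀ := i₀) hσ₀ h2 (fun c => algebraMap K (Polynomial K ⧸ J) (b c))
      have h3 := aeval_eq_zero_of_isIncident hp i₀ j₀ hg hinc (s := Pi.single j₀ 1)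
        (t := Pi.single i₀ 1) (by simp [Pi.single_apply, hy]) (by simp [Pi.single_apply, hl])
      rw [aeval_rename] at h3
      change m P = 0
      rw [← h3, ← AlgHom.comp_apply, comp_aeval]
      congr 2
      funext c
      have hc : c.1.1 ≠ i₀ ∨ c.1.2.1 ≠ Pi.single j₀ (p i₀) := by
        by_contra! hcon
        refine c.2 ?_
        obtain ⟨⟨i, q⟩, hne⟩ := c
        obtain ⟨i', q'⟩ := c₀
        obtain ⟨h5, h6⟩ := hcon
        obtain ⟨h7, h8⟩ := hc₀
        dsimp only at h5 h6 h7 h8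
        subst h5 h7
        exact congrArg _ (Subtype.ext (h6.trans h8.symm))
      rw [Function.comp_apply, hab _ hc, map_add, map_mul]
      have h4 : coeffTuple p (baseForm p (algebraMap K (Polynomial K ⧸ J) 2⁻¹) σ i₀ j₀) c.1 =
          algebraMap K _ (x₀ c) := by
        simp only [coeffTuple, x₀, ← map_baseForm, coeff_map]
      rw [h4]
      rfl
    exact (Polynomial.X_pow_dvd_iff.1 h1 n (Nat.lt_succ_self n))
  -- At parameter 1 the line has reached `x`.
  have h5 : Polynomial.aeval (1 : K) P = eval x g := by
    simp only [P]
    rw [← AlgHom.comp_apply, comp_aeval, ← coe_aeval_eq_eval]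
    simp only [RingHom.coe_coe]
    congr 2
    funext c
    simp [b, c.2]
  rw [← h5, hP, map_zero, map_zero]

theorem exists_isClassicalDiscriminant {K : Type v} [Field K] [CharZero K]
    (hp : ∀ i, 1 ≤ p i) (hrk : r < k) {i₀ : Fin r} (h2 : 2 ≤ p i₀) :
    ∃ D, IsClassicalDiscriminant K k p D := by
  have := vanishingIdeal_discrLocus_isPrime (K := K) hp i₀ (⟨0, by omega⟩ : Fin k)
  refine exists_span_singleton_of_rename
    (⟨i₀, ⟨Pi.single ⟨0, by omega⟩ (p i₀), by simp [Finset.mem_piAntidiag]⟩⟩ : CoeffIdx k p) _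
    fun g hg => eq_zero_of_rename_mem_vanishingIdeal hp hrk h2 _ ⟨rfl, rfl⟩ g hg

end Hypersurface

/-! ## Covariance of the discriminant -/

section Covariance

open MvPolynomial

variable {r k : ℕ} {p p' : Fin r → ℕ}

/-- The linear substitution with matrix `S`. -/
def linSubst {A : Type*} [CommRing A] (S : Matrix (Fin k) (Fin k) A) :
    MvPolynomial (Fin k) A →ₐ[A] MvPolynomial (Fin k) A :=
  aeval fun x => linForm (S x)

theorem linSubst_isHomogeneous {A : Type*} [CommRing A] (S : Matrix (Fin k) (Fin k) A)
    {F : MvPolynomial (Fin k) A} {n : ℕ} (hF : F.IsHomogeneous n) :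
    (linSubst S F).IsHomogeneous n := by
  have := hF.aeval (fun x => linForm (S x)) (n := 1) fun x => linForm_isHomogeneous _
  rwa [one_mul] at this

theorem map_linSubst {A B : Type*} [CommRing A] [CommRing B] (f : A →+* B)
    (S : Matrix (Fin k) (Fin k) A) (F : MvPolynomial (Fin k) A) :
    map f (linSubst S F) = linSubst (S.map f) (map f F) := by
  induction F using MvPolynomial.induction_on with
  | C a => simp [linSubst]
  | add F G hF hG => simp only [map_add, hF, hG]
  | mul_X F i hF =>
    simp only [map_mul, hF, map_X]
    congr 1
    simp only [linSubst, aeval_X, map_linForm]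
    rfl

theorem eval_linSubst {A : Type*} [CommRing A] (S : Matrix (Fin k) (Fin k) A) (y : Fin k → A)
    (F : MvPolynomial (Fin k) A) : eval y (linSubst S F) = eval (S.mulVec y) F := by
  induction F using MvPolynomial.induction_on with
  | C a => simp [linSubst]
  | add F G hF hG => simp only [map_add, hF, hG]
  | mul_X F i hF =>
    simp only [map_mul, hF, eval_X]
    congr 1
    simp only [linSubst, aeval_X, eval_linForm]
    rfl

theorem linSubst_linSubst {A : Type*} [CommRing A] (S T : Matrix (Fin k) (Fin k) A)
    (F : MvPolynomial (Fin k) A) : linSubst S (linSubst T F) = linSubst (T * S) F := by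
  have : (linSubst S).comp (linSubst T) = linSubst (T * S) := by
    refine algHom_ext fun x => ?_
    simp only [AlgHom.comp_apply, linSubst, aeval_X]
    simp only [linForm, map_sum, map_mul, aeval_C, algebraMap_eq, aeval_X, Matrix.mul_apply,
      Finset.mul_sum, Finset.sum_mul]
    rw [Finset.sum_comm]
    simp only [mul_assoc]
  exact DFunLike.congr_fun this F

theorem linSubst_one {A : Type*} [CommRing A] (F : MvPolynomial (Fin k) A) :
    linSubst (1 : Matrix (Fin k) (Fin k) A) F = F := by
  have : linSubst (1 : Matrix (Fin k) (Fin k) A) = AlgHom.id A _ := by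
    refine algHom_ext fun x => ?_
    simp [linSubst, linForm, Matrix.one_apply]
  rw [this]; rfl

theorem eval_pderiv_linSubst {A : Type*} [CommRing A] (S : Matrix (Fin k) (Fin k) A)
    (y : Fin k → A) (z : Fin k) (F : MvPolynomial (Fin k) A) :
    eval y (pderiv z (linSubst S F)) = ∑ x, eval (S.mulVec y) (pderiv x F) * S x z := by
  induction F using MvPolynomial.induction_on with
  | C a => simp [linSubst]
  | add F G hF hG => simp only [map_add, hF, hG, add_mul, Finset.sum_add_distrib]
  | mul_X F i hF =>
    have h1 : linSubst S (X i) = linForm (S i) := by simp [linSubst]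
    have h2 : eval y (linForm (S i)) = (S.mulVec y) i := by rw [eval_linForm]; rfl
    have h3 : ∀ x, eval (S.mulVec y) (pderiv x (F * X i)) * S x z =
        (if i = x then eval (S.mulVec y) F * S x z else 0) +
          (S.mulVec y) i * (eval (S.mulVec y) (pderiv x F) * S x z) := by
      intro x
      rw [Derivation.leibniz, pderiv_X]
      by_cases hx : i = x
      · subst hx; simp; ring
      · simp [hx]; ring
    rw [map_mul, Derivation.leibniz, h1, pderiv_linForm]
    simp only [h3, smul_eq_mul, map_add, map_mul, eval_C, hF, h2, eval_linSubst,
      Finset.sum_add_distrib, Finset.sum_ite_eq, Finset.mem_univ, if_true, ← Finset.mul_sum]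

/-- At the transported common zero, the derivatives of the `H i j` drop out, so the new Jacobian is
a product with the old one as a factor, and its rank cannot grow. Only `S` must be invertible, to
transport the point; `H` may degenerate. -/
theorem mem_discrLocus_of_transform {L : Type*} [Field L] {a : CoeffIdx k p → L}
    {a' : CoeffIdx k p' → L} {H : Fin r → Fin r → MvPolynomial (Fin k) L}
    {S T : Matrix (Fin k) (Fin k) L} (hST : S * T = 1)
    (h : ∀ i, form a' i = ∑ j, H i j * linSubst S (form a j)) (ha : a ∈ discrLocus L k p) :
    a' ∈ discrLocus L k p' := by
  obtain ⟨y, hy, h0, hr⟩ := ha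
  have hy' : S.mulVec (T.mulVec y) = y := by rw [Matrix.mulVec_mulVec, hST, Matrix.one_mulVec]
  refine ⟨T.mulVec y, fun hT => hy (by rw [← hy', hT, Matrix.mulVec_zero]), fun i => ?_, ?_⟩
  · rw [h, map_sum]
    refine Finset.sum_eq_zero fun j _ => ?_
    rw [map_mul, eval_linSubst, hy', h0, mul_zero]
  · have hJ : jacobian a' (T.mulVec y) =
        Matrix.of (fun i j => eval (T.mulVec y) (H i j)) * jacobian a y * S := by
      ext i z
      simp only [jacobian, Matrix.of_apply, Matrix.mul_apply, h, map_sum, Finset.sum_mul,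
        Derivation.leibniz, smul_eq_mul, map_add, map_mul, eval_pderiv_linSubst, eval_linSubst, hy',
        h0, zero_mul, add_zero, Finset.mul_sum]
      rw [Finset.sum_comm]
      simp only [mul_assoc]
    rw [hJ]
    exact ((Matrix.rank_mul_le_left _ _).trans (Matrix.rank_mul_le_right _ _)).trans_lt hr

theorem aeval_eq_zero_of_mem_discrLocus {K : Type v} [Field K] [Infinite K] {L : Type*} [Field L]
    [Algebra K L] (hp : ∀ i, 1 ≤ p i) (i₀ : Fin r) (j₀ : Fin k)
    {h : MvPolynomial (CoeffIdx k p) K} (hh : h ∈ vanishingIdeal K (discrLocus K k p))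
    {a : CoeffIdx k p → L} (ha : a ∈ discrLocus L k p) : aeval a h = 0 := by
  obtain ⟨y, hy, l, hl, hinc⟩ := mem_discrLocus_iff.1 ha
  obtain ⟨s, hs⟩ := exists_dual hy
  obtain ⟨t, ht⟩ := exists_dual hl
  exact aeval_eq_zero_of_isIncident hp i₀ j₀ hh hinc hs ht

/-- Work with an indeterminate tuple, indeterminate `S` and indeterminate coefficients of `H`. At
the universal incident tuple the transformed tuple lies in the discriminant locus of a field, so the
polynomial obtained from `f` has all its coefficients in the ideal of Δ; specialising to `A`, where
that ideal vanishes at `a`, gives zero. This covers rings with nilpotents, as needed for comparing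
ideals. -/
theorem aeval_eq_zero_of_transform {K : Type v} [Field K] [Infinite K] {A : Type*} [CommRing A]
    [Algebra K A] (hp : ∀ i, 1 ≤ p i) (hp' : ∀ i, 1 ≤ p' i) (i₀ : Fin r) (j₀ : Fin k)
    {a : CoeffIdx k p → A} {a' : CoeffIdx k p' → A}
    {H : Fin r → Fin r → MvPolynomial (Fin k) A}
    (hH : ∀ i j, p j ≤ p' i → (H i j).IsHomogeneous (p' i - p j))
    (hH0 : ∀ i j, p' i < p j → H i j = 0) (S : Matrix (Fin k) (Fin k) A)
    (h : ∀ i, form a' i = ∑ j, H i j * linSubst S (form a j))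
    (ha : ∀ f ∈ vanishingIdeal K (discrLocus K k p), aeval a f = 0) :
    ∀ f ∈ vanishingIdeal K (discrLocus K k p'), aeval a' f = 0 := by
  intro f hf
  let R := MvPolynomial (CoeffIdx k p) K
  -- One variable for each element of `A`, sent to that element, lifts the coefficients of every `H
  -- i j` at once.
  let τ := A ⊕ (Fin k × Fin k)
  let ev : MvPolynomial τ R →ₐ[K] A :=
    aevalTower (aeval (R := K) a) (Sum.elim id fun xz => S xz.1 xz.2)
  let H₁ : Fin r → Fin r → MvPolynomial (Fin k) (MvPolynomial τ R) := fun i j =>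
    ∑ m ∈ (H i j).support, monomial m (X (Sum.inl (coeff m (H i j))))
  let S₁ : Matrix (Fin k) (Fin k) (MvPolynomial τ R) := Matrix.of fun x z => X (Sum.inr (x, z))
  let F₁ : Fin r → MvPolynomial (Fin k) (MvPolynomial τ R) :=
    form (p := p) fun c => C (X c)
  let G : Fin r → MvPolynomial (Fin k) (MvPolynomial τ R) := fun i =>
    ∑ j, H₁ i j * linSubst S₁ (F₁ j)
  have hG : ∀ i, (G i).IsHomogeneous (p' i) := by
    intro i
    refine IsHomogeneous.sum _ _ _ fun j _ => ?_
    rcases le_or_gt (p j) (p' i) with hij | hij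
    · have h1 : (H₁ i j).IsHomogeneous (p' i - p j) := by
        refine IsHomogeneous.sum _ _ _ fun m hm => isHomogeneous_monomial _ ?_
        by_contra hne
        exact (mem_support_iff.1 hm) ((hH i j hij).coeff_eq_zero hne)
      have := h1.mul (linSubst_isHomogeneous S₁ (form_isHomogeneous (fun c => C (X c)) j))
      rwa [Nat.sub_add_cancel hij] at this
    · have : H₁ i j = 0 := by simp [H₁, hH0 i j hij]
      rw [this, zero_mul]
      exact isHomogeneous_zero _ _ _
  let a₁ : CoeffIdx k p' → MvPolynomial τ R := coeffTuple p' G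
  have hform : ∀ i, form a₁ i = G i := fun i => form_coeffTuple (hG i)
  have hH₁ : ∀ i j, map (ev : MvPolynomial τ R →+* A) (H₁ i j) = H i j := by
    intro i j
    conv_rhs => rw [(H i j).as_sum]
    simp [H₁, map_monomial, ev]
  have hev : ∀ i, map (ev : MvPolynomial τ R →+* A) (G i) = form a' i := by
    intro i
    rw [h i]
    simp only [G, map_sum, map_mul, hH₁, map_linSubst, F₁, map_form]
    have h1 : (ev : MvPolynomial τ R →+* A) ∘ (fun c => C (X c)) = a := by
      funext c
      have h3 : ev (C (X c : R)) = aeval (R := K) a (X c) := aevalTower_C _ _ _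
      exact h3.trans (aeval_X _ _)
    have h2 : S₁.map (ev : MvPolynomial τ R →+* A) = S := by
      ext x z; simp [S₁, ev]
    rw [h1, h2]
  have ha₁ : ev ∘ a₁ = a' := by
    funext ⟨i, m⟩
    have := congrArg (coeff (Finsupp.equivFunOnFinite.symm m.1)) (hev i)
    rw [coeff_map] at this
    exact this.trans (congrFun (coeffTuple_form a') ⟨i, m⟩)
  let B := MvPolynomial (IncidentVar k p) K
  let φ : R →ₐ[K] B := aeval (univTuple K k p)
  let θ : MvPolynomial τ R →ₐ[K] MvPolynomial τ B := mapAlgHom φ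
  let Q := FractionRing (MvPolynomial τ B)
  let ι : MvPolynomial τ B →ₐ[K] Q := IsScalarTower.toAlgHom K _ _
  have hι : Function.Injective ι := IsFractionRing.injective _ _
  let κ : MvPolynomial τ R →ₐ[K] Q := ι.comp θ
  have hloc : κ ∘ (fun c => C (X c)) ∈ discrLocus Q k p := by
    have h1 : κ ∘ (fun c => C (X c)) = (ι.toRingHom.comp C) ∘ univTuple K k p := by
      funext c
      have h2 : κ (C (X c : R)) = ι (C (φ (X c))) := by simp [κ, θ]
      exact h2.trans (congrArg (fun b => ι (C b)) (aeval_X _ _))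
    rw [h1]
    refine mem_discrLocus_iff.2 ⟨_, fun h0 => ?_, _, fun h0 => ?_,
      (isIncident_incidentTuple _ _ _ _ _ hp).map (ι.toRingHom.comp C)⟩
    · have h2 := congrFun h0 j₀
      exact X_ne_zero (R := K) _ (C_injective τ B (hι (h2.trans (by simp))))
    · have h2 := congrFun h0 i₀
      exact X_ne_zero (R := K) _ (C_injective τ B (hι (h2.trans (by simp))))
  -- The generic matrix is invertible over `Q`, although `S` itself is not assumed to be.
  have hdet : (S₁.map κ).det ≠ 0 := by
    have h1 : S₁.map κ = (Matrix.mvPolynomialX (Fin k) (Fin k) B).map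
        (ι.toRingHom.comp (rename Sum.inr : MvPolynomial (Fin k × Fin k) B →ₐ[B] _).toRingHom) := by
      ext x z
      simp [S₁, κ, θ]
    rw [h1, ← RingHom.mapMatrix_apply, ← RingHom.map_det]
    intro h0
    refine Matrix.det_mvPolynomialX_ne_zero (Fin k) B ?_
    refine rename_injective _ Sum.inr_injective (hι ?_)
    rw [map_zero, map_zero]
    exact h0
  have hinv : S₁.map κ * (S₁.map κ)⁻¹ = 1 :=
    Matrix.mul_nonsing_inv _ (isUnit_iff_ne_zero.2 hdet)
  have hloc' : κ ∘ a₁ ∈ discrLocus Q k p' := by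
    refine mem_discrLocus_of_transform hinv
      (H := fun i j => map (κ : MvPolynomial τ R →+* Q) (H₁ i j)) (fun i => ?_) hloc
    have := congrArg (map (κ : MvPolynomial τ R →+* Q)) (hform i)
    rw [map_form] at this
    refine this.trans ?_
    simp only [G, map_sum, map_mul, map_linSubst, F₁, map_form]
    rfl
  have hzero := aeval_eq_zero_of_mem_discrLocus hp' i₀ j₀ hf hloc'
  have h1 : θ (aeval a₁ f) = 0 := by
    refine hι ?_
    rw [map_zero, ← hzero, ← AlgHom.comp_apply, ← AlgHom.comp_apply, comp_aeval]
    rfl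
  -- The kernel of a coefficientwise map consists of the polynomials with coefficients in the kernel
  -- of `φ`, that is, in the ideal of Δ.
  have h2 : aeval a₁ f ∈ Ideal.map C (RingHom.ker φ.toRingHom) := by
    rw [← ker_map]
    exact h1
  have h3 : Ideal.map C (RingHom.ker φ.toRingHom) ≤ RingHom.ker ev := by
    rw [Ideal.map_le_iff_le_comap]
    intro g hg
    rw [Ideal.mem_comap, RingHom.mem_ker]
    have h4 : ev (C g) = aeval a g := by simp [ev]
    rw [h4]
    refine ha g ?_
    rw [vanishingIdeal_discrLocus_eq_ker hp i₀ j₀]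
    exact hg
  have h5 := h3 h2
  rw [RingHom.mem_ker, ← AlgHom.comp_apply, comp_aeval] at h5
  rw [← ha₁]
  exact h5

end Covariance

/-! ## Quasi-regular sequences -/

section QuasiRegular

open MvPolynomial

variable {R : Type*} [CommRing R] {k : ℕ}

/-- A sequence `g` generating the ideal `I` is quasi-regular if a form whose value at `g` lies in
a higher power of `I` than expected has coefficients in `I`. -/
def IsQuasiRegular (g : Fin k → R) : Prop :=
  ∀ (n : ℕ) (F : MvPolynomial (Fin k) R), F.IsHomogeneous n →
    eval g F ∈ Ideal.span (Set.range g) ^ (n + 1) → F ∈ (Ideal.span (Set.range g)).map C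

theorem eval_mem_mul_pow {g : Fin k → R} {J : Ideal R} {n : ℕ} {F : MvPolynomial (Fin k) R}
    (hF : F.IsHomogeneous n) (hJ : F ∈ J.map C) : eval g F ∈ J * Ideal.span (Set.range g) ^ n := by
  rw [F.as_sum, map_sum]
  refine Ideal.sum_mem _ fun d hd => ?_
  rw [monomial_eq, map_mul, eval_C]
  refine Ideal.mul_mem_mul (mem_map_C_iff.1 hJ d) ?_
  have h1 : (monomial d (1 : R)).IsHomogeneous n :=
    isHomogeneous_monomial _ (by
      by_contra hne
      exact (mem_support_iff.1 hd) (hF.coeff_eq_zero hne))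
  refine (Ideal.mem_span_pow_iff_exists_isHomogeneous g _).2 ⟨_, h1, ?_⟩
  rw [monomial_eq, C_1, one_mul]

theorem exists_form_of_mem_mul_pow {g : Fin k → R} {J : Ideal R} {n : ℕ} {x : R}
    (hx : x ∈ J * Ideal.span (Set.range g) ^ n) :
    ∃ F : MvPolynomial (Fin k) R, F.IsHomogeneous n ∧ F ∈ J.map C ∧ eval g F = x := by
  induction hx using Submodule.mul_induction_on' with
  | mem_mul_mem c hc y hy =>
    obtain ⟨F, hF, rfl⟩ := (Ideal.mem_span_pow_iff_exists_isHomogeneous g y).1 hy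
    exact ⟨C c * F, hF.C_mul c, Ideal.mul_mem_right _ _ (Ideal.mem_map_of_mem C hc), by simp⟩
  | add x _ y _ hx hy =>
    obtain ⟨F, hF, hFJ, rfl⟩ := hx
    obtain ⟨G, hG, hGJ, rfl⟩ := hy
    exact ⟨F + G, hF.add hG, Ideal.add_mem _ hFJ hGJ, map_add _ _ _⟩

/-- An element of `I ^ (n + 1)` is also the value of a form of degree `n` with coefficients in `I`;
subtracting that form reduces to value zero. -/
theorem mem_map_C_of_eval_mem {g : Fin k → R} {n : ℕ}
    (h : ∀ F : MvPolynomial (Fin k) R, F.IsHomogeneous n → eval g F = 0 →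
      F ∈ (Ideal.span (Set.range g)).map C)
    {F : MvPolynomial (Fin k) R} (hF : F.IsHomogeneous n)
    (hFg : eval g F ∈ Ideal.span (Set.range g) ^ (n + 1)) :
    F ∈ (Ideal.span (Set.range g)).map C := by
  rw [pow_succ'] at hFg
  obtain ⟨G, hG, hGI, hFG⟩ := exists_form_of_mem_mul_pow hFg
  have := h (F - G) (hF.sub hG) (by rw [map_sub, hFG, sub_self])
  simpa using Ideal.add_mem _ this hGI

theorem exists_rename_add_X_mul {n : ℕ} {F : MvPolynomial (Fin (k + 1)) R}
    (hF : F.IsHomogeneous (n + 1)) :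
    ∃ (G : MvPolynomial (Fin k) R) (H : MvPolynomial (Fin (k + 1)) R),
      G.IsHomogeneous (n + 1) ∧ H.IsHomogeneous n ∧
        F = rename Fin.castSucc G + X (Fin.last k) * H := by
  have key : ∀ s : Finset (Fin (k + 1) →₀ ℕ), s ⊆ F.support →
      ∃ (G : MvPolynomial (Fin k) R) (H : MvPolynomial (Fin (k + 1)) R),
      G.IsHomogeneous (n + 1) ∧ H.IsHomogeneous n ∧
        ∑ d ∈ s, monomial d (coeff d F) = rename Fin.castSucc G + X (Fin.last k) * H := by
    intro s
    induction s using Finset.cons_induction with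
    | empty => exact fun _ => ⟨0, 0, isHomogeneous_zero _ _ _, isHomogeneous_zero _ _ _, by simp⟩
    | cons d s hd ih =>
      intro hs
      obtain ⟨G, H, hG, hH, hGH⟩ := ih ((Finset.subset_cons hd).trans hs)
      have hdeg : d.degree = n + 1 := by
        by_contra hne
        exact (mem_support_iff.1 (hs (Finset.mem_cons_self d s))) (hF.coeff_eq_zero hne)
      rw [Finset.sum_cons, hGH]
      by_cases h0 : d (Fin.last k) = 0
      · have hmap : (d.comapDomain Fin.castSucc
            (Fin.castSucc_injective k).injOn).mapDomain Fin.castSucc = d := by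
          refine Finsupp.mapDomain_comapDomain _ (Fin.castSucc_injective k) _ fun j hj => ?_
          refine ⟨j.castPred ?_, Fin.castSucc_castPred _ _⟩
          rintro rfl
          exact (Finsupp.mem_support_iff.1 hj) h0
        refine ⟨monomial (d.comapDomain Fin.castSucc (Fin.castSucc_injective k).injOn)
          (coeff d F) + G, H, (isHomogeneous_monomial _ ?_).add hG, hH, ?_⟩
        · rw [← hdeg]
          conv_rhs => rw [← hmap]
          rw [Finsupp.degree_mapDomain]
        · rw [map_add, rename_monomial, hmap, add_assoc]
      · have hle : Finsupp.single (Fin.last k) 1 ≤ d := by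
          rw [Finsupp.single_le_iff]; omega
        have hd' : Finsupp.single (Fin.last k) 1 + (d - Finsupp.single (Fin.last k) 1) = d :=
          add_tsub_cancel_of_le hle
        refine ⟨G, monomial (d - Finsupp.single (Fin.last k) 1) (coeff d F) + H, hG,
          (isHomogeneous_monomial _ ?_).add hH, ?_⟩
        · have := congrArg Finsupp.degree hd'
          rw [map_add, Finsupp.degree_single, hdeg] at this
          omega
        · have : (X (Fin.last k) : MvPolynomial (Fin (k + 1)) R) *
              monomial (d - Finsupp.single (Fin.last k) 1) (coeff d F) =
                monomial d (coeff d F) := by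
            rw [X, monomial_mul, hd', one_mul]
          rw [mul_add, this]; ring
  obtain ⟨G, H, hG, hH, h⟩ := key F.support subset_rfl
  exact ⟨G, H, hG, hH, by rw [← h, ← F.as_sum]⟩

/-- Cancellation modulo `I` lifts to all powers: write `c` as the value of a form `G` of degree `n`;
quasi-regularity puts the coefficients of `a G` into `I`, and cancelling `a` puts those of `G`
there. -/
theorem IsQuasiRegular.mem_pow_of_mul_mem_pow {g : Fin k → R} (hg : IsQuasiRegular g) {a : R}
    (ha : ∀ c, a * c ∈ Ideal.span (Set.range g) → c ∈ Ideal.span (Set.range g)) (n : ℕ) {c : R}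
    (hc : a * c ∈ Ideal.span (Set.range g) ^ n) : c ∈ Ideal.span (Set.range g) ^ n := by
  induction n with
  | zero => simp
  | succ n ih =>
    have h1 := ih (Ideal.pow_le_pow_right (Nat.le_succ n) hc)
    obtain ⟨G, hG, rfl⟩ := (Ideal.mem_span_pow_iff_exists_isHomogeneous g c).1 h1
    have h2 := hg n (C a * G) (hG.C_mul a) (by simpa using hc)
    rw [pow_succ']
    refine eval_mem_mul_pow hG (mem_map_C_iff.2 fun m => ha _ ?_)
    have := mem_map_C_iff.1 h2 m
    rwa [coeff_C_mul] at this

/-- Regular sequences are quasi-regular, by induction on the length and, inside it, on the degree.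
After splitting off the last variable, a relation says that the last element times the value of `H`
lies in a power of the ideal `J` of the shorter sequence, and the last element cancels modulo powers
of `J`. -/
theorem isQuasiRegular_of_forall {k : ℕ} (g : Fin k → R)
    (hg : ∀ (i : Fin k) (c : R), g i * c ∈ Ideal.span (g '' {j | j < i}) →
      c ∈ Ideal.span (g '' {j | j < i})) : IsQuasiRegular g := by
  induction k with
  | zero =>
    intro n F hF hFg
    refine mem_map_C_iff.2 fun m => ?_
    have hI : Ideal.span (Set.range g) = ⊥ := by simp
    rw [hI, Submodule.mem_bot]
    rw [hI, pow_succ, Ideal.mul_bot, Submodule.mem_bot] at hFg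
    rw [F.eq_C_of_isEmpty] at hFg ⊢
    rw [eval_C] at hFg
    simp [hFg]
  | succ k ih =>
    have himg : ∀ i : Fin k, (g ∘ Fin.castSucc) '' {j | j < i} = g '' {j | j < i.castSucc} := by
      intro i
      rw [Set.image_comp]
      congr 1
      ext j
      constructor
      · rintro ⟨j, hj, rfl⟩; exact hj
      · intro hj
        exact ⟨j.castPred (fun h => by
          subst h
          exact absurd (lt_trans hj (Fin.castSucc_lt_last i)) (lt_irrefl _)), hj, by simp⟩
    have hrange : Set.range (g ∘ Fin.castSucc) = g '' {j | j < Fin.last k} := by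
      rw [Set.range_comp]
      congr 1
      ext j
      constructor
      · rintro ⟨j, rfl⟩; exact Fin.castSucc_lt_last j
      · intro hj; exact ⟨j.castPred (ne_of_lt hj), by simp⟩
    have hg' : IsQuasiRegular (g ∘ Fin.castSucc) := ih _ fun i c => by
      rw [himg]; exact hg i.castSucc c
    have ha := hg (Fin.last k)
    rw [← hrange] at ha
    have hle : Ideal.span (Set.range (g ∘ Fin.castSucc)) ≤ Ideal.span (Set.range g) :=
      Ideal.span_mono (Set.range_comp_subset_range _ _)
    intro n
    induction n with
    | zero =>
      intro F hF
      refine mem_map_C_of_eval_mem (fun F hF h0 => ?_) hF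
      rw [← totalDegree_zero_iff_isHomogeneous, totalDegree_eq_zero_iff_eq_C] at hF
      rw [hF, eval_C] at h0
      rw [hF, h0, C_0]
      exact Ideal.zero_mem _
    | succ n ihn =>
      intro F hF
      refine mem_map_C_of_eval_mem (fun F hF h0 => ?_) hF
      obtain ⟨G, H, hG, hH, rfl⟩ := exists_rename_add_X_mul hF
      rw [map_add, map_mul, eval_X, eval_rename] at h0
      have h1 : g (Fin.last k) * eval g H ∈
          Ideal.span (Set.range (g ∘ Fin.castSucc)) ^ (n + 1) := by
        have h2 : g (Fin.last k) * eval g H = eval (g ∘ Fin.castSucc) (-G) := by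
          rw [map_neg]; linear_combination h0
        rw [h2]
        exact (Ideal.mem_span_pow_iff_exists_isHomogeneous _ _).2 ⟨-G, hG.neg, rfl⟩
      have h2 := hg'.mem_pow_of_mul_mem_pow ha (n + 1) h1
      have h3 := ihn H hH (Ideal.pow_right_mono hle _ h2)
      -- `H` has degree `n`, yet its value lies in the power `n + 1` of the smaller ideal. So it is
      -- also the value of a form `h` of degree `n + 1` in the shorter sequence, and `G` plus the
      -- last element times `h` is a relation there.
      obtain ⟨h, hh, hhH⟩ := (Ideal.mem_span_pow_iff_exists_isHomogeneous _ _).1 h2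
      have h4 := hg' (n + 1) (G + C (g (Fin.last k)) * h) (hG.add (hh.C_mul _)) (by
        rw [map_add, map_mul, eval_C, hhH, h0]
        exact Ideal.zero_mem _)
      refine Ideal.add_mem _ ?_ (Ideal.mul_mem_left _ _ h3)
      have h5 : rename Fin.castSucc G = rename Fin.castSucc (G + C (g (Fin.last k)) * h) -
          C (g (Fin.last k)) * rename Fin.castSucc h := by
        rw [map_add, map_mul, rename_C]; ring
      rw [h5]
      refine Ideal.sub_mem _ ?_ (Ideal.mul_mem_right _ _
        (Ideal.mem_map_of_mem C (Ideal.subset_span ⟨_, rfl⟩)))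
      have h6 : (Ideal.span (Set.range (g ∘ Fin.castSucc))).map C ≤
          ((Ideal.span (Set.range g)).map C).comap
            (rename Fin.castSucc : MvPolynomial (Fin k) R →ₐ[R] _) := by
        rw [Ideal.map_le_iff_le_comap]
        intro c hc
        rw [Ideal.mem_comap, Ideal.mem_comap, rename_C]
        exact Ideal.mem_map_of_mem C (hle hc)
      exact h6 h4

theorem isQuasiRegular_of_isRegular {g : Fin k → R}
    (hg : RingTheory.Sequence.IsRegular R (List.ofFn g)) : IsQuasiRegular g := by
  refine isQuasiRegular_of_forall g fun i c hc => ?_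
  have h1 := hg.regular_mod_prev i (by simp)
  have h2 : Ideal.ofList ((List.ofFn g).take i) = Ideal.span (g '' {j | j < i}) := by
    rw [Ideal.ofList]
    congr 1
    ext x
    simp only [Set.mem_ofPred_eq, List.mem_take_iff_getElem, Set.mem_image]
    constructor
    · rintro ⟨j, hj, rfl⟩
      simp at hj ⊢
      exact ⟨⟨j, by omega⟩, hj, rfl⟩
    · rintro ⟨j, hj, rfl⟩
      exact ⟨j, by simp; exact hj, by simp⟩
  rw [h2] at h1
  have h3 : Ideal.span (g '' {j | j < i}) • (⊤ : Submodule R R) =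
      Ideal.span (g '' {j | j < i}) := by simp
  rw [h3] at h1
  rw [← Submodule.Quotient.mk_eq_zero] at hc ⊢
  have h4 : (List.ofFn g)[(i : ℕ)]'(by simp) = g i := by simp
  rw [h4] at h1
  exact h1.right_eq_zero_of_smul hc

theorem mem_map_C_iff_map_mk_eq_zero {I : Ideal R} {F : MvPolynomial (Fin k) R} :
    F ∈ I.map C ↔ map (Ideal.Quotient.mk I) F = 0 := by
  rw [← RingHom.mem_ker, ker_map, Ideal.mk_ker]

theorem exists_matrix_of_span_le {g g' : Fin k → R}
    (h : Ideal.span (Set.range g) ≤ Ideal.span (Set.range g')) :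
    ∃ T : Matrix (Fin k) (Fin k) R, T.mulVec g' = g := by
  have h1 : ∀ j, ∃ c : Fin k → R, ∑ l, c l * g' l = g j := fun j =>
    (Ideal.mem_span_range_iff_exists_fun).1 (h (Ideal.subset_span ⟨j, rfl⟩))
  choose T hT using h1
  exact ⟨T, funext hT⟩

theorem coeff_linForm (w : Fin k → R) (j : Fin k) :
    coeff (Finsupp.single j 1) (linForm w) = w j := by
  simp [linForm, coeff_sum, coeff_C_mul, coeff_X, Finsupp.single_left_inj]

/-- The rows of `T * T' - 1` are linear relations among the entries of `g`, so quasi-regularity in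
degree one puts their entries into the ideal. -/
theorem IsQuasiRegular.map_mul_map_eq_one {g g' : Fin k → R} (hg : IsQuasiRegular g)
    {T T' : Matrix (Fin k) (Fin k) R} (hT : T.mulVec g' = g) (hT' : T'.mulVec g = g') :
    T.map (Ideal.Quotient.mk (Ideal.span (Set.range g))) *
      T'.map (Ideal.Quotient.mk (Ideal.span (Set.range g))) = 1 := by
  set mk := Ideal.Quotient.mk (Ideal.span (Set.range g))
  have h1 : ∀ i, linForm ((T * T' - 1 : Matrix (Fin k) (Fin k) R) i) ∈
      (Ideal.span (Set.range g)).map C := by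
    intro i
    refine hg 1 _ (linForm_isHomogeneous _) ?_
    have h2 : (T * T' - 1 : Matrix (Fin k) (Fin k) R).mulVec g = 0 := by
      rw [Matrix.sub_mulVec, ← Matrix.mulVec_mulVec, hT', hT, Matrix.one_mulVec, sub_self]
    rw [eval_linForm]
    have h3 := congrFun h2 i
    rw [Matrix.mulVec, dotProduct, Pi.zero_apply] at h3
    rw [h3]
    exact Ideal.zero_mem _
  rw [← Matrix.map_mul, ← sub_eq_zero]
  ext i j
  have h2 := mem_map_C_iff.1 (h1 i) (Finsupp.single j 1)
  have h3 : coeff (Finsupp.single j 1) (linForm ((T * T' - 1 : Matrix (Fin k) (Fin k) R) i)) =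
      (T * T' - 1 : Matrix (Fin k) (Fin k) R) i j := coeff_linForm _ _
  rw [h3, ← Ideal.Quotient.eq_zero_iff_mem, Matrix.sub_apply, map_sub] at h2
  rw [Matrix.sub_apply, Matrix.map_apply, Matrix.zero_apply]
  refine Eq.trans ?_ h2
  congr 1
  rw [Matrix.one_apply, Matrix.one_apply]
  split_ifs <;> simp

/-- The base change between the two systems is invertible modulo the ideal, so a form may be
transported to the other system and back. -/
theorem IsQuasiRegular.of_span_eq {g g' : Fin k → R} (hg : IsQuasiRegular g)
    (h : Ideal.span (Set.range g) = Ideal.span (Set.range g')) : IsQuasiRegular g' := by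
  obtain ⟨T, hT⟩ := exists_matrix_of_span_le h.le
  obtain ⟨T', hT'⟩ := exists_matrix_of_span_le h.ge
  have hTT := hg.map_mul_map_eq_one hT hT'
  intro n F hF hFg
  rw [← h] at hFg ⊢
  rw [← hT', ← eval_linSubst] at hFg
  have h1 := hg n _ (linSubst_isHomogeneous T' hF) hFg
  rw [mem_map_C_iff_map_mk_eq_zero, map_linSubst] at h1
  rw [mem_map_C_iff_map_mk_eq_zero]
  have h2 := congrArg (linSubst (T.map (Ideal.Quotient.mk (Ideal.span (Set.range g))))) h1
  rwa [linSubst_linSubst, mul_eq_one_comm.1 hTT, linSubst_one, map_zero] at h2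

theorem exists_forms_of_mem_iSup {r : ℕ} {p : Fin r → ℕ} {g : Fin k → R} {f : Fin r → R} {n : ℕ}
    {x : R} (hx : x ∈ ⨆ (i : Fin r) (_ : p i ≤ n),
      Ideal.span {f i} * Ideal.span (Set.range g) ^ (n - p i)) :
    ∃ h : Fin r → MvPolynomial (Fin k) R, (∀ j, p j ≤ n → (h j).IsHomogeneous (n - p j)) ∧
      (∀ j, n < p j → h j = 0) ∧ x = ∑ j, eval g (h j) * f j := by
  induction hx using Submodule.iSup_induction' with
  | mem i x hx =>
    by_cases hi : p i ≤ n
    · rw [iSup_pos hi] at hx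
      obtain ⟨z, hz, rfl⟩ := Ideal.mem_span_singleton_mul.1 hx
      obtain ⟨F, hF, rfl⟩ := (Ideal.mem_span_pow_iff_exists_isHomogeneous g z).1 hz
      refine ⟨Pi.single i F, fun j hj => ?_, fun j hj => ?_, ?_⟩
      · by_cases hji : j = i
        · subst hji; simpa using hF
        · rw [Pi.single_eq_of_ne hji]; exact isHomogeneous_zero _ _ _
      · rw [Pi.single_eq_of_ne]
        rintro rfl; omega
      · rw [Finset.sum_eq_single i]
        · rw [Pi.single_eq_same, mul_comm]
        · intro j _ hj
          rw [Pi.single_eq_of_ne hj, map_zero, zero_mul]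
        · simp
    · rw [iSup_neg hi] at hx
      rw [Submodule.mem_bot] at hx
      exact ⟨0, fun _ _ => isHomogeneous_zero _ _ _, fun _ _ => rfl, by simp [hx]⟩
  | zero => exact ⟨0, fun _ _ => isHomogeneous_zero _ _ _, fun _ _ => rfl, by simp⟩
  | add x y _ _ hx hy =>
    obtain ⟨h, h1, h2, rfl⟩ := hx
    obtain ⟨h', h1', h2', rfl⟩ := hy
    refine ⟨h + h', fun j hj => (h1 j hj).add (h1' j hj), fun j hj => ?_, ?_⟩
    · rw [Pi.add_apply, h2 j hj, h2' j hj, add_zero]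
    · simp [add_mul, Finset.sum_add_distrib]

/-- Each value of a primed form lies in `J ⊓ I ^ p' i`, so `hlead` writes it as a combination of the
unprimed values up to `I ^ (p' i + 1)`. Substituting `g' = T' g` makes both sides forms of degree
`p' i` in `g`, and quasi-regularity equates their coefficients modulo `I`. -/
theorem IsQuasiRegular.exists_transform {r : ℕ} {p p' : Fin r → ℕ} {I J : Ideal R}
    {g g' : Fin k → R} (hg : IsQuasiRegular g) (hgI : Ideal.span (Set.range g) = I)
    (hgI' : Ideal.span (Set.range g') = I) {a : CoeffIdx k p → R} {a' : CoeffIdx k p' → R}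
    (hJ : ∀ i, eval g' (form a' i) ∈ J)
    (hlead : ∀ n, J ⊓ I ^ n ≤ (⨆ (i : Fin r) (_ : p i ≤ n),
      Ideal.span {eval g (form a i)} * I ^ (n - p i)) ⊔ I ^ (n + 1)) :
    ∃ (H : Fin r → Fin r → MvPolynomial (Fin k) (R ⧸ I)) (S T : Matrix (Fin k) (Fin k) (R ⧸ I)),
      (∀ i j, p j ≤ p' i → (H i j).IsHomogeneous (p' i - p j)) ∧
      (∀ i j, p' i < p j → H i j = 0) ∧ S * T = 1 ∧
      ∀ i, form (Ideal.Quotient.mk I ∘ a') i =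
        ∑ j, H i j * linSubst S (form (Ideal.Quotient.mk I ∘ a) j) := by
  subst hgI
  obtain ⟨T, hT⟩ := exists_matrix_of_span_le hgI'.ge
  obtain ⟨T', hT'⟩ := exists_matrix_of_span_le hgI'.le
  have hTT := hg.map_mul_map_eq_one hT hT'
  set I := Ideal.span (Set.range g) with hI
  set mk := Ideal.Quotient.mk I with hmk
  have key : ∀ i, ∃ h : Fin r → MvPolynomial (Fin k) R,
      (∀ j, p j ≤ p' i → (h j).IsHomogeneous (p' i - p j)) ∧ (∀ j, p' i < p j → h j = 0) ∧
      linSubst (T'.map mk) (form (mk ∘ a') i) = ∑ j, map mk (h j) * form (mk ∘ a) j := by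
    intro i
    have h1 : eval g' (form a' i) ∈ I ^ p' i := by
      rw [← hgI']
      exact (Ideal.mem_span_pow_iff_exists_isHomogeneous _ _).2 ⟨_, form_isHomogeneous a' i, rfl⟩
    obtain ⟨x, hx, e, he, hxe⟩ := Submodule.mem_sup.1 (hlead (p' i) ⟨hJ i, h1⟩)
    obtain ⟨h, hh, hh0, rfl⟩ := exists_forms_of_mem_iSup hx
    refine ⟨h, hh, hh0, ?_⟩
    have h2 : (∑ j, h j * form a j).IsHomogeneous (p' i) := by
      refine IsHomogeneous.sum _ _ _ fun j _ => ?_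
      rcases le_or_gt (p j) (p' i) with hj | hj
      · have := (hh j hj).mul (form_isHomogeneous a j)
        rwa [Nat.sub_add_cancel hj] at this
      · rw [hh0 j hj, zero_mul]; exact isHomogeneous_zero _ _ _
    have h3 := hg (p' i) (linSubst T' (form a' i) - ∑ j, h j * form a j)
      ((linSubst_isHomogeneous T' (form_isHomogeneous a' i)).sub h2) (by
        rw [map_sub, eval_linSubst, hT', ← hxe, map_sum]
        simp only [map_mul, add_sub_cancel_left]
        exact he)
    rw [mem_map_C_iff_map_mk_eq_zero, map_sub, sub_eq_zero, map_linSubst, map_form, map_sum] at h3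
    rw [h3]
    simp only [map_mul, map_form]
    rfl
  choose h hh hh0 hform using key
  -- The relation found holds after the substitution `T'`; applying the inverse substitution `T`
  -- solves for the primed forms, and is absorbed into `H`.
  refine ⟨fun i j => linSubst (T.map mk) (map mk (h i j)), T.map mk, T'.map mk, fun i j hij => ?_,
    fun i j hij => ?_, hTT, fun i => ?_⟩
  · exact linSubst_isHomogeneous _ ((hh i j hij).map mk)
  · simp [hh0 i j hij]
  · have h1 := congrArg (linSubst (T.map mk)) (hform i)
    rw [linSubst_linSubst, mul_eq_one_comm.1 hTT, linSubst_one, map_sum] at h1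
    rw [h1]
    simp only [map_mul]

end QuasiRegular

/-! ## Germs of sections and ideal sheaves -/

section Sheaves

variable {M : LocallyRingedSpace.{u}}

theorem germ_res {U V : Opens M} (h : U ≤ V) (x : M) (hx : x ∈ U) (s : Sec M V) :
    germ M U x hx (res M h s) = germ M V x (h hx) s :=
  TopCat.Presheaf.germ_res_apply M.presheaf (homOfLE h) x hx s

theorem res_res {U V W : Opens M} (h : U ≤ V) (h' : V ≤ W) (s : Sec M W) :
    res M h (res M h' s) = res M (h.trans h') s := by
  have := M.presheaf.map_comp (homOfLE h').op (homOfLE h).op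
  exact (congrArg (fun f => f.hom s) this).symm

theorem exists_sec_of_germ (x : M) (t : Stalk M x) :
    ∃ (U : Opens M) (hx : x ∈ U) (s : Sec M U), germ M U x hx s = t :=
  M.presheaf.exists_germ_eq t

theorem exists_res_eq_of_germ_eq {U V : Opens M} {x : M} (hU : x ∈ U) (hV : x ∈ V) {s : Sec M U}
    {t : Sec M V} (h : germ M U x hU s = germ M V x hV t) :
    ∃ (W : Opens M) (_ : x ∈ W) (iU : W ≤ U) (iV : W ≤ V), res M iU s = res M iV t := by
  obtain ⟨W, hW, iU, iV, e⟩ := M.presheaf.germ_eq x hU hV s t h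
  exact ⟨W, hW, leOfHom iU, leOfHom iV, e⟩

theorem exists_secs_of_germs {ι : Type*} [Finite ι] {x : M} {U₀ : Opens M} (hx₀ : x ∈ U₀)
    (t : ι → Stalk M x) :
    ∃ (U : Opens M) (_ : U ≤ U₀) (hx : x ∈ U) (s : ι → Sec M U),
      ∀ i, germ M U x hx (s i) = t i := by
  choose V hV s hs using fun i => exists_sec_of_germ x (t i)
  have hle : ∀ i, (⨅ i, V i) ⊓ U₀ ≤ V i := fun i => inf_le_left.trans (iInf_le V i)
  have hx : x ∈ (⨅ i, V i) ⊓ U₀ := ⟨by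
    rw [Opens.coe_iInf]
    exact Set.mem_iInter.2 hV, hx₀⟩
  exact ⟨_, inf_le_right, hx, fun i => res M (hle i) (s i), fun i => by rw [germ_res, hs]⟩

theorem exists_res_eq_of_germs_eq {ι : Type*} [Finite ι] {x : M} {U : Opens M} (hx : x ∈ U)
    {s t : ι → Sec M U} (h : ∀ i, germ M U x hx (s i) = germ M U x hx (t i)) :
    ∃ (W : Opens M) (_ : x ∈ W) (i : W ≤ U), ∀ j, res M i (s j) = res M i (t j) := by
  choose V hV hVU hVU' hst using fun i => exists_res_eq_of_germ_eq hx hx (h i)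
  have hle : ∀ i, (⨅ i, V i) ⊓ U ≤ V i := fun i => inf_le_left.trans (iInf_le V i)
  refine ⟨(⨅ i, V i) ⊓ U, ⟨by
    rw [Opens.coe_iInf]
    exact Set.mem_iInter.2 hV, hx⟩, inf_le_right, fun j => ?_⟩
  rw [← res_res (hle j) (hVU j), hst j, res_res]

theorem exists_isUnit_germ {U : Opens M} {x : M} (hx : x ∈ U) {s : Sec M U}
    (hs : IsUnit (germ M U x hx s)) :
    ∃ (V : Opens M) (h : V ≤ U), x ∈ V ∧ ∀ (y : M) (hy : y ∈ V), IsUnit (germ M U y (h hy) s) := by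
  obtain ⟨V, i, hV, h⟩ := RingedSpace.isUnit_res_of_isUnit_germ M.toRingedSpace U s x hx hs
  refine ⟨V, leOfHom i, hV, fun y hy => ?_⟩
  rw [← germ_res (leOfHom i) y hy]
  exact IsUnit.map (germ M V y hy) h

theorem IdealSheaf.mem_stalk_iff (J : IdealSheaf M) {x : M} {t : Stalk M x} :
    t ∈ J.stalk x ↔ ∃ (U : Opens M) (hx : x ∈ U) (s : Sec M U), s ∈ J.ideal U ∧
      germ M U x hx s = t := by
  constructor
  · let I : Ideal (Stalk M x) :=
      { carrier := {t | ∃ (U : Opens M) (hx : x ∈ U) (s : Sec M U), s ∈ J.ideal U ∧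
          germ M U x hx s = t}
        zero_mem' := ⟨⊤, trivial, 0, Ideal.zero_mem _, map_zero _⟩
        add_mem' := by
          rintro _ _ ⟨U, hx, s, hs, rfl⟩ ⟨V, hx', t, ht, rfl⟩
          refine ⟨U ⊓ V, Opens.mem_inf.2 ⟨hx, hx'⟩, res M inf_le_left s + res M inf_le_right t,
            Ideal.add_mem _ (J.res_mem _ _ hs) (J.res_mem _ _ ht), ?_⟩
          rw [map_add, germ_res, germ_res]
        smul_mem' := by
          rintro c _ ⟨V, hx', t, ht, rfl⟩
          obtain ⟨U, hx, s, rfl⟩ := exists_sec_of_germ x c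
          refine ⟨U ⊓ V, Opens.mem_inf.2 ⟨hx, hx'⟩, res M inf_le_left s * res M inf_le_right t,
            Ideal.mul_mem_left _ _ (J.res_mem _ _ ht), ?_⟩
          rw [map_mul, germ_res, germ_res, smul_eq_mul] }
    intro ht
    have hle : J.stalk x ≤ I := by
      refine iSup_le fun U => iSup_le fun hx => Ideal.map_le_iff_le_comap.2 fun s hs => ?_
      exact ⟨U, hx, s, hs, rfl⟩
    exact hle ht
  · rintro ⟨U, hx, s, hs, rfl⟩
    exact Ideal.mem_iSup_of_mem U (Ideal.mem_iSup_of_mem hx (Ideal.mem_map_of_mem _ hs))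

theorem IdealSheaf.mem_of_forall_germ_mem (J : IdealSheaf M) {U : Opens M} {s : Sec M U}
    (h : ∀ (x : M) (hx : x ∈ U), germ M U x hx s ∈ J.stalk x) : s ∈ J.ideal U := by
  refine J.of_local U s fun x hx => ?_
  obtain ⟨V, hV, t, ht, hst⟩ := J.mem_stalk_iff.1 (h x hx)
  obtain ⟨W, hW, iU, iV, e⟩ := exists_res_eq_of_germ_eq hx hV hst.symm
  exact ⟨W, iU, hW, by rw [e]; exact J.res_mem iV t ht⟩

theorem IdealSheaf.germ_mem_stalk (J : IdealSheaf M) {U : Opens M} {s : Sec M U}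
    (hs : s ∈ J.ideal U) (x : M) (hx : x ∈ U) : germ M U x hx s ∈ J.stalk x :=
  J.mem_stalk_iff.2 ⟨U, hx, s, hs, rfl⟩

theorem mem_vanishing_iff {Z : Set M} {U : Opens M} {s : Sec M U} :
    s ∈ (vanishing M Z).ideal U ↔ ∀ (x : M) (hx : x ∈ U), x ∈ Z →
      germ M U x hx s ∈ IsLocalRing.maximalIdeal (Stalk M x) := by
  simp only [vanishing, Ideal.mem_iInf, Ideal.mem_comap]

theorem germ_mem_idealAt_iff {Z : Set M} {U : Opens M} {s : Sec M U} {x : M} {hx : x ∈ U} :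
    germ M U x hx s ∈ idealAt M Z x ↔ ∃ (V : Opens M) (h : V ≤ U), x ∈ V ∧
      ∀ (y : M) (hy : y ∈ V), y ∈ Z →
        germ M U y (h hy) s ∈ IsLocalRing.maximalIdeal (Stalk M y) := by
  constructor
  · intro h
    obtain ⟨V, hV, t, ht, hst⟩ := (IdealSheaf.mem_stalk_iff _).1 h
    obtain ⟨W, hW, iU, iV, e⟩ := exists_res_eq_of_germ_eq hx hV hst.symm
    refine ⟨W, iU, hW, fun y hy hyZ => ?_⟩
    rw [← germ_res iU y hy, e, germ_res]
    exact mem_vanishing_iff.1 ht y (iV hy) hyZ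
  · rintro ⟨V, h, hV, H⟩
    refine (IdealSheaf.mem_stalk_iff _).2 ⟨V, hV, res M h s, mem_vanishing_iff.2 fun y hy hyZ => ?_,
      germ_res h x hV s⟩
    rw [germ_res]
    exact H y hy hyZ

theorem idealAt_le_maximalIdeal {Z : Set M} {x : M} (hx : x ∈ Z) :
    idealAt M Z x ≤ IsLocalRing.maximalIdeal (Stalk M x) := by
  intro t ht
  obtain ⟨U, hU, s, rfl⟩ := exists_sec_of_germ x t
  obtain ⟨V, h, hV, H⟩ := germ_mem_idealAt_iff.1 ht
  exact H x hV hx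

theorem idealAt_anti {Z X : Set M} (h : Z ⊆ X) (x : M) : idealAt M X x ≤ idealAt M Z x := by
  intro t ht
  obtain ⟨U, hU, s, rfl⟩ := exists_sec_of_germ x t
  obtain ⟨V, hVU, hV, H⟩ := germ_mem_idealAt_iff.1 ht
  exact germ_mem_idealAt_iff.2 ⟨V, hVU, hV, fun y hy hyZ => H y hy (h hyZ)⟩

theorem idealAt_eq_top {Z : Set M} (hZ : IsClosed Z) {x : M} (hx : x ∉ Z) :
    idealAt M Z x = ⊤ := by
  rw [Ideal.eq_top_iff_one]
  refine (IdealSheaf.mem_stalk_iff _).2 ⟨⟨Zᶜ, hZ.isOpen_compl⟩, hx, 1,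
    mem_vanishing_iff.2 fun y hy hyZ => absurd hyZ hy, map_one _⟩

/-- A function that is a unit at one point is a unit nearby, so it cannot vanish on a dense part of
`Z` without vanishing on `Z`. -/
theorem mem_vanishing_of_dense {Z : Set M} {U W : Opens M}
    (hW : (U : Set M) ∩ Z ⊆ closure ((W : Set M) ∩ Z)) {s : Sec M U}
    (h : ∀ (x : M) (hx : x ∈ U), x ∈ W → x ∈ Z →
      germ M U x hx s ∈ IsLocalRing.maximalIdeal (Stalk M x)) :
    s ∈ (vanishing M Z).ideal U := by
  refine mem_vanishing_iff.2 fun x hx hxZ => ?_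
  by_contra hns
  rw [IsLocalRing.mem_maximalIdeal, mem_nonunits_iff, not_not] at hns
  obtain ⟨V, hVU, hV, H⟩ := exists_isUnit_germ hx hns
  obtain ⟨y, hyV, hyW, hyZ⟩ := mem_closure_iff.1 (hW ⟨hx, hxZ⟩) V V.isOpen hV
  exact (IsLocalRing.mem_maximalIdeal _).1 (h y (hVU hyV) hyW hyZ) (H y hyV)

end Sheaves

/-! ## Expansions at a point -/

section Expansions

open MvPolynomial

variable {M : LocallyRingedSpace.{u}} {X Z : Set M} {k r : ℕ} {U : Opens M}

/-- The germs of the coefficients of an expansion. -/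
def Expansion.germA (E : Expansion M X Z k r U) (x : M) (hx : x ∈ U) : CoeffIdx k E.p → Stalk M x :=
  germ M U x hx ∘ E.a

/-- The germs of the generators of the ideal of `Z`. -/
def Expansion.germG (E : Expansion M X Z k r U) (x : M) (hx : x ∈ U) : Fin k → Stalk M x :=
  germ M U x hx ∘ E.g

/-- The classes in the local ring of `Z` of the coefficients of an expansion. -/
def Expansion.subA (E : Expansion M X Z k r U) (x : M) (hx : x ∈ U) :
    CoeffIdx k E.p → SubStalk M Z x :=
  Ideal.Quotient.mk (idealAt M Z x) ∘ E.germA x hx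

theorem Expansion.germ_f (E : Expansion M X Z k r U) (x : M) (hx : x ∈ U) (i : Fin r) :
    germ M U x hx (E.f i) = eval (E.germG x hx) (form (E.germA x hx) i) := by
  rw [E.expand, map_eval, map_form]
  rfl

theorem Expansion.span_germG (E : Expansion M X Z k r U) {x : M} (hx : x ∈ U) (hxZ : x ∈ Z) :
    Ideal.span (Set.range (E.germG x hx)) = idealAt M Z x :=
  E.span_g x hx hxZ

/-- Any `k` generators qualify, not only those forming the given regular sequence; this freedom is
why quasi-regularity is used. -/
theorem isQuasiRegular_of_isLCI (hZ : IsLCI M Z k) {x : M} (hxZ : x ∈ Z) {g : Fin k → Stalk M x}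
    (hg : Ideal.span (Set.range g) = idealAt M Z x) : IsQuasiRegular g := by
  obtain ⟨V, f, hV, hf⟩ := hZ x hxZ
  obtain ⟨h1, h2⟩ := hf x hV
  exact (isQuasiRegular_of_isRegular (h2 hxZ)).of_span_eq (h1.trans hg.symm)

theorem Expansion.germ_f_mem (E : Expansion M X Z k r U) {x : M} (hx : x ∈ U) (hxZ : x ∈ Z)
    (i : Fin r) : germ M U x hx (E.f i) ∈ idealAt M X x := by
  rw [← E.good.span_eq x hx hxZ]
  exact Ideal.subset_span ⟨i, rfl⟩

theorem exists_transform_of_expansions (hZ : IsLCI M Z k) {U' : Opens M}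
    (E : Expansion M X Z k r U) (E' : Expansion M X Z k r U') {x : M} (hx : x ∈ U) (hx' : x ∈ U')
    (hxZ : x ∈ Z) :
    ∃ (H : Fin r → Fin r → MvPolynomial (Fin k) (SubStalk M Z x))
      (S T : Matrix (Fin k) (Fin k) (SubStalk M Z x)),
      (∀ i j, E.p j ≤ E'.p i → (H i j).IsHomogeneous (E'.p i - E.p j)) ∧
      (∀ i j, E'.p i < E.p j → H i j = 0) ∧ S * T = 1 ∧
      ∀ i, form (E'.subA x hx') i = ∑ j, H i j * linSubst S (form (E.subA x hx) j) := by
  refine (isQuasiRegular_of_isLCI hZ hxZ (E.span_germG hx hxZ)).exists_transform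
    (J := idealAt M X x) (E.span_germG hx hxZ) (E'.span_germG hx' hxZ) (fun i => ?_) fun n => ?_
  · rw [← E'.germ_f]
    exact E'.germ_f_mem hx' hxZ i
  · have := E.good.leading x hx hxZ n
    simpa only [E.germ_f] using this

/-- The evaluation of functions on `Z` at a point, with values in an algebraic closure of the
residue field. -/
def subValue {x : M} (hxZ : x ∈ Z) :
    SubStalk M Z x →+* AlgebraicClosure (IsLocalRing.ResidueField (Stalk M x)) :=
  Ideal.Quotient.lift (idealAt M Z x)
    ((algebraMap _ _).comp (IsLocalRing.residue (Stalk M x))) fun a ha => by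
      rw [RingHom.comp_apply,
        (IsLocalRing.residue_eq_zero_iff a).2 (idealAt_le_maximalIdeal hxZ ha), map_zero]

theorem subValue_comp_subA (E : Expansion M X Z k r U) {x : M} (hx : x ∈ U) (hxZ : x ∈ Z) :
    subValue hxZ ∘ E.subA x hx = E.valueAt x hx := rfl

/-- Ordinariness is defined through one expansion but holds for all: the transformation from `E` to
the witness `E'`, reduced to the residue field, would carry a discriminant tuple of `E` to one of
`E'`. -/
theorem Expansion.valueAt_notMem (hZ : IsLCI M Z k) {x : M} (hxZ : x ∈ Z)
    (ho : IsOrdinaryAt M X Z k r x) (E : Expansion M X Z k r U) (hx : x ∈ U) :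
    E.valueAt x hx ∉
      discrLocus (AlgebraicClosure (IsLocalRing.ResidueField (Stalk M x))) k E.p := by
  obtain ⟨-, U', hx', E', hE'⟩ := ho
  intro hE
  refine hE' ?_
  obtain ⟨H, S, T, -, -, hST, hform⟩ := exists_transform_of_expansions hZ E E' hx hx' hxZ
  refine mem_discrLocus_of_transform (a := E.valueAt x hx)
    (H := fun i j => map (subValue hxZ) (H i j)) (S := S.map (subValue hxZ))
    (T := T.map (subValue hxZ)) ?_ (fun i => ?_) hE
  · rw [← Matrix.map_mul, hST]
    exact Matrix.map_one _ (map_zero _) (map_one _)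
  · have h1 := congrArg (map (subValue hxZ)) (hform i)
    rw [map_form, subValue_comp_subA, map_sum] at h1
    rw [h1]
    simp only [map_mul, map_linSubst, map_form, subValue_comp_subA]

theorem IsSetup.subset (hS : IsSetup M X Z k r) : Z ⊆ singularLocus M X := by
  obtain ⟨x, hx, rfl⟩ := hS.component
  exact connectedComponentIn_subset _ _

theorem IsSetup.exists_ordinary (hS : IsSetup M X Z k r) {V : Opens M}
    (hV : ((V : Set M) ∩ Z).Nonempty) :
    ∃ W : Opens M, W ≤ V ∧ ((W : Set M) ∩ Z).Nonempty ∧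
      ∀ x ∈ W, x ∈ Z → IsOrdinaryAt M X Z k r x := by
  obtain ⟨W, hW, ho⟩ := hS.ordinary
  obtain ⟨x, hxV, hxZ⟩ := hV
  obtain ⟨y, hyV, hyW, hyZ⟩ := mem_closure_iff.1 (hW hxZ) V V.isOpen hxV
  exact ⟨V ⊓ W, inf_le_left, ⟨y, ⟨hyV, hyW⟩, hyZ⟩, fun x hx hxZ => ho x hx.2 hxZ⟩

theorem IsSetup.lt (hS : IsSetup M X Z k r) (hZ : Z.Nonempty) : r < k := by
  obtain ⟨x, hx⟩ := hZ
  obtain ⟨W, -, ⟨y, hyW, hyZ⟩, ho⟩ := hS.exists_ordinary (V := ⊤) ⟨x, trivial, hx⟩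
  exact (ho y hyW hyZ).1

/-- Multiplicity zero would mean that a good generator lies outside the ideal of `Z` at some point,
although the ideal of `X` is contained in it. -/
theorem IsSetup.one_le (hS : IsSetup M X Z k r) (E : Expansion M X Z k r U)
    (hU : ((U : Set M) ∩ Z).Nonempty) (i : Fin r) : 1 ≤ E.p i := by
  obtain ⟨W, hW, hmult⟩ := E.good.mult
  obtain ⟨x, hx, hxZ⟩ := hU
  obtain ⟨y, hyU, hyW, hyZ⟩ := mem_closure_iff.1 (hW ⟨hx, hxZ⟩) U U.isOpen hx
  have h1 := (hmult y hyU hyW hyZ i).2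
  by_contra h0
  have h2 : E.p i = 0 := by omega
  rw [h2, zero_add, pow_one] at h1
  exact h1 (idealAt_anti (fun z hz => (hS.subset hz).1) y (E.germ_f_mem hyU hyZ i))

/-- Generic smoothness of reduced locally complete intersections: at suitable points of any
nonempty open part, generators of the ideal are part of a system of local coordinates. -/
def HasGenericSmoothness (M : LocallyRingedSpace.{u}) : Prop :=
  ∀ (Z : Set M) (k : ℕ), IsClosed Z → IsLCI M Z k → ∀ V : Opens M, ((V : Set M) ∩ Z).Nonempty →
    ∃ x ∈ V, x ∈ Z ∧ ∀ g : Fin k → Stalk M x, Ideal.span (Set.range g) = idealAt M Z x →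
      ∀ c : Fin k → Stalk M x, ∑ j, c j * g j ∈ IsLocalRing.maximalIdeal (Stalk M x) ^ 2 →
        ∀ j, c j ∈ IsLocalRing.maximalIdeal (Stalk M x)

theorem exists_pderiv_form_eq_C {A : Type*} [CommRing A] {p : Fin r → ℕ} (hp : ∀ i, p i = 1)
    (a : CoeffIdx k p → A) (i : Fin r) (j : Fin k) : ∃ b : A, pderiv j (form a i) = C b := by
  have h1 : (pderiv j (form a i)).IsHomogeneous 0 := by
    have := (form_isHomogeneous a i).pderiv (i := j)
    rwa [hp i] at this
  rw [← totalDegree_zero_iff_isHomogeneous, totalDegree_eq_zero_iff_eq_C] at h1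
  exact ⟨_, h1⟩

theorem eval_form_of_linear {A : Type*} [CommRing A] {p : Fin r → ℕ} (hp : ∀ i, p i = 1)
    {a : CoeffIdx k p → A} {B : Fin r → Fin k → A} (hB : ∀ i j, pderiv j (form a i) = C (B i j))
    (y : Fin k → A) (i : Fin r) : eval y (form a i) = ∑ j, B i j * y j := by
  have h1 := sum_mul_eval_pderiv (form_isHomogeneous a i) y
  rw [hp i, Nat.cast_one, one_mul] at h1
  rw [← h1]
  exact Finset.sum_congr rfl fun j _ => by rw [hB, eval_C, mul_comm]

theorem exists_ne_zero_of_linear {L : Type*} [Field L] {p : Fin r → ℕ} (hrk : r < k)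
    (hp : ∀ i, p i = 1) (a : CoeffIdx k p → L) :
    ∃ y : Fin k → L, y ≠ 0 ∧ ∀ i, eval y (form a i) = 0 := by
  choose B hB using exists_pderiv_form_eq_C hp a
  have h1 : LinearMap.ker (Matrix.mulVecLin (Matrix.of B)) ≠ ⊥ := by
    apply LinearMap.ker_ne_bot_of_finrank_lt
    simpa using hrk
  obtain ⟨y, hy, hy0⟩ := (Submodule.ne_bot_iff _).1 h1
  refine ⟨y, hy0, fun i => ?_⟩
  rw [eval_form_of_linear hp hB]
  exact congrFun (LinearMap.mem_ker.1 hy) i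

/-- If all multiplicities were 1, the good generators would be linear combinations of the `g j` with
a coefficient matrix of full rank at an ordinary point. Where the `g j` are independent modulo `𝔪²`,
so are then the good generators, making `X` smooth at a point of `Z`. -/
theorem IsSetup.exists_two_le (hS : IsSetup M X Z k r) (hM : HasGenericSmoothness M)
    (E : Expansion M X Z k r U) (hU : ((U : Set M) ∩ Z).Nonempty) : ∃ i, 2 ≤ E.p i := by
  by_contra! hcon
  have hp : ∀ i, E.p i = 1 := fun i => by
    have := hS.one_le E hU i
    have := hcon i
    omega
  obtain ⟨W, hWU, hWZ, ho⟩ := hS.exists_ordinary hU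
  obtain ⟨x, hxW, hxZ, hg⟩ := hM Z k hS.closed_Z hS.lci_Z W hWZ
  have hx : x ∈ U := hWU hxW
  have hord := E.valueAt_notMem hS.lci_Z hxZ (ho x hxW hxZ) hx
  set m := IsLocalRing.maximalIdeal (Stalk M x)
  -- Lying outside Δ constrains the Jacobian only at a common zero; one exists since there are fewer
  -- linear forms than variables.
  obtain ⟨y, hy, hy0⟩ := exists_ne_zero_of_linear (ho x hxW hxZ).1 hp (E.valueAt x hx)
  have hrow : ∀ l : Fin r → AlgebraicClosure (IsLocalRing.ResidueField (Stalk M x)),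
      (∀ j, ∑ i, l i * eval y (pderiv j (form (E.valueAt x hx) i)) = 0) → l = 0 := by
    intro l hl
    by_contra hl0
    exact hord (mem_discrLocus_iff.2 ⟨y, hy, l, hl0, hy0, hl⟩)
  choose B hB using exists_pderiv_form_eq_C hp (E.germA x hx)
  have hf : ∀ i, germ M U x hx (E.f i) = ∑ j, B i j * E.germG x hx j := by
    intro i
    rw [E.germ_f, eval_form_of_linear hp hB]
  have hBval : ∀ i j, eval y (pderiv j (form (E.valueAt x hx) i)) =
      algebraMap _ _ (IsLocalRing.residue (Stalk M x) (B i j)) := by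
    intro i j
    have h1 : form (E.valueAt x hx) i = map ((algebraMap _ _).comp
        (IsLocalRing.residue (Stalk M x))) (form (E.germA x hx) i) := by
      rw [map_form]; rfl
    rw [h1, pderiv_map, hB, map_C, eval_C]
    rfl
  have hfm : ∀ i, germ M U x hx (E.f i) ∈ m := fun i =>
    idealAt_le_maximalIdeal (hS.subset hxZ).1 (E.germ_f_mem hx hxZ i)
  refine (hS.subset hxZ).2 ⟨r, fun i => ⟨_, hfm i⟩, E.good.span_eq x hx hxZ, ?_⟩
  rw [Fintype.linearIndependent_iff]
  intro c hc
  choose d hd using fun i => IsLocalRing.residue_surjective (R := Stalk M x) (c i)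
  have h2 : ∑ i, d i * germ M U x hx (E.f i) ∈ m ^ 2 := by
    have h3 : m.toCotangent (∑ i, d i • ⟨_, hfm i⟩) = 0 := by
      rw [map_sum, ← hc]
      refine Finset.sum_congr rfl fun i _ => ?_
      rw [map_smul, ← hd]
      rfl
    rw [Ideal.toCotangent_eq_zero] at h3
    simpa using h3
  have h4 : ∀ j, ∑ i, d i * B i j ∈ m := by
    refine hg (E.germG x hx) (E.span_germG hx hxZ) _ ?_
    convert h2 using 1
    simp only [hf, Finset.mul_sum, Finset.sum_mul]
    rw [Finset.sum_comm]
    simp only [mul_assoc]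
  have h5 := hrow (fun i => algebraMap _ _ (c i)) fun j => by
    have h6 := (IsLocalRing.residue_eq_zero_iff _).2 (h4 j)
    rw [map_sum] at h6
    have h7 := congrArg (algebraMap _ (AlgebraicClosure (IsLocalRing.ResidueField (Stalk M x)))) h6
    rw [map_zero, map_sum] at h7
    rw [← h7]
    exact Finset.sum_congr rfl fun i _ => by rw [hBval, map_mul, map_mul, hd]
  intro i
  have h8 := congrFun h5 i
  exact (map_eq_zero _).1 h8

end Expansions

/-! ## The local equations of the discriminant -/

section LocalEquation

open MvPolynomial

/-- Divide by the value of `D`: over the quotient the whole ideal of Δ vanishes at `a`, hence so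
does the value of `D'` at the transformed tuple. -/
theorem eval₂_mem_span_of_transform {k r : ℕ} {p p' : Fin r → ℕ} {K : Type v} [Field K] [Infinite K]
    {A : Type*} [CommRing A] (γ : K →+* A) (hp : ∀ i, 1 ≤ p i) (hp' : ∀ i, 1 ≤ p' i) (i₀ : Fin r)
    (j₀ : Fin k) {a : CoeffIdx k p → A} {a' : CoeffIdx k p' → A}
    {H : Fin r → Fin r → MvPolynomial (Fin k) A}
    (hH : ∀ i j, p j ≤ p' i → (H i j).IsHomogeneous (p' i - p j))
    (hH0 : ∀ i j, p' i < p j → H i j = 0) (S : Matrix (Fin k) (Fin k) A)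
    (h : ∀ i, form a' i = ∑ j, H i j * linSubst S (form a j))
    {D : MvPolynomial (CoeffIdx k p) K} {D' : MvPolynomial (CoeffIdx k p') K}
    (hD : IsClassicalDiscriminant K k p D) (hD' : IsClassicalDiscriminant K k p' D') :
    eval₂ γ a' D' ∈ Ideal.span {eval₂ γ a D} := by
  let mk := Ideal.Quotient.mk (Ideal.span {eval₂ γ a D})
  let _ : Algebra K (A ⧸ Ideal.span {eval₂ γ a D}) := (mk.comp γ).toAlgebra
  have hmk : ∀ {q : Fin r → ℕ} (b : CoeffIdx k q → A) (f : MvPolynomial (CoeffIdx k q) K),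
      aeval (mk ∘ b) f = mk (eval₂ γ b f) := by
    intro q b f
    rw [hom_eval₂]
    rfl
  have key := aeval_eq_zero_of_transform (K := K) hp hp' i₀ j₀ (a := mk ∘ a) (a' := mk ∘ a')
    (H := fun i j => map mk (H i j)) (fun i j hij => (hH i j hij).map mk)
    (fun i j hij => by rw [hH0 i j hij, map_zero]) (S.map mk) (fun i => by
      have h1 := congrArg (map mk) (h i)
      rw [map_form, map_sum] at h1
      rw [h1]
      simp only [map_mul, map_linSubst, map_form]) (fun f hf => by
      rw [← hD, Ideal.mem_span_singleton] at hf
      obtain ⟨e, rfl⟩ := hf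
      rw [map_mul, hmk, Ideal.Quotient.eq_zero_iff_mem.2 (Ideal.mem_span_singleton_self _),
        zero_mul]) D' (by rw [← hD']; exact Ideal.mem_span_singleton_self _)
  rw [hmk] at key
  exact Ideal.Quotient.eq_zero_iff_mem.1 key

theorem eval₂_ne_zero_of_notMem_discrLocus {k r : ℕ} {p : Fin r → ℕ} {K : Type v} [Field K]
    [Infinite K] {L : Type*} [Field L] [IsAlgClosed L] (γ : K →+* L) (hp : ∀ i, 1 ≤ p i)
    (i₀ : Fin r) (j₀ : Fin k) {a : CoeffIdx k p → L} (ha : a ∉ discrLocus L k p)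
    {D : MvPolynomial (CoeffIdx k p) K} (hD : IsClassicalDiscriminant K k p D) :
    eval₂ γ a D ≠ 0 := by
  let _ : Algebra K L := γ.toAlgebra
  intro h0
  refine ha (mem_discrLocus_of_forall_aeval_eq_zero (K := K) hp i₀ j₀ fun f hf => ?_)
  rw [← hD, Ideal.mem_span_singleton] at hf
  obtain ⟨e, rfl⟩ := hf
  rw [map_mul]
  have : aeval a D = 0 := h0
  rw [this, zero_mul]

variable {M : LocallyRingedSpace.{u}} {X Z : Set M} {k r : ℕ} {U : Opens M} {K : Type v} [Field K]

/-- The constants in the local ring of `Z` at `x`. -/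
def subConst (c : K →+* Sec M ⊤) (Z : Set M) (x : M) : K →+* SubStalk M Z x :=
  (germOn M Z ⊤ x trivial).comp c

theorem germOn_localEquation (E : Expansion M X Z k r U) (c : K →+* Sec M ⊤)
    (D : MvPolynomial (CoeffIdx k E.p) K) (x : M) (hx : x ∈ U) :
    germOn M Z U x hx (E.localEquation c D) = eval₂ (subConst c Z x) (E.subA x hx) D := by
  rw [Expansion.localEquation, hom_eval₂]
  congr 1
  ext t
  simp only [RingHom.comp_apply, subConst, const, germ_res]

theorem localEquation_mem_localIdeal [Infinite K] (hS : IsSetup M X Z k r) (hr : 0 < r)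
    {U' : Opens M} (E : Expansion M X Z k r U) (E' : Expansion M X Z k r U') (c : K →+* Sec M ⊤)
    {D : MvPolynomial (CoeffIdx k E.p) K} {D' : MvPolynomial (CoeffIdx k E'.p) K}
    (hD : IsClassicalDiscriminant K k E.p D) (hD' : IsClassicalDiscriminant K k E'.p D')
    {x : M} (hx : x ∈ U) (hx' : x ∈ U') (hxZ : x ∈ Z) :
    germOn M Z U' x hx' (E'.localEquation c D') ∈ E.localIdeal c D x hx := by
  obtain ⟨H, S, T, hH, hH0, -, hform⟩ := exists_transform_of_expansions hS.lci_Z E E' hx hx' hxZ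
  rw [Expansion.localIdeal, germOn_localEquation, germOn_localEquation]
  exact eval₂_mem_span_of_transform _ (hS.one_le E ⟨x, hx, hxZ⟩) (hS.one_le E' ⟨x, hx', hxZ⟩)
    ⟨0, hr⟩ ⟨0, hr.trans (hS.lt ⟨x, hxZ⟩)⟩ hH hH0 S hform hD hD'

theorem localIdeal_eq [Infinite K] (hS : IsSetup M X Z k r) (hr : 0 < r)
    {U' : Opens M} (E : Expansion M X Z k r U) (E' : Expansion M X Z k r U') (c : K →+* Sec M ⊤)
    {D : MvPolynomial (CoeffIdx k E.p) K} {D' : MvPolynomial (CoeffIdx k E'.p) K}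
    (hD : IsClassicalDiscriminant K k E.p D) (hD' : IsClassicalDiscriminant K k E'.p D')
    {x : M} (hx : x ∈ U) (hx' : x ∈ U') (hxZ : x ∈ Z) :
    E.localIdeal c D x hx = E'.localIdeal c D' x hx' :=
  le_antisymm
    ((Ideal.span_singleton_le_iff_mem _).2
      (localEquation_mem_localIdeal hS hr E' E c hD' hD hx' hx hxZ))
    ((Ideal.span_singleton_le_iff_mem _).2
      (localEquation_mem_localIdeal hS hr E E' c hD hD' hx hx' hxZ))

theorem isUnit_germ_localEquation [Infinite K] (hS : IsSetup M X Z k r) (hr : 0 < r)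
    (E : Expansion M X Z k r U) (c : K →+* Sec M ⊤) {D : MvPolynomial (CoeffIdx k E.p) K}
    (hD : IsClassicalDiscriminant K k E.p D) {x : M} (hx : x ∈ U) (hxZ : x ∈ Z)
    (ho : IsOrdinaryAt M X Z k r x) : IsUnit (germ M U x hx (E.localEquation c D)) := by
  by_contra hn
  have h1 := (IsLocalRing.residue_eq_zero_iff _).2 ((IsLocalRing.mem_maximalIdeal _).2 hn)
  refine eval₂_ne_zero_of_notMem_discrLocus ((subValue hxZ).comp (subConst c Z x))
    (hS.one_le E ⟨x, hx, hxZ⟩) ⟨0, hr⟩ ⟨0, hr.trans (hS.lt ⟨x, hxZ⟩)⟩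
    (E.valueAt_notMem hS.lci_Z hxZ ho hx) hD ?_
  rw [← subValue_comp_subA E hx hxZ]
  have h2 : subValue hxZ (eval₂ (subConst c Z x) (E.subA x hx) D) = 0 := by
    rw [← germOn_localEquation]
    change algebraMap _ _ (IsLocalRing.residue (Stalk M x) _) = _
    rw [h1, map_zero]
  rwa [hom_eval₂] at h2

/-- If a product with the local equation vanishes on `Z` near `x`, the other factor vanishes at the
nearby ordinary points of `Z`, where the equation is a unit. These are dense, and a function
vanishing there is zero on the reduced `Z`. -/
theorem localEquation_mem_nonZeroDivisors [Infinite K] (hS : IsSetup M X Z k r) (hr : 0 < r)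
    (E : Expansion M X Z k r U) (c : K →+* Sec M ⊤) {D : MvPolynomial (CoeffIdx k E.p) K}
    (hD : IsClassicalDiscriminant K k E.p D) {x : M} (hx : x ∈ U) :
    germOn M Z U x hx (E.localEquation c D) ∈ nonZeroDivisors (SubStalk M Z x) := by
  rw [mem_nonZeroDivisors_iff_right]
  intro t ht
  obtain ⟨t, rfl⟩ := Ideal.Quotient.mk_surjective t
  obtain ⟨V₀, hV₀, s₀, rfl⟩ := exists_sec_of_germ x t
  set V := V₀ ⊓ U
  have hV : x ∈ V := Opens.mem_inf.2 ⟨hV₀, hx⟩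
  set s : Sec M V := res M inf_le_left s₀
  have hs : germ M V₀ x hV₀ s₀ = germ M V x hV s := by rw [germ_res]
  have he : germ M U x hx (E.localEquation c D) =
      germ M V x hV (res M inf_le_right (E.localEquation c D)) := by rw [germ_res]
  rw [RingHom.comp_apply, ← map_mul, Ideal.Quotient.eq_zero_iff_mem, hs, he, ← map_mul,
    germ_mem_idealAt_iff] at ht
  obtain ⟨V', hV'V, hV', H⟩ := ht
  rw [hs, Ideal.Quotient.eq_zero_iff_mem, ← germ_res hV'V x hV']
  refine IdealSheaf.germ_mem_stalk _ ?_ x hV'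
  obtain ⟨W, hW, ho⟩ := hS.ordinary
  refine mem_vanishing_of_dense (W := W) (Set.inter_subset_right.trans hW) fun y hy hyW hyZ => ?_
  have h1 := H y hy hyZ
  rw [map_mul, germ_res (inf_le_right : V ≤ U)] at h1
  rw [germ_res hV'V]
  refine ((IsLocalRing.maximalIdeal.isMaximal _).isPrime.mem_or_mem h1).resolve_right fun h2 => ?_
  exact (IsLocalRing.mem_maximalIdeal _).1 h2
    (isUnit_germ_localEquation hS hr E c hD (hV'V hy).2 hyZ (ho y hyW hyZ))

end LocalEquation

/-! ### Existence of expansions near every point of `Z` -/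

section Existence

open MvPolynomial

variable {M : LocallyRingedSpace.{u}} {X Z : Set M} {k r : ℕ}

theorem IsGoodBasis.restrict {U V : Opens M} (h : V ≤ U) {p : Fin r → ℕ} {f : Fin r → Sec M U}
    (hf : IsGoodBasis M X Z U p f) : IsGoodBasis M X Z V p fun i => res M h (f i) where
  span_eq x hx hxZ := by
    simp only [germ_res]
    exact hf.span_eq x (h hx) hxZ
  mult := by
    obtain ⟨W, hW, H⟩ := hf.mult
    refine ⟨W, (Set.inter_subset_inter_left _ h).trans hW, fun x hx hxW hxZ i => ?_⟩
    simp only [germ_res]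
    exact H x (h hx) hxW hxZ i
  leading x hx hxZ n := by
    simp only [germ_res]
    exact hf.leading x (h hx) hxZ n

/-- The multiplicity of a good generator is prescribed only on a dense part of `Z`, while an
expansion needs it at every point. Raise the order one step at a time: write `f` as a form of degree
`m` in generators of the ideal of `Z`. At the dense points quasi-regularity puts its coefficients
into the ideal of `Z`; so they vanish on all of `Z` near `x`, and the order is at least `m + 1`. -/
theorem germ_mem_pow_of_dense (hZ : IsLCI M Z k) {U W : Opens M}
    (hW : (U : Set M) ∩ Z ⊆ closure ((W : Set M) ∩ Z)) {f : Sec M U} {n : ℕ}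
    (hf : ∀ (x : M) (hx : x ∈ U), x ∈ W → x ∈ Z → germ M U x hx f ∈ idealAt M Z x ^ n)
    {x : M} (hx : x ∈ U) (hxZ : x ∈ Z) : germ M U x hx f ∈ idealAt M Z x ^ n := by
  obtain ⟨V₀, g₀, hV₀, hg₀⟩ := hZ x hxZ
  suffices H : ∀ m ≤ n, germ M U x hx f ∈ idealAt M Z x ^ m from H n le_rfl
  intro m
  induction m with
  | zero => simp
  | succ m ih =>
    intro hmn
    have h1 := ih (by omega)
    rw [← (hg₀ x hV₀).1] at h1
    obtain ⟨F, hF, hFf⟩ := (Ideal.mem_span_pow_iff_exists_isHomogeneous _ _).1 h1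
    -- A single form is treated as a tuple of length one, so that the coefficient formalism applies.
    let p : Fin 1 → ℕ := fun _ => m
    obtain ⟨V₁, hV₁, hxV₁, a₀, ha₀⟩ := exists_secs_of_germs (U₀ := V₀ ⊓ U)
      (Opens.mem_inf.2 ⟨hV₀, hx⟩) (coeffTuple p fun _ => F)
    let g₁ : Fin k → Sec M V₁ := fun j => res M (hV₁.trans inf_le_left) (g₀ j)
    have hgerm : ∀ (y : M) (hy : y ∈ V₁), germ M V₁ y hy (eval g₁ (form a₀ 0)) =
        eval (fun j => germ M V₀ y (hV₁ hy).1 (g₀ j)) (form (germ M V₁ y hy ∘ a₀) 0) := by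
      intro y hy
      rw [map_eval, map_form]
      congr 2
      funext j
      exact germ_res _ _ _ _
    have h2 : germ M V₁ x hxV₁ (res M (hV₁.trans inf_le_right) f) =
        germ M V₁ x hxV₁ (eval g₁ (form a₀ 0)) := by
      rw [germ_res, ← hFf, hgerm]
      congr 1
      have : germ M V₁ x hxV₁ ∘ a₀ = coeffTuple p fun _ => F := funext ha₀
      rw [this]
      exact (form_coeffTuple (p := p) (F := fun _ => F) (i := 0) hF).symm
    obtain ⟨V, hxV, i₁, i₂, hV⟩ := exists_res_eq_of_germ_eq hxV₁ hxV₁ h2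
    have hVU : V ≤ U := i₁.trans (hV₁.trans inf_le_right)
    have hcoef : ∀ c, res M i₂ (a₀ c) ∈ (vanishing M Z).ideal V := by
      intro c
      refine mem_vanishing_of_dense (W := W)
        ((Set.inter_subset_inter_left _ hVU).trans hW) fun y hy hyW hyZ => ?_
      have h3 : germ M U y (hVU hy) f ∈ idealAt M Z y ^ (m + 1) :=
        Ideal.pow_le_pow_right hmn (hf y (hVU hy) hyW hyZ)
      have h4 := congrArg (germ M V y hy) hV
      rw [germ_res, germ_res, germ_res, hgerm y (i₂ hy)] at h4
      rw [h4, ← (hg₀ y (hV₁ (i₂ hy)).1).1] at h3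
      have h5 := isQuasiRegular_of_isLCI hZ hyZ (hg₀ y (hV₁ (i₂ hy)).1).1 m _
        (form_isHomogeneous (p := p) _ 0) h3
      rw [(hg₀ y (hV₁ (i₂ hy)).1).1] at h5
      have h6 := mem_map_C_iff.1 h5 (Finsupp.equivFunOnFinite.symm c.2.1)
      have h7 := congrFun (coeffTuple_form (p := p) (germ M V₁ y (i₂ hy) ∘ a₀)) c
      rw [coeffTuple, Subsingleton.elim c.1 0] at h7
      rw [germ_res]
      rw [h7] at h6
      exact idealAt_le_maximalIdeal hyZ h6
    rw [← hFf, pow_succ', ← (hg₀ x hV₀).1]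
    refine eval_mem_mul_pow hF ?_
    have h8 : F = form (coeffTuple p fun _ => F) 0 :=
      (form_coeffTuple (p := p) (F := fun _ => F) (i := 0) hF).symm
    rw [h8, form]
    refine Ideal.sum_mem _ fun c _ => Ideal.mul_mem_right _ _ (Ideal.mem_map_of_mem C ?_)
    rw [← ha₀, (hg₀ x hV₀).1, ← germ_res i₂ x hxV]
    exact IdealSheaf.germ_mem_stalk _ (hcoef _) x hxV

theorem IsSetup.exists_expansion (hS : IsSetup M X Z k r) {z : M} (hz : z ∈ Z) :
    ∃ U : Opens M, z ∈ U ∧ Nonempty (Expansion M X Z k r U) := by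
  obtain ⟨p, hp⟩ := hS.strict
  obtain ⟨U₁, f, hzU₁, hf⟩ := hp z hz
  obtain ⟨U₂, g, hzU₂, hg⟩ := hS.lci_Z z hz
  obtain ⟨W, hW, hmult⟩ := hf.mult
  have h1 : ∀ i, ∃ F : MvPolynomial (Fin k) (Stalk M z), F.IsHomogeneous (p i) ∧
      eval (fun j => germ M U₂ z hzU₂ (g j)) F = germ M U₁ z hzU₁ (f i) := by
    intro i
    have := germ_mem_pow_of_dense hS.lci_Z hW
      (fun x hx hxW hxZ => (hmult x hx hxW hxZ i).1) hzU₁ hz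
    rw [← (hg z hzU₂).1] at this
    exact (Ideal.mem_span_pow_iff_exists_isHomogeneous _ _).1 this
  choose F hF hFf using h1
  obtain ⟨V₁, hV₁, hzV₁, a, ha⟩ := exists_secs_of_germs (U₀ := U₁ ⊓ U₂)
    (Opens.mem_inf.2 ⟨hzU₁, hzU₂⟩) (coeffTuple p F)
  have ha' : germ M V₁ z hzV₁ ∘ a = coeffTuple p F := funext ha
  let g₁ : Fin k → Sec M V₁ := fun j => res M (hV₁.trans inf_le_right) (g j)
  have hg₁ : germ M V₁ z hzV₁ ∘ g₁ = fun j => germ M U₂ z hzU₂ (g j) :=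
    funext fun j => germ_res _ _ _ _
  obtain ⟨V, hzV, hV, hVf⟩ := exists_res_eq_of_germs_eq hzV₁
    (s := fun i => res M (hV₁.trans inf_le_left) (f i)) (t := fun i => eval g₁ (form a i))
    (fun i => by rw [germ_res, map_eval, map_form, ha', hg₁, form_coeffTuple (hF i), hFf])
  refine ⟨V, hzV, ⟨⟨p, fun j => res M hV (g₁ j),
    fun i => res M (hV.trans (hV₁.trans inf_le_left)) (f i),
    fun c => res M hV (a c), fun x hx _ => ?_, hf.restrict _, fun i => ?_⟩⟩⟩
  · simp only [g₁, germ_res]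
    exact (hg x (hV₁ (hV hx)).2).1
  · have h2 := hVf i
    rw [res_res, map_eval, map_form] at h2
    exact h2

end Existence

/-! ### Gluing the local equations to a Cartier divisor -/

section Glue

open MvPolynomial

variable {M : LocallyRingedSpace.{u}} {X Z : Set M} {k r : ℕ} {K : Type v} [Field K]

/-- The ideal sheaf of the discriminant of the transversal type. -/
def discriminantSheaf (c : K →+* Sec M ⊤) (X Z : Set M) (k r : ℕ) : IdealSheaf M where
  ideal U := ⨅ (x : M) (hx : x ∈ U) (_ : x ∈ Z) (V : Opens M) (E : Expansion M X Z k r V)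
    (hxV : x ∈ V) (D : MvPolynomial (CoeffIdx k E.p) K) (_ : IsClassicalDiscriminant K k E.p D),
      (E.localIdeal c D x hxV).comap (germOn M Z U x hx)
  res_mem := by
    intro U V h s hs
    simp only [Ideal.mem_iInf, Ideal.mem_comap, RingHom.comp_apply, germ_res] at hs ⊢
    exact fun x hx => hs x (h hx)
  of_local := by
    intro U s hs
    simp only [Ideal.mem_iInf, Ideal.mem_comap, RingHom.comp_apply] at hs ⊢
    intro x hx
    obtain ⟨V, h, hV, H⟩ := hs x hx
    simp only [germ_res] at H
    exact H x hV

theorem mem_discriminantSheaf_iff {c : K →+* Sec M ⊤} {U : Opens M} {s : Sec M U} :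
    s ∈ (discriminantSheaf c X Z k r).ideal U ↔ ∀ (x : M) (hx : x ∈ U), x ∈ Z →
      ∀ (V : Opens M) (E : Expansion M X Z k r V) (hxV : x ∈ V)
        (D : MvPolynomial (CoeffIdx k E.p) K), IsClassicalDiscriminant K k E.p D →
          germOn M Z U x hx s ∈ E.localIdeal c D x hxV := by
  simp only [discriminantSheaf, Ideal.mem_iInf, Ideal.mem_comap]

/-- The sheaf imposes the conditions of all expansions at all points. By independence of the
choices, the local equation of one expansion meets them throughout its domain, so it is a section
and generates the image of the stalk. -/
theorem map_stalk_discriminantSheaf [Infinite K] (hS : IsSetup M X Z k r) (hr : 0 < r)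
    (c : K →+* Sec M ⊤) {U : Opens M} (E : Expansion M X Z k r U)
    {D : MvPolynomial (CoeffIdx k E.p) K} (hD : IsClassicalDiscriminant K k E.p D) {x : M}
    (hx : x ∈ U) (hxZ : x ∈ Z) :
    ((discriminantSheaf c X Z k r).stalk x).map (Ideal.Quotient.mk (idealAt M Z x)) =
      E.localIdeal c D x hx := by
  refine le_antisymm (Ideal.map_le_iff_le_comap.2 fun t ht => ?_)
    ((Ideal.span_singleton_le_iff_mem _).2 ?_)
  · obtain ⟨V, hxV, s, hs, rfl⟩ := (IdealSheaf.mem_stalk_iff _).1 ht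
    exact mem_discriminantSheaf_iff.1 hs x hxV hxZ U E hx D hD
  · refine Ideal.mem_map_of_mem _ (IdealSheaf.germ_mem_stalk _ ?_ x hx)
    exact mem_discriminantSheaf_iff.2 fun y hy hyZ V E' hyV D' hD' =>
      localEquation_mem_localIdeal hS hr E' E c hD' hD hyV hy hyZ

/-- An ideal containing the ideal of `Z` is the preimage of its image in `𝒪_{Z,x}`. This gives
uniqueness of the divisor. -/
theorem IdealSheaf.mem_stalk_iff_of_vanishing_le {J : IdealSheaf M}
    (hJ : ∀ U, (vanishing M Z).ideal U ≤ J.ideal U) {x : M} {t : Stalk M x} :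
    t ∈ J.stalk x ↔ Ideal.Quotient.mk (idealAt M Z x) t ∈
      (J.stalk x).map (Ideal.Quotient.mk (idealAt M Z x)) := by
  have hle : idealAt M Z x ≤ J.stalk x := fun t ht => by
    obtain ⟨U, hx, s, hs, rfl⟩ := (IdealSheaf.mem_stalk_iff _).1 ht
    exact J.germ_mem_stalk (hJ U hs) x hx
  rw [← Ideal.mem_comap, Ideal.comap_map_of_surjective _ Ideal.Quotient.mk_surjective,
    ← RingHom.ker_eq_comap_bot, Ideal.mk_ker, sup_eq_left.2 hle]

theorem IsSetup.hasTransversalDiscriminant [CharZero K] (hS : IsSetup M X Z k r)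
    (hM : HasGenericSmoothness M) (c : K →+* Sec M ⊤) :
    HasTransversalDiscriminant c X Z k r := by
  have hZne : Z.Nonempty := by
    obtain ⟨x, hx, rfl⟩ := hS.component
    exact ⟨x, mem_connectedComponentIn hx⟩
  have hdisc : ∀ (U : Opens M) (E : Expansion M X Z k r U), ((U : Set M) ∩ Z).Nonempty →
      ∃ D, IsClassicalDiscriminant K k E.p D := by
    intro U E hU
    obtain ⟨i, hi⟩ := hS.exists_two_le hM E hU
    exact exists_isClassicalDiscriminant (hS.one_le E hU) (hS.lt hZne) hi
  -- An index of a form of degree at least 2 exists, so there is at least one form.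
  have hr : 0 < r := by
    obtain ⟨z, hz⟩ := hZne
    obtain ⟨U, hzU, ⟨E⟩⟩ := hS.exists_expansion hz
    obtain ⟨i, -⟩ := hS.exists_two_le hM E ⟨z, hzU, hz⟩
    exact i.pos
  refine ⟨fun z hz => hS.exists_expansion hz, hdisc, ?_, ?_⟩
  · intro U U' E E' D D' hD hD' x hx hx' hxZ
    exact localIdeal_eq hS hr E E' c hD hD' hx hx' hxZ
  · have hvan : ∀ U, (vanishing M Z).ideal U ≤ (discriminantSheaf c X Z k r).ideal U := by
      intro U s hs
      refine mem_discriminantSheaf_iff.2 fun x hx hxZ V E hxV D hD => ?_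
      rw [RingHom.comp_apply,
        Ideal.Quotient.eq_zero_iff_mem.2 (IdealSheaf.germ_mem_stalk _ hs x hx)]
      exact Ideal.zero_mem _
    refine ⟨discriminantSheaf c X Z k r, ⟨⟨hvan, fun z hz => ?_⟩, ?_⟩, ?_⟩
    · obtain ⟨U, hzU, ⟨E⟩⟩ := hS.exists_expansion hz
      obtain ⟨D, hD⟩ := hdisc U E ⟨z, hzU, hz⟩
      exact ⟨U, E.localEquation c D, hzU, fun x hx hxZ =>
        ⟨map_stalk_discriminantSheaf hS hr c E hD hx hxZ,
          localEquation_mem_nonZeroDivisors hS hr E c hD hx⟩⟩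
    · exact fun U E D hD x hx hxZ => ⟨map_stalk_discriminantSheaf hS hr c E hD hx hxZ,
        localEquation_mem_nonZeroDivisors hS hr E c hD hx⟩
    · rintro J ⟨⟨hJvan, -⟩, hJ⟩
      have hstalk : ∀ x, J.stalk x = (discriminantSheaf c X Z k r).stalk x := by
        intro x
        ext t
        rw [IdealSheaf.mem_stalk_iff_of_vanishing_le hJvan,
          IdealSheaf.mem_stalk_iff_of_vanishing_le hvan]
        by_cases hxZ : x ∈ Z
        · obtain ⟨U, hxU, ⟨E⟩⟩ := hS.exists_expansion hxZ
          obtain ⟨D, hD⟩ := hdisc U E ⟨x, hxU, hxZ⟩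
          rw [(hJ U E D hD x hxU hxZ).1, map_stalk_discriminantSheaf hS hr c E hD hxU hxZ]
        -- Off the closed set `Z` the ring `𝒪_{Z,x}` is zero, so both stalks are the unit ideal.
        · have h0 : Ideal.Quotient.mk (idealAt M Z x) t = 0 :=
            Ideal.Quotient.eq_zero_iff_mem.2 (by
              rw [idealAt_eq_top hS.closed_Z hxZ]
              exact Submodule.mem_top)
          rw [h0]
          exact iff_of_true (Ideal.zero_mem _) (Ideal.zero_mem _)
      ext U s
      constructor
      · exact fun hs => IdealSheaf.mem_of_forall_germ_mem _ fun x hx => by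
          rw [← hstalk]; exact J.germ_mem_stalk hs x hx
      · exact fun hs => IdealSheaf.mem_of_forall_germ_mem _ fun x hx => by
          rw [hstalk]; exact IdealSheaf.germ_mem_stalk _ hs x hx

end Glue

/-! ## Generic smoothness of locally complete intersections in schemes -/

section SchemeCase

theorem mem_of_eval_linear_mem_sq {R : Type*} [CommRing R] {k : ℕ} {g : Fin k → R}
    (hg : IsQuasiRegular g) {c : Fin k → R}
    (hc : ∑ j, c j * g j ∈ Ideal.span (Set.range g) ^ 2) (j : Fin k) :
    c j ∈ Ideal.span (Set.range g) := by
  have h1 := hg 1 (linForm c) (linForm_isHomogeneous c) (by rwa [eval_linForm])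
  have h2 := MvPolynomial.mem_map_C_iff.1 h1 (Finsupp.single j 1)
  rwa [coeff_linForm] at h2

/-- After localising at a minimal prime `P` of `a`, the elements of `P` are nilpotent modulo `a`:
otherwise a prime over `a` avoiding both `s` and the complement of `P` would be strictly smaller
than `P`. -/
theorem exists_mul_pow_mem_of_mem_minimalPrimes {R : Type*} [CommRing R] {a P : Ideal R}
    (hP : P ∈ a.minimalPrimes) {s : R} (hs : s ∈ P) : ∃ d ∉ P, ∃ n : ℕ, d * s ^ n ∈ a := by
  have := hP.1.1
  by_contra! hcon
  obtain ⟨Q, hQ, haQ, hd⟩ := Ideal.exists_le_prime_disjoint a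
    (P.primeCompl ⊔ Submonoid.powers s) (by
      rw [Set.disjoint_left]
      intro y hy hy'
      obtain ⟨d, hd, _, ⟨n, rfl⟩, rfl⟩ := Submonoid.mem_sup.1 hy'
      exact hcon d hd n hy)
  have hQP : Q ≤ P := fun y hy => by
    by_contra hyP
    exact Set.disjoint_left.1 hd hy (Submonoid.mem_sup_left (T := Submonoid.powers s)
      (show y ∈ P.primeCompl from hyP))
  exact Set.disjoint_left.1 hd (hP.2 ⟨hQ, haQ⟩ hQP hs)
    (Submonoid.mem_sup_right (S := P.primeCompl) (Submonoid.mem_powers s))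

theorem mem_basicOpen_fromSpec_iff {M : Scheme.{u}} {U : M.Opens} (hU : IsAffineOpen U)
    (q : PrimeSpectrum Γ(M, U)) (hq : hU.fromSpec q ∈ U) (s : Γ(M, U)) :
    germ M.toLocallyRingedSpace U (hU.fromSpec q) hq s ∈ IsLocalRing.maximalIdeal _ ↔
      s ∈ q.asIdeal := by
  have h1 := M.mem_basicOpen s (hU.fromSpec q) hq
  have h2 : hU.fromSpec q ∈ M.basicOpen s ↔ q ∈ PrimeSpectrum.basicOpen s := by
    rw [← hU.fromSpec_preimage_basicOpen]
    rfl
  rw [PrimeSpectrum.mem_basicOpen] at h2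
  rw [IsLocalRing.mem_maximalIdeal, mem_nonunits_iff, ← not_iff_not, not_not]
  exact h1.symm.trans h2

/-- Take the generic point of a component of `Z` meeting `V`, that is, a minimal prime over the
ideal of `Z` in an affine chart. A function in that prime has a power which, times a unit near the
point, vanishes on `Z`; so the function itself vanishes on `Z` near the point. -/
theorem exists_idealAt_eq_maximalIdeal (M : Scheme.{u}) {Z : Set M.toLocallyRingedSpace}
    (hZ : IsClosed Z) {V : Opens M.toLocallyRingedSpace} (hV : ((V : Set _) ∩ Z).Nonempty) :
    ∃ x ∈ V, x ∈ Z ∧ idealAt M.toLocallyRingedSpace Z x =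
      IsLocalRing.maximalIdeal (Stalk M.toLocallyRingedSpace x) := by
  obtain ⟨z, hzV, hzZ⟩ := hV
  obtain ⟨U, hU, hzU, hUV⟩ := exists_isAffineOpen_mem_and_subset (X := M) (U := V) hzV
  have hmem : ∀ q, hU.fromSpec q ∈ U := fun q => by
    have : hU.fromSpec q ∈ Set.range hU.fromSpec := ⟨q, rfl⟩
    rwa [hU.range_fromSpec] at this
  have hsurj : ∀ y ∈ U, ∃ q, hU.fromSpec q = y := fun y hy => by
    have : y ∈ Set.range hU.fromSpec := by rwa [hU.range_fromSpec]
    exact this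
  set a : Ideal Γ(M, U) := (vanishing M.toLocallyRingedSpace Z).ideal U
  obtain ⟨q₀, rfl⟩ := hsurj z hzU
  have hle : ∀ q, hU.fromSpec q ∈ Z ↔ a ≤ q.asIdeal := by
    intro q
    constructor
    · intro hq s hs
      exact (mem_basicOpen_fromSpec_iff hU q (hmem q) s).1 (mem_vanishing_iff.1 hs _ (hmem q) hq)
    · intro hq
      by_contra hn
      obtain ⟨s, hs, hsq⟩ := hU.exists_basicOpen_le (V := ⟨Zᶜ, hZ.isOpen_compl⟩)
        ⟨hU.fromSpec q, hn⟩ (hmem q)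
      have h1 : s ∈ a := mem_vanishing_iff.2 fun y hy hyZ => by
        rw [IsLocalRing.mem_maximalIdeal, mem_nonunits_iff]
        intro hu
        exact hs ((M.mem_basicOpen s y hy).2 hu) hyZ
      have h2 := (mem_basicOpen_fromSpec_iff hU q (hmem q) s).2 (hq h1)
      exact (IsLocalRing.mem_maximalIdeal _).1 h2 ((M.mem_basicOpen s _ (hmem q)).1 hsq)
  have := q₀.isPrime
  obtain ⟨P, hP, -⟩ := Ideal.exists_minimalPrimes_le ((hle q₀).1 hzZ)
  let q : PrimeSpectrum Γ(M, U) := ⟨P, hP.1.1⟩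
  refine ⟨hU.fromSpec q, hUV (hmem q), (hle q).2 hP.1.2, ?_⟩
  refine le_antisymm (idealAt_le_maximalIdeal ((hle q).2 hP.1.2)) fun t ht => ?_
  let := TopCat.Presheaf.algebra_section_stalk M.presheaf (U := U) ⟨hU.fromSpec q, hmem q⟩
  have hloc := hU.isLocalization_stalk' q (hmem q)
  have hqp : q.asIdeal.IsPrime := q.isPrime
  obtain ⟨⟨s, b⟩, hsb⟩ := @IsLocalization.surj _ _ q.asIdeal.primeCompl _ _ _ hloc t
  have hb : IsUnit (germ M.toLocallyRingedSpace U _ (hmem q) (b : Γ(M, U))) :=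
    @IsLocalization.map_units _ _ q.asIdeal.primeCompl _ _ _ hloc b
  have hsb' : t * germ M.toLocallyRingedSpace U _ (hmem q) (b : Γ(M, U)) =
    germ M.toLocallyRingedSpace U _ (hmem q) s := hsb
  have hsq : s ∈ P := (mem_basicOpen_fromSpec_iff hU q (hmem q) s).1
    (hsb' ▸ Ideal.mul_mem_right _ _ ht)
  rw [← Ideal.mul_unit_mem_iff_mem _ hb, hsb']
  obtain ⟨d, hd, n, hn⟩ := exists_mul_pow_mem_of_mem_minimalPrimes hP hsq
  have hdq : IsUnit (germ M.toLocallyRingedSpace U _ (hmem q) d) := by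
    by_contra hcon
    exact hd ((mem_basicOpen_fromSpec_iff hU q (hmem q) d).1
      ((IsLocalRing.mem_maximalIdeal _).2 hcon))
  obtain ⟨W, hWU, hW, H⟩ := exists_isUnit_germ (hmem q) hdq
  refine germ_mem_idealAt_iff.2 ⟨W, hWU, hW, fun y hy hyZ => ?_⟩
  have h1 := mem_vanishing_iff.1 hn y (hWU hy) hyZ
  have hmax := (IsLocalRing.maximalIdeal.isMaximal (Stalk M.toLocallyRingedSpace y)).isPrime
  rw [map_mul, map_pow] at h1
  refine hmax.mem_of_pow_mem n ((hmax.mem_or_mem h1).resolve_left fun h2 => ?_)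
  exact (IsLocalRing.mem_maximalIdeal _).1 h2 (H y hy)

/-- At such a generic point the ideal of `Z` is the maximal ideal, and independence modulo its
square is quasi-regularity in degree one. -/
theorem hasGenericSmoothness_scheme (M : Scheme.{u}) :
    HasGenericSmoothness M.toLocallyRingedSpace := by
  intro Z k hZ hlci V hV
  obtain ⟨x, hxV, hxZ, hx⟩ := exists_idealAt_eq_maximalIdeal M hZ hV
  refine ⟨x, hxV, hxZ, fun g hg c hc j => ?_⟩
  rw [← hx, ← hg] at hc ⊢
  exact mem_of_eval_linear_mem_sq (isQuasiRegular_of_isLCI hlci hxZ hg) hc j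

end SchemeCase

/-! ## Holomorphic dependence of integrals on parameters, and Hadamard's lemma -/

section Hadamard

open scoped ContDiff Topology

variable {H G : Type v} [NormedAddCommGroup H] [NormedAddCommGroup G]

theorem continuousOn_segment {ψ : ℂ × H → G} {Ω : Set (ℂ × H)} (hψ : ContinuousOn ψ Ω) {x : H}
    (hx : ∀ s ∈ Set.Icc (0 : ℝ) 1, ((s : ℂ), x) ∈ Ω) :
    ContinuousOn (fun s : ℝ => ψ ((s : ℂ), x)) (Set.uIcc 0 1) := by
  rw [Set.uIcc_of_le zero_le_one]
  exact hψ.comp (by fun_prop) hx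

/-- Compactness of the segment: local bounds combine to one that is uniform in the integration
variable, as domination under the integral requires. -/
theorem exists_eventually_norm_le {ψ : ℂ × H → G} {Ω : Set (ℂ × H)} (hΩ : IsOpen Ω)
    (hψ : ContinuousOn ψ Ω) {x : H} (hx : ∀ s ∈ Set.Icc (0 : ℝ) 1, ((s : ℂ), x) ∈ Ω) :
    ∃ C : ℝ, ∀ᶠ y in 𝓝 x, ∀ s ∈ Set.Icc (0 : ℝ) 1, ‖ψ ((s : ℂ), y)‖ ≤ C := by
  refine isCompact_Icc.induction_on
    (p := fun S : Set ℝ => ∃ C : ℝ, ∀ᶠ y in 𝓝 x, ∀ s ∈ S, ‖ψ ((s : ℂ), y)‖ ≤ C) ?_ ?_ ?_ ?_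
  · exact ⟨0, by simp⟩
  · rintro S T hST ⟨C, hC⟩
    exact ⟨C, hC.mono fun y hy s hs => hy s (hST hs)⟩
  · rintro S T ⟨C, hC⟩ ⟨D, hD⟩
    refine ⟨max C D, (hC.and hD).mono fun y hy s hs => ?_⟩
    rcases hs with hs | hs
    · exact (hy.1 s hs).trans (le_max_left _ _)
    · exact (hy.2 s hs).trans (le_max_right _ _)
  · intro s hs
    have h1 : ContinuousAt (fun p : ℝ × H => ‖ψ ((p.1 : ℂ), p.2)‖) (s, x) := by
      have h2 : ContinuousAt ψ ((s : ℂ), x) := hψ.continuousAt (hΩ.mem_nhds (hx s hs))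
      exact (ContinuousAt.comp (f := fun p : ℝ × H => ((p.1 : ℂ), p.2)) h2 (by fun_prop)).norm
    have h2 := h1.eventually_lt_const (lt_add_one _)
    rw [nhds_prod_eq, Filter.eventually_prod_iff] at h2
    obtain ⟨p, hp, q, hq, hpq⟩ := h2
    exact ⟨{s | p s}, mem_nhdsWithin_of_mem_nhds hp, _, hq.mono fun y hy s hs => (hpq hs hy).le⟩

variable [NormedSpace ℂ H] [NormedSpace ℂ G]

theorem hasFDerivAt_integral_segment {ψ : ℂ × H → G} {Ω : Set (ℂ × H)} (hΩ : IsOpen Ω)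
    (hψ : ContDiffOn ℂ ∞ ψ Ω) {B : Set H} (hB : IsOpen B)
    (hBΩ : ∀ x ∈ B, ∀ s ∈ Set.Icc (0 : ℝ) 1, ((s : ℂ), x) ∈ Ω) {x : H} (hx : x ∈ B) :
    HasFDerivAt (fun x => ∫ s in (0 : ℝ)..1, ψ ((s : ℂ), x))
      (∫ s in (0 : ℝ)..1, (fderiv ℂ ψ ((s : ℂ), x)).comp (ContinuousLinearMap.inr ℂ ℂ H)) x := by
  have hψ' : ContinuousOn (fun z => (fderiv ℂ ψ z).comp (ContinuousLinearMap.inr ℂ ℂ H)) Ω :=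
    (hψ.continuousOn_fderiv_of_isOpen hΩ (by simp)).clm_comp continuousOn_const
  obtain ⟨C, hC⟩ := exists_eventually_norm_le hΩ hψ' (hBΩ x hx)
  have hN := Filter.inter_mem hC (hB.mem_nhds hx)
  have hIcc : ∀ s : ℝ, s ∈ Set.uIoc (0 : ℝ) 1 → s ∈ Set.Icc (0 : ℝ) 1 := fun s hs => by
    rw [Set.uIoc_of_le zero_le_one] at hs
    exact Set.Ioc_subset_Icc_self hs
  refine intervalIntegral.hasFDerivAt_integral_of_dominated_of_fderiv_le (𝕜 := ℂ)
    (F := fun x s => ψ ((s : ℂ), x))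
    (F' := fun x s => (fderiv ℂ ψ ((s : ℂ), x)).comp (ContinuousLinearMap.inr ℂ ℂ H))
    (bound := fun _ => C) hN ?_ ?_ ?_ ?_ ?_ ?_
  · filter_upwards [hB.mem_nhds hx] with y hy
    exact (continuousOn_segment hψ.continuousOn
      (hBΩ y hy)).intervalIntegrable.def'.aestronglyMeasurable
  · exact (continuousOn_segment hψ.continuousOn (hBΩ x hx)).intervalIntegrable
  · exact (continuousOn_segment hψ' (hBΩ x hx)).intervalIntegrable.def'.aestronglyMeasurable
  · exact Filter.Eventually.of_forall fun s hs y hy => hy.1 s (hIcc s hs)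
  · exact intervalIntegrable_const
  · refine Filter.Eventually.of_forall fun s hs y hy => ?_
    have h1 : HasFDerivAt ψ (fderiv ℂ ψ ((s : ℂ), y)) ((s : ℂ), y) :=
      ((hψ.differentiableOn (by simp)).differentiableAt
        (hΩ.mem_nhds (hBΩ y hy.2 s (hIcc s hs)))).hasFDerivAt
    exact h1.comp y (hasFDerivAt_prodMk_right (s : ℂ) y)

theorem contDiffOn_integral_segment {ψ : ℂ × H → G} {Ω : Set (ℂ × H)} (hΩ : IsOpen Ω)
    (hψ : ContDiffOn ℂ ∞ ψ Ω) {B : Set H} (hB : IsOpen B)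
    (hBΩ : ∀ x ∈ B, ∀ s ∈ Set.Icc (0 : ℝ) 1, ((s : ℂ), x) ∈ Ω) :
    ContDiffOn ℂ ∞ (fun x => ∫ s in (0 : ℝ)..1, ψ ((s : ℂ), x)) B := by
  rw [contDiffOn_infty]
  intro n
  -- The derivative is again an integral of this kind, with values in continuous linear maps; hence
  -- the target must vary.
  induction n generalizing G with
  | zero =>
    rw [Nat.cast_zero, contDiffOn_zero]
    exact fun x hx => (hasFDerivAt_integral_segment hΩ hψ hB hBΩ hx).continuousAt.continuousWithinAt
  | succ n ih =>
    rw [Nat.cast_add, Nat.cast_one, contDiffOn_succ_iff_fderiv_of_isOpen hB]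
    refine ⟨fun x hx => (hasFDerivAt_integral_segment hΩ hψ hB hBΩ
      hx).differentiableAt.differentiableWithinAt, by simp, ?_⟩
    have h1 : ContDiffOn ℂ ∞ (fun z => (fderiv ℂ ψ z).comp (ContinuousLinearMap.inr ℂ ℂ H)) Ω :=
      (hψ.fderiv_of_isOpen hΩ (by simp)).clm_comp contDiffOn_const
    exact (ih h1).congr fun x hx => (hasFDerivAt_integral_segment hΩ hψ hB hBΩ hx).fderiv

/-- Hadamard's lemma: a holomorphic function of `(w, t)` vanishing for `w = 0` is a combination of
the coordinates of `w`. -/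
theorem exists_eq_sum_mul_of_eq_zero {s : ℕ} {T : Type} [NormedAddCommGroup T] [NormedSpace ℂ T]
    {ρ : ℝ} {f : (Fin s → ℂ) × T → ℂ} (hf : ContDiffOn ℂ ∞ f (Metric.ball 0 ρ))
    (hf0 : ∀ t, (0, t) ∈ Metric.ball (0 : (Fin s → ℂ) × T) ρ → f (0, t) = 0) :
    ∃ c : Fin s → (Fin s → ℂ) × T → ℂ, (∀ i, ContDiffOn ℂ ∞ (c i) (Metric.ball 0 ρ)) ∧
      ∀ y ∈ Metric.ball (0 : (Fin s → ℂ) × T) ρ, f y = ∑ i, c i y * y.1 i := by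
  set B := Metric.ball (0 : (Fin s → ℂ) × T) ρ
  -- Contract `w` to zero with `t` fixed and integrate the derivative of `f` along the resulting
  -- segment.
  let L : ℂ × ((Fin s → ℂ) × T) → (Fin s → ℂ) × T := fun z => (z.1 • z.2.1, z.2.2)
  have hL : ContDiff ℂ ∞ L := by fun_prop
  have hΩ : IsOpen (L ⁻¹' B) := Metric.isOpen_ball.preimage hL.continuous
  have hBΩ : ∀ x ∈ B, ∀ σ ∈ Set.Icc (0 : ℝ) 1, ((σ : ℂ), x) ∈ L ⁻¹' B := by
    intro x hx σ hσ
    have h1 : ‖(σ : ℂ) • x.1‖ ≤ ‖x.1‖ := by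
      rw [norm_smul, Complex.norm_real, Real.norm_of_nonneg hσ.1]
      exact mul_le_of_le_one_left (norm_nonneg _) hσ.2
    simp only [B, Set.mem_preimage, Metric.mem_ball, dist_zero_right, Prod.norm_def] at hx ⊢
    exact lt_of_le_of_lt (max_le_max h1 le_rfl) hx
  have hf' : ContDiffOn ℂ ∞ (fderiv ℂ f) B := hf.fderiv_of_isOpen Metric.isOpen_ball (by simp)
  let e : Fin s → (Fin s → ℂ) × T := fun i => (Pi.single i 1, 0)
  let ψ : Fin s → ℂ × ((Fin s → ℂ) × T) → ℂ := fun i z => fderiv ℂ f (L z) (e i)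
  have hψ : ∀ i, ContDiffOn ℂ ∞ (ψ i) (L ⁻¹' B) := fun i =>
    (hf'.comp hL.contDiffOn (fun z hz => hz)).clm_apply contDiffOn_const
  refine ⟨fun i x => ∫ σ in (0 : ℝ)..1, ψ i ((σ : ℂ), x), fun i =>
    contDiffOn_integral_segment hΩ (hψ i) Metric.isOpen_ball hBΩ, fun y hy => ?_⟩
  have hd : ∀ σ ∈ Set.uIcc (0 : ℝ) 1, HasDerivAt (fun σ : ℝ => f (L ((σ : ℂ), y)))
      (∑ i, ψ i ((σ : ℂ), y) * y.1 i) σ := by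
    intro σ hσ
    rw [Set.uIcc_of_le zero_le_one] at hσ
    have h1 : HasFDerivAt f (fderiv ℂ f (L ((σ : ℂ), y))) (L ((σ : ℂ), y)) :=
      ((hf.differentiableOn (by simp)).differentiableAt
        (Metric.isOpen_ball.mem_nhds (hBΩ y hy σ hσ))).hasFDerivAt
    have h2 : HasDerivAt (fun z : ℂ => L (z, y)) (y.1, 0) (σ : ℂ) := by
      have h3 : HasDerivAt (fun z : ℂ => z • y.1) y.1 (σ : ℂ) := by
        simpa using (hasDerivAt_id (σ : ℂ)).smul_const y.1
      exact h3.prodMk (hasDerivAt_const _ y.2)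
    have h3 := (h1.comp_hasDerivAt (σ : ℂ) h2).comp_ofReal
    have h4 : ((y.1, 0) : (Fin s → ℂ) × T) = ∑ i, y.1 i • e i := by
      simp only [e, Prod.ext_iff, Prod.fst_sum, Prod.snd_sum, Prod.smul_mk, smul_zero,
        Finset.sum_const_zero, and_true]
      ext j
      simp [Pi.single_apply]
    rw [h4, map_sum] at h3
    refine h3.congr_deriv ?_
    exact Finset.sum_congr rfl fun i _ => by rw [map_smul, smul_eq_mul, mul_comm (y.1 i)]
  have hcont : ∀ i, ContinuousOn (fun σ : ℝ => ψ i ((σ : ℂ), y) * y.1 i) (Set.uIcc 0 1) := fun i =>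
    (continuousOn_segment (hψ i).continuousOn (hBΩ y hy)).mul continuousOn_const
  have h1 := intervalIntegral.integral_eq_sub_of_hasDerivAt hd
    (continuousOn_finsetSum _ fun i _ => hcont i).intervalIntegrable
  have h0 : f (L (((0 : ℝ) : ℂ), y)) = 0 := by
    have := hBΩ y hy 0 (by simp)
    simp only [L, Set.mem_preimage, Complex.ofReal_zero, zero_smul] at this ⊢
    exact hf0 _ this
  rw [h0, sub_zero,
    intervalIntegral.integral_finsetSum fun i _ => (hcont i).intervalIntegrable] at h1
  simp only [intervalIntegral.integral_mul_const] at h1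
  rw [h1]
  simp [L]

end Hadamard

/-! ## Holomorphic functions whose common zero locus has constant rank -/

section ConstantRank

open scoped ContDiff Topology

/-- The function `f` is holomorphic near `x`. -/
def HolAt {E : Type*} [NormedAddCommGroup E] [NormedSpace ℂ E] (f : E → ℂ) (x : E) : Prop :=
  ∀ᶠ y in 𝓝 x, ContDiffAt ℂ ∞ f y

/-- Every holomorphic function near `x` vanishing on the common zeros of the `g j` is a combination
of the `g j` near `x`. -/
def GeneratesAt {E : Type*} [NormedAddCommGroup E] [NormedSpace ℂ E] {k : ℕ} (g : Fin k → E → ℂ)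
    (x : E) : Prop :=
  ∀ h : E → ℂ, HolAt h x → (∀ᶠ y in 𝓝 x, (∀ j, g j y = 0) → h y = 0) →
    ∃ c : Fin k → E → ℂ, (∀ j, HolAt (c j) x) ∧ ∀ᶠ y in 𝓝 x, h y = ∑ j, c j y * g j y

theorem HolAt.self {E : Type*} [NormedAddCommGroup E] [NormedSpace ℂ E] {f : E → ℂ} {x : E}
    (h : HolAt f x) : ContDiffAt ℂ ∞ f x :=
  h.self_of_nhds

theorem HolAt.fderiv_apply {E : Type*} [NormedAddCommGroup E] [NormedSpace ℂ E] {f : E → ℂ} {x : E}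
    (h : HolAt f x) (v : E) : HolAt (fun y => fderiv ℂ f y v) x :=
  h.mono fun y hy => (hy.fderiv_right (m := ∞) (by simp)).clm_apply contDiffAt_const

theorem eq_zero_of_deriv_eq {k : ℕ} {u u' : ℝ → Fin k → ℂ} {K : ℝ}
    (hu : ∀ τ ∈ Set.Icc (0 : ℝ) 1, HasDerivAt u (u' τ) τ) (h0 : u 0 = 0)
    (hK : ∀ τ ∈ Set.Icc (0 : ℝ) 1, ‖u' τ‖ ≤ K * ‖u τ‖) : u 1 = 0 := by
  have h1 := norm_le_gronwallBound_of_norm_deriv_right_le (f := u) (f' := u') (δ := 0) (K := K)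
    (ε := 0) (a := 0) (b := 1) (fun τ hτ => (hu τ hτ).continuousAt.continuousWithinAt)
    (fun τ hτ => (hu τ (Set.Ico_subset_Icc_self hτ)).hasDerivWithinAt) (by simp [h0])
    (fun τ hτ => by simpa using hK τ (Set.Ico_subset_Icc_self hτ)) 1 (by simp)
  simpa [gronwallBound_ε0] using h1

/-- The derivatives of the `g j` along the slice vanish on the common zero locus, so by `hI` they
are combinations of the `g m`. Along a ray in the slice the vector of the `g j` thus satisfies a
homogeneous linear differential equation with bounded coefficients and starts at zero; Grönwall's
inequality makes it vanish. -/
theorem eq_zero_on_slice {s d k : ℕ} {g : Fin k → (Fin s → ℂ) × (Fin d → ℂ) → ℂ}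
    (hg : ∀ j, HolAt (g j) 0) (hg0 : ∀ j, g j 0 = 0)
    (hI : GeneratesAt g 0)
    (hd : ∀ᶠ y in 𝓝 0, (∀ j, g j y = 0) → ∀ j v, fderiv ℂ (g j) y (0, v) = 0) :
    ∀ᶠ t in 𝓝 0, ∀ j, g j (0, t) = 0 := by
  choose c hc hcg using fun (j : Fin k) (l : Fin d) =>
    hI (fun y => fderiv ℂ (g j) y (0, Pi.single l 1)) ((hg j).fderiv_apply _)
      (hd.mono fun y hy hy0 => hy hy0 j _)
  have hcb : ∀ j l m, ∀ᶠ y in 𝓝 0, ‖c j l m y‖ < ‖c j l m 0‖ + 1 := fun j l m =>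
    (hc j l m).self.continuousAt.norm.eventually_lt_const (lt_add_one _)
  have hall : ∀ᶠ y in 𝓝 (0 : (Fin s → ℂ) × (Fin d → ℂ)), ∀ j, ContDiffAt ℂ ∞ (g j) y ∧ ∀ l,
      (fderiv ℂ (g j) y (0, Pi.single l 1) = ∑ m, c j l m y * g m y) ∧
      ∀ m, ‖c j l m y‖ < ‖c j l m 0‖ + 1 := by
    refine Filter.eventually_all.2 fun j => (hg j).and (Filter.eventually_all.2 fun l =>
      (hcg j l).and (Filter.eventually_all.2 fun m => hcb j l m))
  obtain ⟨ρ, hρ, H⟩ := Metric.eventually_nhds_iff_ball.1 hall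
  refine Metric.eventually_nhds_iff_ball.2 ⟨ρ, hρ, fun t ht j => ?_⟩
  have hmem : ∀ τ ∈ Set.Icc (0 : ℝ) 1, ((0, (τ : ℂ) • t) : (Fin s → ℂ) × (Fin d → ℂ)) ∈
      Metric.ball 0 ρ := by
    intro τ hτ
    have h1 : ‖(τ : ℂ) • t‖ ≤ ‖t‖ := by
      rw [norm_smul, Complex.norm_real, Real.norm_of_nonneg hτ.1]
      exact mul_le_of_le_one_left (norm_nonneg _) hτ.2
    rw [Metric.mem_ball, dist_zero_right] at ht ⊢
    rw [Prod.norm_mk, norm_zero, max_eq_right (norm_nonneg _)]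
    exact h1.trans_lt ht
  have hder : ∀ τ ∈ Set.Icc (0 : ℝ) 1, HasDerivAt
      (fun τ : ℝ => fun j => g j (0, (τ : ℂ) • t))
      (fun j => ∑ l, t l * ∑ m, c j l m (0, (τ : ℂ) • t) * g m (0, (τ : ℂ) • t)) τ := by
    intro τ hτ
    refine hasDerivAt_pi.2 fun j => ?_
    obtain ⟨h1, h2⟩ := H _ (hmem τ hτ) j
    have h3 : HasDerivAt (fun z : ℂ => ((0, z • t) : (Fin s → ℂ) × (Fin d → ℂ))) (0, t)
        (τ : ℂ) := by
      have h4 : HasDerivAt (fun z : ℂ => z • t) t (τ : ℂ) := by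
        simpa using (hasDerivAt_id (τ : ℂ)).smul_const t
      exact (hasDerivAt_const _ _).prodMk h4
    have h5 := ((h1.differentiableAt (by simp)).hasFDerivAt.comp_hasDerivAt (τ : ℂ) h3).comp_ofReal
    refine h5.congr_deriv ?_
    have h6 : ((0, t) : (Fin s → ℂ) × (Fin d → ℂ)) = ∑ l, t l • (0, Pi.single l 1) := by
      simp only [Prod.ext_iff, Prod.fst_sum, Prod.snd_sum, Prod.smul_mk, smul_zero,
        Finset.sum_const_zero, true_and]
      ext j
      simp [Pi.single_apply]
    rw [h6, map_sum]
    exact Finset.sum_congr rfl fun l _ => by rw [map_smul, smul_eq_mul, (h2 l).1]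
  have := eq_zero_of_deriv_eq (K := ∑ j, ∑ l, ‖t l‖ * ∑ m, (‖c j l m 0‖ + 1)) hder
    (by
      ext j
      rw [Complex.ofReal_zero, zero_smul]
      exact hg0 j) fun τ hτ => ?_
  · simpa using congrFun this j
  · set u : Fin k → ℂ := fun j => g j (0, (τ : ℂ) • t)
    have h1 : ∀ j, ‖∑ l, t l * ∑ m, c j l m (0, (τ : ℂ) • t) * g m (0, (τ : ℂ) • t)‖ ≤
        (∑ l, ‖t l‖ * ∑ m, (‖c j l m 0‖ + 1)) * ‖u‖ := by
      intro j
      rw [Finset.sum_mul]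
      refine (norm_sum_le _ _).trans (Finset.sum_le_sum fun l _ => ?_)
      rw [norm_mul, mul_assoc, Finset.sum_mul]
      refine mul_le_mul_of_nonneg_left ((norm_sum_le _ _).trans (Finset.sum_le_sum fun m _ => ?_))
        (norm_nonneg _)
      rw [norm_mul]
      exact mul_le_mul (((H _ (hmem τ hτ) j).2 l).2 m).le (norm_le_pi_norm u m) (norm_nonneg _)
        (by positivity)
    refine (pi_norm_le_iff_of_nonneg (by positivity)).2 fun j => (h1 j).trans ?_
    refine mul_le_mul_of_nonneg_right ?_ (norm_nonneg _)
    exact Finset.single_le_sum (f := fun j => ∑ l, ‖t l‖ * ∑ m, (‖c j l m 0‖ + 1))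
      (fun j _ => by positivity) (Finset.mem_univ j)

theorem exists_eq_sum_of_slice {s d k : ℕ} {g : Fin k → (Fin s → ℂ) × (Fin d → ℂ) → ℂ}
    (hg : ∀ j, HolAt (g j) 0) (hg0 : ∀ j, g j 0 = 0)
    (hI : GeneratesAt g 0)
    (hd : ∀ᶠ y in 𝓝 0, (∀ j, g j y = 0) → ∀ j v, fderiv ℂ (g j) y (0, v) = 0) (j : Fin k) :
    ∃ c : Fin s → (Fin s → ℂ) × (Fin d → ℂ) → ℂ, (∀ i, HolAt (c i) 0) ∧
      ∀ᶠ y in 𝓝 0, g j y = ∑ i, c i y * y.1 i := by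
  have h0 := eq_zero_on_slice hg hg0 hI hd
  have h1 : ∀ᶠ y in 𝓝 (0 : (Fin s → ℂ) × (Fin d → ℂ)), ∀ j, g j (0, y.2) = 0 :=
    (continuous_snd.tendsto (0 : (Fin s → ℂ) × (Fin d → ℂ))).eventually h0
  obtain ⟨ρ, hρ, H⟩ := Metric.eventually_nhds_iff_ball.1 (h1.and (hg j))
  obtain ⟨c, hc, hcg⟩ := exists_eq_sum_mul_of_eq_zero (f := g j) (ρ := ρ)
    (fun y hy => (H y hy).2.contDiffWithinAt) (fun t ht => (H (0, t) ht).1 j)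
  refine ⟨c, fun i => ?_, ?_⟩
  · filter_upwards [Metric.ball_mem_nhds 0 hρ] with y hy
    exact (hc i).contDiffAt (Metric.isOpen_ball.mem_nhds hy)
  · filter_upwards [Metric.ball_mem_nhds 0 hρ] with y hy using hcg y hy

variable {E : Type*} [NormedAddCommGroup E] [NormedSpace ℂ E] [FiniteDimensional ℂ E]

/-- Linearly independent linear forms are part of a system of linear coordinates. -/
theorem exists_equiv_of_linearIndependent {s : ℕ} {l : Fin s → E →L[ℂ] ℂ}
    (hl : LinearIndependent ℂ l) :
    ∃ (d : ℕ) (e : E ≃L[ℂ] (Fin s → ℂ) × (Fin d → ℂ)), ∀ v i, (e v).1 i = l i v := by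
  let D : E →ₗ[ℂ] (Fin s → ℂ) := LinearMap.pi fun i => (l i).toLinearMap
  have hD : Function.Surjective D := by
    rw [← LinearMap.range_eq_top]
    by_contra hne
    obtain ⟨f, hf, hfD⟩ := Submodule.exists_le_ker_of_lt_top _ (lt_top_iff_ne_top.2 hne)
    refine hf ?_
    have h1 : ∑ i, f (Pi.single i 1) • l i = 0 := by
      ext v
      have h2 : f (D v) = 0 := hfD ⟨v, rfl⟩
      rw [LinearMap.pi_apply_eq_sum_univ f] at h2
      have h3 : ∀ i : Fin s, (fun j => if i = j then (1 : ℂ) else 0) = Pi.single i 1 := fun i => by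
        ext j
        simp [Pi.single_apply, eq_comm]
      simpa [D, mul_comm, h3] using h2
    have h3 := Fintype.linearIndependent_iff.1 hl _ h1
    refine LinearMap.pi_ext' fun i => LinearMap.ext_ring ?_
    simpa using h3 i
  obtain ⟨P, hP⟩ := LinearMap.exists_leftInverse_of_injective (LinearMap.ker D).subtype
    (Submodule.ker_subtype _)
  let b := (Module.finBasis ℂ (LinearMap.ker D)).equivFun
  let F : E →ₗ[ℂ] (Fin s → ℂ) × (Fin _ → ℂ) := D.prod (b.toLinearMap.comp P)
  have hPk : ∀ v : LinearMap.ker D, P v = v := fun v => LinearMap.congr_fun hP v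
  have hF : Function.Bijective F := by
    constructor
    · rw [injective_iff_map_eq_zero]
      intro v hv
      obtain ⟨h1, h2⟩ := Prod.ext_iff.1 hv
      have h3 : P v = 0 := b.map_eq_zero_iff.1 h2
      have h4 := hPk ⟨v, h1⟩
      rw [h3] at h4
      exact (congrArg Subtype.val h4).symm
    · rintro ⟨a, t⟩
      obtain ⟨v, rfl⟩ := hD a
      refine ⟨v + (b.symm t - P v : LinearMap.ker D), Prod.ext ?_ ?_⟩
      · change D _ = D v
        rw [map_add, LinearMap.mem_ker.1 (b.symm t - P v).2, add_zero]
      · change b (P _) = t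
        rw [map_add, hPk]
        simp
  exact ⟨_, (LinearEquiv.ofBijective F hF).toContinuousLinearEquiv, fun v i => rfl⟩

/-- Functions with linearly independent differentials are part of a system of coordinates. -/
theorem exists_coordinates {s : ℕ} {w : Fin s → E → ℂ} {x : E} (hw : ∀ i, HolAt (w i) x)
    (hw0 : ∀ i, w i x = 0) (hl : LinearIndependent ℂ fun i => fderiv ℂ (w i) x) :
    ∃ (d : ℕ) (Ψ : OpenPartialHomeomorph E ((Fin s → ℂ) × (Fin d → ℂ))), x ∈ Ψ.source ∧ Ψ x = 0 ∧
      (∀ᶠ y in 𝓝 x, ContDiffAt ℂ ∞ Ψ y) ∧ (∀ᶠ z in 𝓝 0, ContDiffAt ℂ ∞ Ψ.symm z) ∧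
      ∀ y i, (Ψ y).1 i = w i y := by
  obtain ⟨d, e, he⟩ := exists_equiv_of_linearIndependent hl
  let ψ : E → (Fin s → ℂ) × (Fin d → ℂ) := fun y => (fun i => w i y, (e (y - x)).2)
  have hψ : ∀ᶠ y in 𝓝 x, ContDiffAt ℂ ∞ ψ y := by
    filter_upwards [Filter.eventually_all.2 hw] with y hy
    refine (contDiffAt_pi.2 hy).prodMk ?_
    fun_prop
  have hψx : HasFDerivAt ψ (e : E →L[ℂ] (Fin s → ℂ) × (Fin d → ℂ)) x := by
    have h1 : HasFDerivAt ψ ((ContinuousLinearMap.pi fun i => fderiv ℂ (w i) x).prod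
        ((ContinuousLinearMap.snd ℂ (Fin s → ℂ) (Fin d → ℂ)).comp
          (e : E →L[ℂ] (Fin s → ℂ) × (Fin d → ℂ)))) x := by
      refine (hasFDerivAt_pi.2 fun i =>
        ((hw i).self.differentiableAt (by simp)).hasFDerivAt).prodMk ?_
      exact ((ContinuousLinearMap.snd ℂ (Fin s → ℂ) (Fin d → ℂ)).comp
          (e : E →L[ℂ] (Fin s → ℂ) × (Fin d → ℂ))).hasFDerivAt.comp x
          ((hasFDerivAt_id x).sub_const x)
    refine h1.congr_fderiv ?_
    refine ContinuousLinearMap.ext fun v => Prod.ext ?_ rfl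
    ext i
    exact (he v i).symm
  have : CompleteSpace E := FiniteDimensional.complete ℂ E
  have hne : (∞ : WithTop ℕ∞) ≠ 0 := by simp
  set Ψ := hψ.self_of_nhds.toOpenPartialHomeomorph ψ hψx hne
  have hΨ : (Ψ : E → (Fin s → ℂ) × (Fin d → ℂ)) = ψ := rfl
  have hx : x ∈ Ψ.source := hψ.self_of_nhds.mem_toOpenPartialHomeomorph_source hψx hne
  have hx0 : Ψ x = 0 := by
    rw [hΨ]
    refine Prod.ext (funext fun i => hw0 i) ?_
    simp [ψ]
  refine ⟨d, Ψ, hx, hx0, hψ, ?_, fun y i => rfl⟩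
  -- Invertibility of the differential is an open condition, which gives smoothness of the inverse
  -- near 0 and not only at 0.
  have h1 : ∀ᶠ y in 𝓝 x, ∃ e' : E ≃L[ℂ] (Fin s → ℂ) × (Fin d → ℂ), HasFDerivAt ψ
      (e' : E →L[ℂ] (Fin s → ℂ) × (Fin d → ℂ)) y := by
    have h2 : ContinuousAt (fderiv ℂ ψ) x :=
      (hψ.self_of_nhds.fderiv_right (m := 0) (by simp)).continuousAt
    have h3 : Set.range ((↑) : (E ≃L[ℂ] (Fin s → ℂ) × (Fin d → ℂ)) → _) ∈ 𝓝 (fderiv ℂ ψ x) := by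
      rw [hψx.fderiv]
      exact ContinuousLinearEquiv.nhds e
    filter_upwards [h2 h3, hψ] with y hy hy'
    obtain ⟨e', he'⟩ := hy
    exact ⟨e', he' ▸ (hy'.differentiableAt (by simp)).hasFDerivAt⟩
  have h0 : (0 : (Fin s → ℂ) × (Fin d → ℂ)) ∈ Ψ.target := hx0 ▸ Ψ.map_source hx
  have h2 : Filter.Tendsto Ψ.symm (𝓝 0) (𝓝 x) := by
    have h3 := Ψ.continuousAt_symm h0
    rw [ContinuousAt, ← hx0, Ψ.left_inv hx, hx0] at h3
    exact h3
  filter_upwards [h2.eventually h1, h2.eventually hψ, Ψ.open_target.mem_nhds h0] with z hz hz' hzt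
  obtain ⟨e', he'⟩ := hz
  exact Ψ.contDiffAt_symm hzt he' hz'

/-- Take the `g (σ i)` as first coordinates. The rank condition then says that at common zeros no `g
j` varies in the remaining directions, so every `g j` vanishes where the first coordinates do, and
Hadamard's lemma expresses it through them. -/
theorem exists_eq_sum_of_constantRank {s k : ℕ} {g : Fin k → E → ℂ} {σ : Fin s → Fin k} {x : E}
    (hg : ∀ j, HolAt (g j) x) (hg0 : ∀ j, g j x = 0) (hI : GeneratesAt g x)
    (hl : LinearIndependent ℂ fun i => fderiv ℂ (g (σ i)) x)
    (hr : ∀ᶠ y in 𝓝 x, (∀ j, g j y = 0) → ∀ j, fderiv ℂ (g j) y ∈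
      Submodule.span ℂ (Set.range fun i => fderiv ℂ (g (σ i)) y)) (j : Fin k) :
    ∃ c : Fin s → E → ℂ, (∀ i, HolAt (c i) x) ∧
      ∀ᶠ y in 𝓝 x, g j y = ∑ i, c i y * g (σ i) y := by
  obtain ⟨d, Ψ, hx, hx0, hΨ, hΦ, hw⟩ :=
    exists_coordinates (fun i => hg (σ i)) (fun i => hg0 (σ i)) hl
  have h0 : (0 : (Fin s → ℂ) × (Fin d → ℂ)) ∈ Ψ.target := hx0 ▸ Ψ.map_source hx
  have hΦ0 : Ψ.symm 0 = x := by rw [← hx0, Ψ.left_inv hx]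
  have htΦ : Filter.Tendsto Ψ.symm (𝓝 0) (𝓝 x) := by
    have h3 := Ψ.continuousAt_symm h0
    rwa [ContinuousAt, hΦ0] at h3
  have htΨ : Filter.Tendsto Ψ (𝓝 x) (𝓝 0) := by
    have h3 := Ψ.continuousAt hx
    rwa [ContinuousAt, hx0] at h3
  have htgt := Ψ.open_target.mem_nhds h0
  have hsrc := Ψ.open_source.mem_nhds hx
  have hpull : ∀ f : E → ℂ, HolAt f x → HolAt (fun z => f (Ψ.symm z)) 0 := fun f hf => by
    filter_upwards [htΦ.eventually hf, hΦ] with z hz hz' using hz.comp z hz'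
  have hpush : ∀ f : (Fin s → ℂ) × (Fin d → ℂ) → ℂ, HolAt f 0 → HolAt (fun y => f (Ψ y)) x :=
    fun f hf => by
      filter_upwards [htΨ.eventually hf, hΨ] with z hz hz' using hz.comp z hz'
  have hI' : GeneratesAt (fun j z => g j (Ψ.symm z)) 0 := by
    intro h hh hh0
    obtain ⟨c, hc, hcg⟩ := hI (fun y => h (Ψ y)) (hpush h hh) (by
      filter_upwards [htΨ.eventually hh0, hsrc] with y hy hys hyg
      exact hy (by rwa [Ψ.left_inv hys]))
    refine ⟨fun j z => c j (Ψ.symm z), fun j => hpull _ (hc j), ?_⟩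
    filter_upwards [htΦ.eventually hcg, htgt] with z hz hzt
    rwa [Ψ.right_inv hzt] at hz
  have hd : ∀ᶠ z in 𝓝 0, (∀ j, g j (Ψ.symm z) = 0) → ∀ j v,
      fderiv ℂ (fun z => g j (Ψ.symm z)) z (0, v) = 0 := by
    have h1 : ∀ᶠ y in 𝓝 x, ∀ j, ContDiffAt ℂ ∞ (g j) y := Filter.eventually_all.2 hg
    filter_upwards [htΦ.eventually hr, htΦ.eventually h1, hΦ, htgt] with z hz hzg hzΦ hzt hz0 j v
    have h2 : ∀ j, fderiv ℂ (fun z => g j (Ψ.symm z)) z (0, v) =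
        fderiv ℂ (g j) (Ψ.symm z) (fderiv ℂ Ψ.symm z (0, v)) := fun j => by
      have h3 := ((hzg j).differentiableAt (by simp)).hasFDerivAt.comp z
        (hzΦ.differentiableAt (by simp)).hasFDerivAt
      exact DFunLike.congr_fun h3.fderiv _
    have h3 : ∀ i, fderiv ℂ (g (σ i)) (Ψ.symm z) (fderiv ℂ Ψ.symm z (0, v)) = 0 := fun i => by
      rw [← h2]
      have h4 : (fun z => g (σ i) (Ψ.symm z)) =ᶠ[𝓝 z] fun z => z.1 i := by
        filter_upwards [Ψ.open_target.mem_nhds hzt] with y hy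
        rw [← hw, Ψ.right_inv hy]
      rw [h4.fderiv_eq]
      have h5 : HasFDerivAt (fun z : (Fin s → ℂ) × (Fin d → ℂ) => z.1 i)
          ((ContinuousLinearMap.proj i).comp (ContinuousLinearMap.fst ℂ _ _)) z :=
        ((ContinuousLinearMap.proj (R := ℂ) (φ := fun _ : Fin s => ℂ) i).comp
          (ContinuousLinearMap.fst ℂ (Fin s → ℂ) (Fin d → ℂ))).hasFDerivAt
      rw [h5.fderiv]
      rfl
    rw [h2]
    refine Submodule.span_induction (p := fun L _ => L (fderiv ℂ Ψ.symm z (0, v)) = 0)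
      ?_ ?_ ?_ ?_ (hz hz0 j)
    · rintro _ ⟨i, rfl⟩
      exact h3 i
    · rfl
    · intro L L' _ _ h h'
      rw [add_apply, h, h', add_zero]
    · intro a L _ h
      rw [smul_apply, h, smul_zero]
  obtain ⟨c, hc, hcg⟩ := exists_eq_sum_of_slice (g := fun j z => g j (Ψ.symm z))
    (fun j => hpull _ (hg j)) (fun j => by rw [hΦ0, hg0]) hI' hd j
  refine ⟨fun i y => c i (Ψ y), fun i => hpush _ (hc i), ?_⟩
  filter_upwards [htΨ.eventually hcg, hsrc] with y hy hys
  rw [Ψ.left_inv hys] at hy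
  rw [hy]
  exact Finset.sum_congr rfl fun i _ => by rw [hw]

/-- At a suitable point of the common zero locus, some of the functions have independent
differentials and the others are combinations of these. -/
theorem exists_point_of_generates {k : ℕ} {g : Fin k → E → ℂ} {O : Set E} (hO : IsOpen O)
    (hg : ∀ j, ∀ y ∈ O, ContDiffAt ℂ ∞ (g j) y) (hne : ∃ y ∈ O, ∀ j, g j y = 0)
    (hI : ∀ y ∈ O, (∀ j, g j y = 0) → GeneratesAt g y) :
    ∃ x ∈ O, (∀ j, g j x = 0) ∧ ∃ (s : ℕ) (σ : Fin s → Fin k),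
      LinearIndependent ℂ (fun i => fderiv ℂ (g (σ i)) x) ∧ ∀ j, ∃ c : Fin s → E → ℂ,
        (∀ i, HolAt (c i) x) ∧ ∀ᶠ y in 𝓝 x, g j y = ∑ i, c i y * g (σ i) y := by
  classical
  let P : ℕ → Prop := fun s => ∃ x ∈ O, (∀ j, g j x = 0) ∧ ∃ σ : Fin s → Fin k,
    LinearIndependent ℂ (fun i => fderiv ℂ (g (σ i)) x)
  have hb : ∀ s, P s → s ≤ k := by
    rintro s ⟨x, -, -, σ, hσ⟩
    have : Function.Injective σ := fun i i' h => hσ.injective (by simp only [h])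
    simpa using Fintype.card_le_of_injective σ this
  have hP0 : P 0 := by
    obtain ⟨y, hy, hy0⟩ := hne
    exact ⟨y, hy, hy0, Fin.elim0, linearIndependent_empty_type⟩
  -- Choose the largest number of independent differentials occurring at a common zero in `O`;
  -- independence is open, so the rank stays constant on the zero locus near `x`.
  set s := Nat.findGreatest P k
  obtain ⟨x, hx, hx0, σ, hσ⟩ : P s := Nat.findGreatest_spec (Nat.zero_le k) hP0
  have hmax : ¬ P (s + 1) := fun h =>
    Nat.findGreatest_is_greatest (Nat.lt_succ_self s) (hb _ h) h
  have hgx : ∀ j, HolAt (g j) x := fun j => Filter.eventually_of_mem (hO.mem_nhds hx) (hg j)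
  refine ⟨x, hx, hx0, s, σ, hσ, fun j =>
    exists_eq_sum_of_constantRank hgx hx0 (hI x hx hx0) hσ ?_ j⟩
  have h1 : ContinuousAt (fun y => fun i => fderiv ℂ (g (σ i)) y) x :=
    continuousAt_pi.2 fun i => ((hgx (σ i)).self.fderiv_right (m := 0) (by simp)).continuousAt
  have h2 : ∀ᶠ y in 𝓝 x, LinearIndependent ℂ fun i => fderiv ℂ (g (σ i)) y :=
    h1.eventually (isOpen_setOfPred_linearIndependent.mem_nhds hσ)
  filter_upwards [h2, hO.mem_nhds hx] with y hy hyO hy0 j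
  by_contra hcon
  refine hmax ⟨y, hyO, hy0, Fin.cons j σ, ?_⟩
  have h3 : LinearIndependent ℂ (Fin.cons (fderiv ℂ (g j) y) (fun i => fderiv ℂ (g (σ i)) y) :
    Fin (s + 1) → E →L[ℂ] ℂ) := linearIndependent_finCons.2 ⟨hy, hcon⟩
  refine (congrArg (fun v : Fin (s + 1) → E →L[ℂ] ℂ => LinearIndependent ℂ v) ?_).mp h3
  ext i : 1
  refine Fin.cases ?_ (fun i => ?_) i <;> simp

end ConstantRank

/-! ## Sections of the structure sheaf of a complex manifold in a chart -/

section Chart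

open scoped Manifold ContDiff Topology

variable {E : Type v} [NormedAddCommGroup E] [NormedSpace ℂ E]
  {M : Type} [TopologicalSpace M] [ChartedSpace E M]

/-- The value of a section at a point. -/
def value (W : Opens M) (x : M) (hx : x ∈ W) : Sec (complexSpace E M) W →+* ℂ :=
  ContMDiffMap.evalRingHom (I := 𝓘(ℂ, E)) (I' := 𝓘(ℂ)) (n := ∞) (R := ℂ) (⟨x, hx⟩ : W)

theorem value_res {W W' : Opens M} (h : W ≤ W') {x : M} (hx : x ∈ W)
    (s : Sec (complexSpace E M) W') : value W x hx (res _ h s) = value W' x (h hx) s :=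
  rfl

theorem germ_mem_maximalIdeal_iff {W : Opens M} {x : M} (hx : x ∈ W)
    (s : Sec (complexSpace E M) W) :
    germ (complexSpace E M) W x hx s ∈ IsLocalRing.maximalIdeal (Stalk (complexSpace E M) x) ↔
      value W x hx s = 0 := by
  rw [IsLocalRing.mem_maximalIdeal, mem_nonunits_iff]
  have h1 := smoothSheafCommRing.isUnit_stalk_iff (𝓘(ℂ, E)) (M := M)
    (germ (complexSpace E M) W x hx s)
  have h2 : smoothSheafCommRing.eval 𝓘(ℂ, E) 𝓘(ℂ) M ℂ x (germ (complexSpace E M) W x hx s) =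
    value W x hx s := smoothSheafCommRing.eval_germ W x hx s
  rw [RingHom.mem_ker, h2] at h1
  exact (not_congr h1).trans not_not

/-- A section of the structure sheaf as a function on the model space, extended by zero. -/
def secFun (φ : OpenPartialHomeomorph M E) {W : Opens M}
    (s : Sec (complexSpace E M) W) (e : E) : ℂ :=
  open Classical in if h : φ.symm e ∈ W then value W (φ.symm e) h s else 0

theorem secFun_eq (φ : OpenPartialHomeomorph M E) {W : Opens M}
    (s : Sec (complexSpace E M) W) {e : E} (h : φ.symm e ∈ W) :
    secFun φ s e = value W (φ.symm e) h s :=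
  dif_pos h

theorem secFun_apply (φ : OpenPartialHomeomorph M E) {W : Opens M}
    (s : Sec (complexSpace E M) W) {x : M} (hxs : x ∈ φ.source) (hx : x ∈ W) :
    secFun φ s (φ x) = value W x hx s := by
  have h : ∀ (y : M) (hy : y ∈ W), y = x → value W y hy s = value W x hx s := by
    rintro y hy rfl
    rfl
  rw [secFun_eq φ s (by rwa [φ.left_inv hxs])]
  exact h _ _ (φ.left_inv hxs)

theorem contDiffAt_secFun {φ : OpenPartialHomeomorph M E}
    (hφ : φ ∈ IsManifold.maximalAtlas 𝓘(ℂ, E) ∞ M) {W : Opens M}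
    (s : Sec (complexSpace E M) W) {e : E}
    (he : e ∈ φ.target) (h : φ.symm e ∈ W) :
    ContDiffAt ℂ ∞ (secFun φ s) e := by
  classical
  let f : M → ℂ := fun x => if h : x ∈ W then value W x h s else 0
  have h1 : ContMDiffAt 𝓘(ℂ, E) 𝓘(ℂ) ∞ f (φ.symm e) := by
    have h2 : ContMDiffAt 𝓘(ℂ, E) 𝓘(ℂ) ∞ (fun x : W => f x) ⟨_, h⟩ := by
      have h3 : (fun x : W => f x) = fun x : W => value W x x.2 s := by
        ext x
        exact dif_pos x.2
      rw [h3]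
      have h4 : ContMDiff 𝓘(ℂ, E) 𝓘(ℂ) ∞ (fun x : W => value W x x.2 s) :=
        smoothSheaf.contMDiff_section (IM := 𝓘(ℂ, E)) (I := 𝓘(ℂ)) (N := ℂ) (U := op W) s
      exact h4.contMDiffAt
    exact contMDiffAt_subtype_iff.1 h2
  have h5 : ContMDiffAt 𝓘(ℂ, E) 𝓘(ℂ, E) ∞ φ.symm e :=
    (contMDiffOn_symm_of_mem_maximalAtlas hφ).contMDiffAt
      (φ.open_target.mem_nhds he)
  exact (h1.comp e h5).contDiffAt

theorem holAt_secFun {φ : OpenPartialHomeomorph M E}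
    (hφ : φ ∈ IsManifold.maximalAtlas 𝓘(ℂ, E) ∞ M) {W : Opens M}
    (s : Sec (complexSpace E M) W) {e : E}
    (he : e ∈ φ.target) (h : φ.symm e ∈ W) :
    HolAt (secFun φ s) e := by
  have h1 := (φ.continuousAt_symm he).preimage_mem_nhds (W.isOpen.mem_nhds h)
  filter_upwards [h1, φ.open_target.mem_nhds he] with y hy hy'
  exact contDiffAt_secFun hφ s hy' hy

theorem exists_sec_of_holAt {φ : OpenPartialHomeomorph M E}
    (hφ : φ ∈ IsManifold.maximalAtlas 𝓘(ℂ, E) ∞ M) {f : E → ℂ} {e : E}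
    (he : e ∈ φ.target) (hf : HolAt f e) :
    ∃ (W : Opens M) (_ : φ.symm e ∈ W) (s : Sec (complexSpace E M) W),
      ∀ (x : M) (hx : x ∈ W), x ∈ φ.source ∧ value W x hx s = f (φ x) := by
  obtain ⟨O, hO, hOo, heO⟩ := eventually_nhds_iff.1 hf
  have hW := φ.isOpen_inter_preimage hOo
  let W : Opens M := ⟨_, hW⟩
  have hs : ContMDiff 𝓘(ℂ, E) 𝓘(ℂ) ∞ (fun x : W => f (φ (x : M))) := by
    intro x
    have hx : (x : M) ∈ φ.source ∩ φ ⁻¹' O := x.2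
    have h1 : ContMDiffAt 𝓘(ℂ, E) 𝓘(ℂ, E) ∞ φ (x : M) :=
      (contMDiffOn_of_mem_maximalAtlas hφ).contMDiffAt
        (φ.open_source.mem_nhds hx.1)
    have h2 : ContMDiffAt 𝓘(ℂ, E) 𝓘(ℂ) ∞ (fun x => f (φ x)) (x : M) :=
      (hO _ hx.2).contMDiffAt.comp (x : M) h1
    exact contMDiffAt_subtype_iff.2 h2
  have heW : φ.symm e ∈ W := by
    refine ⟨φ.map_target he, ?_⟩
    rw [Set.mem_preimage, φ.right_inv he]
    exact heO
  exact ⟨W, heW, (⟨_, hs⟩ : C^∞⟮𝓘(ℂ, E), W; 𝓘(ℂ), ℂ⟯), fun x hx => ⟨hx.1, rfl⟩⟩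

end Chart

/-! ## Generic smoothness of locally complete intersections in complex manifolds -/

section ManifoldCase

open scoped Manifold ContDiff Topology

/-- Independence modulo `𝔪²` passes from one system of generators to the other, since the base
change is invertible modulo the ideal, hence modulo `𝔪`. -/
theorem IsQuasiRegular.mem_of_span_eq {R : Type*} [CommRing R] [IsLocalRing R] {k : ℕ}
    {g g' : Fin k → R} (hg' : IsQuasiRegular g') (h : Ideal.span (Set.range g) =
      Ideal.span (Set.range g')) (hm : Ideal.span (Set.range g) ≤ IsLocalRing.maximalIdeal R)
    (H : ∀ c : Fin k → R, ∑ j, c j * g j ∈ IsLocalRing.maximalIdeal R ^ 2 →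
      ∀ j, c j ∈ IsLocalRing.maximalIdeal R)
    {c : Fin k → R} (hc : ∑ j, c j * g' j ∈ IsLocalRing.maximalIdeal R ^ 2) (j : Fin k) :
    c j ∈ IsLocalRing.maximalIdeal R := by
  obtain ⟨T, hT⟩ := exists_matrix_of_span_le h.le
  obtain ⟨T', hT'⟩ := exists_matrix_of_span_le h.ge
  have h1 := hg'.map_mul_map_eq_one hT' hT
  have h2 : ∀ l, Matrix.vecMul c T' l ∈ IsLocalRing.maximalIdeal R := by
    refine H _ ?_
    have h3 : ∑ l, Matrix.vecMul c T' l * g l = ∑ j, c j * g' j := by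
      have h4 := Matrix.dotProduct_mulVec c T' g
      rw [hT'] at h4
      exact h4.symm
    rwa [h3]
  have h3 : Matrix.vecMul (Matrix.vecMul c T') T j ∈ IsLocalRing.maximalIdeal R := by
    rw [Matrix.vecMul, dotProduct]
    exact Ideal.sum_mem _ fun l _ => Ideal.mul_mem_right _ _ (h2 l)
  have h4 : ∀ i l, (T' * T - 1 : Matrix _ _ R) i l ∈ IsLocalRing.maximalIdeal R := by
    intro i l
    refine hm ?_
    rw [h, ← Ideal.Quotient.eq_zero_iff_mem]
    rw [← Matrix.map_mul] at h1
    have h6 := congrFun (congrFun h1 i) l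
    rw [Matrix.map_apply] at h6
    rw [Matrix.sub_apply, map_sub, h6, Matrix.one_apply, Matrix.one_apply]
    split_ifs <;> simp
  have h6 : c j = Matrix.vecMul (Matrix.vecMul c T') T j -
      Matrix.vecMul c (T' * T - 1 : Matrix _ _ R) j := by
    rw [Matrix.vecMul_sub, Matrix.vecMul_vecMul, Matrix.vecMul_one, Pi.sub_apply, sub_sub_cancel]
  rw [h6]
  refine Ideal.sub_mem _ h3 ?_
  rw [Matrix.vecMul, dotProduct]
  exact (Ideal.sum_mem _ fun l _ => Ideal.mul_mem_left _ _ (h4 l j))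

variable {E : Type v} [NormedAddCommGroup E] [NormedSpace ℂ E]
  {M : Type} [TopologicalSpace M] [ChartedSpace E M]

theorem hasFDerivAt_mul_of_eq_zero {f g : E → ℂ} {x : E} (hf : DifferentiableAt ℂ f x)
    (hg : DifferentiableAt ℂ g x) (hg0 : g x = 0) :
    HasFDerivAt (fun y => f y * g y) (f x • fderiv ℂ g x) x := by
  refine (hf.hasFDerivAt.mul hg.hasFDerivAt).congr_fderiv ?_
  ext v
  simp [hg0]

theorem germ_eq_of_value_eq {U W : Opens M} {x : M} (hU : x ∈ U) (hW : x ∈ W)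
    {s : Sec (complexSpace E M) U} {t : Sec (complexSpace E M) W}
    (h : ∀ᶠ y in 𝓝 x, ∀ (hyU : y ∈ U) (hyW : y ∈ W), value U y hyU s = value W y hyW t) :
    germ (complexSpace E M) U x hU s = germ (complexSpace E M) W x hW t := by
  obtain ⟨O, hO, hOo, hxO⟩ := eventually_nhds_iff.1 h
  let V : Opens M := U ⊓ W ⊓ ⟨O, hOo⟩
  have hV : x ∈ V := ⟨⟨hU, hW⟩, hxO⟩
  have hVU : V ≤ U := inf_le_left.trans inf_le_left
  have hVW : V ≤ W := inf_le_left.trans inf_le_right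
  have h1 : res (complexSpace E M) hVU s = res (complexSpace E M) hVW t := by
    refine ContMDiffMap.ext fun y => ?_
    exact hO y y.2.2 (hVU y.2) (hVW y.2)
  have h2 := congrArg (germ (complexSpace E M) V x hV) h1
  rwa [germ_res, germ_res] at h2

theorem eventually_value_eq {U W : Opens M} {x : M} (hU : x ∈ U) (hW : x ∈ W)
    {s : Sec (complexSpace E M) U} {t : Sec (complexSpace E M) W}
    (h : germ (complexSpace E M) U x hU s = germ (complexSpace E M) W x hW t) :
    ∀ᶠ y in 𝓝 x, ∃ (hyU : y ∈ U) (hyW : y ∈ W), value U y hyU s = value W y hyW t := by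
  obtain ⟨(V : Opens M), hV, iU, iW, e⟩ := exists_res_eq_of_germ_eq hU hW h
  filter_upwards [V.isOpen.mem_nhds hV] with y hy
  exact ⟨iU hy, iW hy, congrArg (value V y hy) e⟩

theorem eventually_secFun_eq (φ : OpenPartialHomeomorph M E) {U W : Opens M} {e : E}
    (he : e ∈ φ.target) (hU : φ.symm e ∈ U) (hW : φ.symm e ∈ W)
    {s : Sec (complexSpace E M) U} {t : Sec (complexSpace E M) W}
    (h : germ (complexSpace E M) U _ hU s = germ (complexSpace E M) W _ hW t) :
    secFun φ s =ᶠ[𝓝 e] secFun φ t := by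
  filter_upwards [(φ.continuousAt_symm he).eventually (eventually_value_eq hU hW h)] with y hy
  obtain ⟨hyU, hyW, hy⟩ := hy
  rw [secFun_eq φ s hyU, secFun_eq φ t hyW, hy]

/-- By the product rule, a product of two functions vanishing at a point has zero differential
there; sums are handled by linearity. -/
theorem exists_fderiv_secFun_eq_zero {φ : OpenPartialHomeomorph M E}
    (hφ : φ ∈ IsManifold.maximalAtlas 𝓘(ℂ, E) ∞ M) {e : E} (he : e ∈ φ.target)
    {t : Stalk (complexSpace E M) (φ.symm e)}
    (ht : t ∈ IsLocalRing.maximalIdeal (Stalk (complexSpace E M) (φ.symm e)) ^ 2) :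
    ∃ (W : Opens M) (hW : φ.symm e ∈ W) (s : Sec (complexSpace E M) W),
      germ (complexSpace E M) W _ hW s = t ∧ fderiv ℂ (secFun φ s) e = 0 := by
  rw [pow_two] at ht
  have hnhds : ∀ W : Opens M, φ.symm e ∈ W → ∀ᶠ y in 𝓝 e, φ.symm y ∈ W := fun W hW =>
    (φ.continuousAt_symm he).eventually (W.isOpen.mem_nhds hW)
  refine Submodule.mul_induction_on ht ?_ ?_
  · intro a ha b hb
    obtain ⟨(U : Opens M), hU, a, rfl⟩ := exists_sec_of_germ (M := complexSpace E M) _ a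
    obtain ⟨(V : Opens M), hV, b, rfl⟩ := exists_sec_of_germ (M := complexSpace E M) _ b
    have hUV : φ.symm e ∈ U ⊓ V := ⟨hU, hV⟩
    refine ⟨U ⊓ V, hUV, res (complexSpace E M) inf_le_left a *
      res (complexSpace E M) inf_le_right b, ?_, ?_⟩
    · rw [map_mul, germ_res, germ_res]
    · have h1 : secFun φ (res (complexSpace E M) inf_le_left a *
          res (complexSpace E M) inf_le_right b : Sec (complexSpace E M) (U ⊓ V)) =ᶠ[𝓝 e]
          fun y => secFun φ a y * secFun φ b y := by
        filter_upwards [hnhds _ hUV] with y hy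
        rw [secFun_eq φ _ hy, secFun_eq φ a hy.1, secFun_eq φ b hy.2, map_mul, value_res, value_res]
      rw [h1.fderiv_eq]
      have h2 := hasFDerivAt_mul_of_eq_zero
        ((contDiffAt_secFun hφ a he hU).differentiableAt (by simp))
        ((contDiffAt_secFun hφ b he hV).differentiableAt (by simp))
        ((secFun_eq φ b hV).trans ((germ_mem_maximalIdeal_iff (M := M) hV b).1 hb))
      refine h2.fderiv.trans ?_
      ext v
      simp [secFun_eq φ a hU, (germ_mem_maximalIdeal_iff (M := M) hU a).1 ha]
  · rintro _ _ ⟨U, hU, a, rfl, ha⟩ ⟨V, hV, b, rfl, hb⟩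
    have hUV : φ.symm e ∈ U ⊓ V := ⟨hU, hV⟩
    refine ⟨U ⊓ V, hUV, res (complexSpace E M) inf_le_left a +
      res (complexSpace E M) inf_le_right b, ?_, ?_⟩
    · rw [map_add, germ_res, germ_res]
    · have h1 : secFun φ (res (complexSpace E M) inf_le_left a +
          res (complexSpace E M) inf_le_right b : Sec (complexSpace E M) (U ⊓ V)) =ᶠ[𝓝 e]
          fun y => secFun φ a y + secFun φ b y := by
        filter_upwards [hnhds _ hUV] with y hy
        rw [secFun_eq φ _ hy, secFun_eq φ a hy.1, secFun_eq φ b hy.2, map_add, value_res, value_res]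
      rw [h1.fderiv_eq]
      have h2 := ((contDiffAt_secFun hφ a he hU).differentiableAt (by simp)).hasFDerivAt.add
        ((contDiffAt_secFun hφ b he hV).differentiableAt (by simp)).hasFDerivAt
      refine h2.fderiv.trans ?_
      rw [ha, hb, add_zero]

/-- If the differentials of the functions `g j`, vanishing at a point, are linearly independent
then their germs are linearly independent modulo the square of the maximal ideal. -/
theorem mem_maximalIdeal_of_linearIndependent {k : ℕ} {φ : OpenPartialHomeomorph M E}
    (hφ : φ ∈ IsManifold.maximalAtlas 𝓘(ℂ, E) ∞ M) {e : E}
    (he : e ∈ φ.target) {U : Opens M} (hU : φ.symm e ∈ U)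
    {g : Fin k → Sec (complexSpace E M) U} (hg : ∀ j, secFun φ (g j) e = 0)
    (hl : LinearIndependent ℂ fun j => fderiv ℂ (secFun φ (g j)) e)
    {c : Fin k → Stalk (complexSpace E M) (φ.symm e)}
    (hc : ∑ j, c j * germ (complexSpace E M) U _ hU (g j) ∈
      IsLocalRing.maximalIdeal (Stalk (complexSpace E M) (φ.symm e)) ^ 2) (j : Fin k) :
    c j ∈ IsLocalRing.maximalIdeal (Stalk (complexSpace E M) (φ.symm e)) := by
  obtain ⟨W, hW, s, hs, hs0⟩ := exists_fderiv_secFun_eq_zero hφ he hc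
  obtain ⟨(V : Opens M), hVU, hV, γ, hγ⟩ :=
    exists_secs_of_germs (M := complexSpace E M) (U₀ := U) hU c
  have h1 : germ (complexSpace E M) W _ hW s = germ (complexSpace E M) V _ hV
      (∑ j, γ j * res (complexSpace E M) hVU (g j)) := by
    rw [hs, map_sum]
    exact Finset.sum_congr rfl fun j _ => by rw [map_mul, germ_res, hγ]
  have h2 : secFun φ s =ᶠ[𝓝 e] fun y => ∑ j, secFun φ (γ j) y * secFun φ (g j) y := by
    refine (eventually_secFun_eq φ he hW hV h1).trans ?_
    filter_upwards [(φ.continuousAt_symm he).eventually (V.isOpen.mem_nhds hV)] with y hy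
    rw [secFun_eq φ _ hy, map_sum]
    exact Finset.sum_congr rfl fun j _ => by
      rw [map_mul, value_res, secFun_eq φ _ hy, secFun_eq φ _ (hVU hy)]
  have h3 : HasFDerivAt (fun y => ∑ j, secFun φ (γ j) y * secFun φ (g j) y)
      (∑ j, secFun φ (γ j) e • fderiv ℂ (secFun φ (g j)) e) e := by
    refine HasFDerivAt.fun_sum fun j _ => ?_
    exact hasFDerivAt_mul_of_eq_zero
      ((contDiffAt_secFun hφ (γ j) he hV).differentiableAt (by simp))
      ((contDiffAt_secFun hφ (g j) he hU).differentiableAt (by simp)) (hg j)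
  rw [h2.fderiv_eq, h3.fderiv] at hs0
  have h4 := Fintype.linearIndependent_iff.1 hl _ hs0 j
  rw [secFun_eq φ _ hV] at h4
  rw [← hγ]
  exact (germ_mem_maximalIdeal_iff (M := M) hV (γ j)).2 h4

/-- Near `e` the set `Z` lies in the zero locus of the `g j`, so a function vanishing on that locus
has its germ in the ideal of `Z`, hence in the span of the germs of the `g j`. -/
theorem generatesAt_secFun {k : ℕ} {Z : Set M} {φ : OpenPartialHomeomorph M E}
    (hφ : φ ∈ IsManifold.maximalAtlas 𝓘(ℂ, E) ∞ M) {e : E} (he : e ∈ φ.target)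
    {U : Opens M} (hU : φ.symm e ∈ U) {g : Fin k → Sec (complexSpace E M) U}
    (hg : Ideal.span (Set.range fun j => germ (complexSpace E M) U _ hU (g j)) =
      idealAt (complexSpace E M) Z (φ.symm e))
    (hz : ∀ᶠ y in 𝓝 e, φ.symm y ∈ Z → ∀ j, secFun φ (g j) y = 0) :
    GeneratesAt (fun j => secFun φ (g j)) e := by
  intro h hh hh0
  obtain ⟨W, hW, s, hs⟩ := exists_sec_of_holAt hφ he hh
  have h1 : germ (complexSpace E M) W _ hW s ∈ idealAt (complexSpace E M) Z (φ.symm e) := by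
    have h2 : ∀ᶠ x in 𝓝 (φ.symm e), x ∈ Z → h (φ x) = 0 := by
      have h3 := φ.continuousAt (φ.map_target he)
      rw [ContinuousAt, φ.right_inv he] at h3
      filter_upwards [h3.eventually hh0, h3.eventually hz,
        φ.open_source.mem_nhds (φ.map_target he)] with x hx hx' hxs hxZ
      rw [φ.left_inv hxs] at hx'
      exact hx (hx' hxZ)
    obtain ⟨O, hO, hOo, heO⟩ := eventually_nhds_iff.1 h2
    refine germ_mem_idealAt_iff.2 ⟨W ⊓ ⟨O, hOo⟩, inf_le_left, ⟨hW, heO⟩, fun y hy hyZ => ?_⟩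
    refine (germ_mem_maximalIdeal_iff (M := M) hy.1 s).2 ?_
    rw [(hs y hy.1).2]
    exact hO y hy.2 hyZ
  rw [← hg, Ideal.mem_span_range_iff_exists_fun] at h1
  obtain ⟨c, hc⟩ := h1
  obtain ⟨(V : Opens M), hVU, hV, γ, hγ⟩ :=
    exists_secs_of_germs (M := complexSpace E M) (U₀ := U) hU c
  have h2 : germ (complexSpace E M) W _ hW s = germ (complexSpace E M) V _ hV
      (∑ j, γ j * res (complexSpace E M) hVU (g j)) := by
    rw [← hc, map_sum]
    exact Finset.sum_congr rfl fun j _ => by rw [map_mul, germ_res, hγ]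
  refine ⟨fun j => secFun φ (γ j), fun j => holAt_secFun hφ (γ j) he hV, ?_⟩
  filter_upwards [eventually_secFun_eq φ he hW hV h2, φ.open_target.mem_nhds he,
    (φ.continuousAt_symm he).eventually (W.isOpen.mem_nhds hW),
    (φ.continuousAt_symm he).eventually (V.isOpen.mem_nhds hV)] with y hy hyt hyW hyV
  rw [secFun_eq φ _ hyW, (hs _ hyW).2, φ.right_inv hyt, secFun_eq φ _ hyV, map_sum] at hy
  rw [hy]
  exact Finset.sum_congr rfl fun j _ => by
    rw [map_mul, value_res, secFun_eq φ _ hyV, secFun_eq φ _ (hVU hyV)]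

/-- If some of the quasi-regular germs `g j` generate the others, then there are no others. -/
theorem surjective_of_eq_sum {R : Type*} [CommRing R] [IsLocalRing R] {k s : ℕ} {g : Fin k → R}
    (hg : IsQuasiRegular g) (hm : Ideal.span (Set.range g) ≤ IsLocalRing.maximalIdeal R)
    {σ : Fin s → Fin k} (h : ∀ j, ∃ c : Fin s → R, g j = ∑ i, c i * g (σ i)) :
    Function.Surjective σ := by
  intro j
  by_contra! hj
  obtain ⟨c, hc⟩ := h j
  -- If `j` were missed by `σ`, this linear relation would have coefficient 1 at `j`, forcing 1 into
  -- the maximal ideal.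
  have h1 := mem_of_eval_linear_mem_sq hg
    (c := Pi.single j 1 - ∑ i, Pi.single (σ i) (c i)) (by
      simp only [Pi.sub_apply, Finset.sum_apply, sub_mul, Finset.sum_sub_distrib, Finset.sum_mul]
      rw [Finset.sum_comm]
      simp only [Pi.single_apply, ite_mul, zero_mul, one_mul, Finset.sum_ite_eq',
        Finset.mem_univ, if_true]
      rw [← hc, sub_self]
      exact Ideal.zero_mem _) j
  have h2 : ∀ i, (Pi.single (σ i) (c i) : Fin k → R) j = 0 := fun i =>
    Pi.single_eq_of_ne (hj i).symm _
  rw [Pi.sub_apply, Finset.sum_apply, Finset.sum_eq_zero fun i _ => h2 i, sub_zero,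
    Pi.single_eq_same] at h1
  exact (IsLocalRing.mem_maximalIdeal _).1 (hm h1) isUnit_one

/-- At a point of `Z` of maximal rank, those generators with independent differentials generate the
others; quasi-regularity then leaves no others. So all `k` differentials are independent there, and
independence modulo `𝔪²` follows for every system of `k` generators. -/
theorem hasGenericSmoothness_complexSpace [FiniteDimensional ℂ E]
    [IsManifold 𝓘(ℂ, E) ((⊤ : ℕ∞) : WithTop ℕ∞) M] :
    HasGenericSmoothness (complexSpace E M) := by
  rintro (Z : Set M) k hZ hlci (V : Opens M) ⟨(z : M), hzV, hzZ⟩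
  obtain ⟨(U : Opens M), f, hzU, hf⟩ := hlci z hzZ
  obtain ⟨φ, hφ, hzφ⟩ : ∃ φ ∈ IsManifold.maximalAtlas 𝓘(ℂ, E) ∞ M, z ∈ φ.source :=
    ⟨_, IsManifold.chart_mem_maximalAtlas z, mem_chart_source E z⟩
  let O : Set E := φ.target ∩ φ.symm ⁻¹' ((V ⊓ U : Opens M) : Set M)
  have hO : IsOpen O := φ.isOpen_inter_preimage_symm (V ⊓ U : Opens M).isOpen
  -- The common zeros of the `f j` in `U` are exactly the points of `Z`, since off `Z` the germs
  -- generate the unit ideal.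
  have hval : ∀ (x : M) (hx : x ∈ U), x ∈ Z ↔ ∀ j, value U x hx (f j) = 0 := by
    intro x hx
    constructor
    · intro hxZ j
      refine (germ_mem_maximalIdeal_iff (M := M) hx (f j)).1 (idealAt_le_maximalIdeal hxZ ?_)
      rw [← (hf x hx).1]
      exact Ideal.subset_span ⟨j, rfl⟩
    · intro h
      by_contra hxZ
      have h1 := (hf x hx).1
      rw [idealAt_eq_top hZ hxZ] at h1
      refine (IsLocalRing.maximalIdeal.isMaximal (Stalk (complexSpace E M) x)).ne_top
        (top_le_iff.1 (h1.ge.trans (Ideal.span_le.2 ?_)))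
      rintro _ ⟨j, rfl⟩
      exact (germ_mem_maximalIdeal_iff (M := M) hx (f j)).2 (h j)
  have hfun : ∀ y ∈ O, φ.symm y ∈ Z ↔ ∀ j, secFun φ (f j) y = 0 := by
    intro y hy
    rw [hval _ hy.2.2]
    exact forall_congr' fun j => by rw [secFun_eq φ _ hy.2.2]
  have hzO : φ z ∈ O := by
    refine ⟨φ.map_source hzφ, ?_⟩
    rw [Set.mem_preimage, φ.left_inv hzφ]
    exact ⟨hzV, hzU⟩
  have hz0 : ∀ j, secFun φ (f j) (φ z) = 0 := by
    refine (hfun _ hzO).1 ?_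
    rwa [φ.left_inv hzφ]
  obtain ⟨e, he, he0, s, σ, hl, hσ⟩ := exists_point_of_generates hO
    (fun j y hy => contDiffAt_secFun hφ (f j) hy.1 hy.2.2) ⟨φ z, hzO, hz0⟩
    (fun y hy _ => generatesAt_secFun hφ hy.1 hy.2.2 (hf _ hy.2.2).1 (by
      filter_upwards [hO.mem_nhds hy] with y' hy' using (hfun y' hy').1))
  have hxZ : φ.symm e ∈ Z := (hfun e he).2 he0
  have hx : φ.symm e ∈ U := he.2.2
  have hspan := (hf _ hx).1
  set G : Fin k → Stalk (complexSpace E M) (φ.symm e) :=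
    fun j => germ (complexSpace E M) U _ hx (f j)
  have hGm : Ideal.span (Set.range G) ≤ IsLocalRing.maximalIdeal _ :=
    hspan.le.trans (idealAt_le_maximalIdeal hxZ)
  have hsurj : Function.Surjective σ := by
    refine surjective_of_eq_sum (isQuasiRegular_of_isLCI hlci hxZ hspan) hGm fun j => ?_
    obtain ⟨c, hc, hcg⟩ := hσ j
    choose W hW γ hγ using fun i => exists_sec_of_holAt hφ he.1 (hc i)
    refine ⟨fun i => germ (complexSpace E M) (W i) _ (hW i) (γ i), ?_⟩
    obtain ⟨(N : Opens M), hNU, hN, δ, hδ⟩ :=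
      exists_secs_of_germs (M := complexSpace E M) (U₀ := U) hx fun i =>
        germ (complexSpace E M) (W i) _ (hW i) (γ i)
    have h1 : G j = germ (complexSpace E M) N _ hN
        (∑ i, δ i * res (complexSpace E M) hNU (f (σ i))) := by
      refine germ_eq_of_value_eq hx hN ?_
      have h3 := φ.continuousAt (φ.map_target he.1)
      rw [ContinuousAt, φ.right_inv he.1] at h3
      filter_upwards [Filter.eventually_all.2 fun i =>
          eventually_value_eq (M := M) hN (hW i) (hδ i),
        h3.eventually hcg, φ.open_source.mem_nhds (φ.map_target he.1)] with x hxδ hxc hxs hxU hxN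
      rw [secFun_apply φ (f j) hxs hxU] at hxc
      rw [hxc, map_sum]
      refine Finset.sum_congr rfl fun i _ => ?_
      obtain ⟨_, hxW, hi⟩ := hxδ i
      rw [map_mul, value_res, hi, (hγ i x hxW).2, secFun_apply φ (f (σ i)) hxs hxU]
    rw [h1, map_sum]
    exact Finset.sum_congr rfl fun i _ => by rw [map_mul, germ_res, hδ]
  have hl' : LinearIndependent ℂ fun j => fderiv ℂ (secFun φ (f j)) e := by
    have hinj : Function.Injective σ := fun i i' h => hl.injective (by simp only [h])
    let σ' := Equiv.ofBijective σ ⟨hinj, hsurj⟩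
    exact (linearIndependent_equiv σ').1 hl
  refine ⟨φ.symm e, he.2.1, hxZ, fun g' hg' c hc j => ?_⟩
  exact (isQuasiRegular_of_isLCI hlci hxZ hg').mem_of_span_eq (hspan.trans hg'.symm) hGm
    (fun c hc => mem_maximalIdeal_of_linearIndependent hφ he.1 hx he0 hl' hc) hc j

end ManifoldCase

end TransversalDiscriminant

end

theorem mainTheorem5 :
    (∀ (K : Type u) [Field K] [IsAlgClosed K] [CharZero K]
      (M : AlgebraicGeometry.Scheme.{u}) (π : M ⟶ AlgebraicGeometry.Spec (CommRingCat.of K))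
      [AlgebraicGeometry.Smooth π] (X Z : Set M.toLocallyRingedSpace) (k r : ℕ),
      TransversalDiscriminant.IsSetup M.toLocallyRingedSpace X Z k r →
      TransversalDiscriminant.HasTransversalDiscriminant
        (TransversalDiscriminant.schemeConst π) X Z k r) ∧
    (∀ (E : Type v) [NormedAddCommGroup E] [NormedSpace ℂ E] [FiniteDimensional ℂ E]
      (M : Type) [TopologicalSpace M] [ChartedSpace E M]
      [IsManifold (modelWithCornersSelf ℂ E) ((⊤ : ℕ∞) : WithTop ℕ∞) M]
      (X Z : Set (TransversalDiscriminant.complexSpace E M)) (k r : ℕ),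
      TransversalDiscriminant.IsSetup (TransversalDiscriminant.complexSpace E M) X Z k r →
      TransversalDiscriminant.HasTransversalDiscriminant
        (TransversalDiscriminant.manifoldConst E M) X Z k r) := by
  refine ⟨fun K _ _ _ M π _ X Z k r hS => ?_, fun E _ _ _ M _ _ _ X Z k r hS => ?_⟩
  · exact hS.hasTransversalDiscriminant
      (TransversalDiscriminant.hasGenericSmoothness_scheme M) _
  · exact hS.hasTransversalDiscriminant
      TransversalDiscriminant.hasGenericSmoothness_complexSpace _
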